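/- Let $(N^{m+1},h)$ be a smooth Riemannian manifold, let $\phi:(M^m,g)\to(N^{m+1},h)$ be a smooth isometric immersion ($g=\phi^*h$) of a smooth manifold $M^m$, let $\xi$ be a smooth unit normal vector field along $\phi$, and let $\eta=H\xi$ be the mean curvature vector field, $\eta=\frac1m\,\mathrm{Trace}_g B$, where $B(X,Y)=\nabla^N_XY-\nabla^M_XY$ is the second fundamental form. Let $f:M\to(0,\infty)$ be smooth. The map $\phi$ is called $f$-biharmonic if it is a critical point of the $f$-bienergy: for every compact $\Omega\subseteq M$ and every smooth variation $(\phi_t)_{t\in\mathbb R}$ of $\phi_0=\phi$ through maps $M\to N$ with $\phi_t=\phi$ outside $\Omega$, $$\frac{d}{dt}\Big|_{t=0}\ \frac12\int_\Omega f\,|\tau(\phi_t)|^2\,v_g=0,$$ where $\tau(\phi_t)=\mathrm{Trace}_g\nabla d\phi_t$ is the tension field and $v_g$ the Riemannian volume of $g$. **Theorem 3.1.** The hypersurface $\phi$ is $f$-biharmonic if and only if, on $M$, $$\begin{cases}\Delta(fH)-fH\,\big(|A|^2-\mathrm{Ric}^N(\xi,\xi)\big)=0,\\[2pt] A(\mathrm{grad}(fH))+fH\,\big(\tfrac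 m2\,\mathrm{grad}\,H-(\mathrm{Ric}^N(\xi))^{\top}\big)=0.\end{cases}$$ Here $A$ is the shape operator with respect to $\xi$, $g(AX,Y)=h(B(X,Y),\xi)$; $\Delta=\mathrm{div}\,\mathrm{grad}$ and $\mathrm{grad}$ are the Laplacian and the gradient of $(M,g)$; $\mathrm{Ric}^N(\xi,\cdot)$ is the Ricci tensor of $N$ (positive on round spheres), and $\mathrm{Ric}^N:T_qN\to T_qN$ also denotes the Ricci operator, $\langle\mathrm{Ric}^N(Z),W\rangle=\mathrm{Ric}^N(Z,W)$; and $v^\top$ is the component of $v$ tangent to the hypersurface. -/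

import Mathlib

open Bundle MeasureTheory
open scoped Manifold ContDiff

noncomputable section

/-! ## Riemannian geometry in coordinates on an open set of `ℝⁿ` -/

/-- The `i`-th partial derivative of a real function on `ℝⁿ`. -/
def partialD {n : ℕ} (i : Fin n) (F : EuclideanSpace ℝ (Fin n) → ℝ)
    (u : EuclideanSpace ℝ (Fin n)) : ℝ :=
  fderiv ℝ F u (EuclideanSpace.single i 1)

/-- The Christoffel symbols `Γᵏᵢⱼ = ½ gᵏˡ (∂ᵢ gⱼₗ + ∂ⱼ gᵢₗ - ∂ₗ gᵢⱼ)` of the Levi-Civita connection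
of a metric with coefficient matrix `G`, so that `∇_{∂ᵢ} ∂ⱼ = Γᵏᵢⱼ ∂ₖ`. -/
def christoffel {n : ℕ} (G : EuclideanSpace ℝ (Fin n) → Matrix (Fin n) (Fin n) ℝ)
    (k i j : Fin n) (u : EuclideanSpace ℝ (Fin n)) : ℝ :=
  (1 / 2) * ∑ l, (G u)⁻¹ k l *
    (partialD i (fun w => G w j l) u + partialD j (fun w => G w i l) u
      - partialD l (fun w => G w i j) u)

/-- The coefficients `Rˡₖᵢⱼ` of the curvature operator
`R(X, Y)Z = [∇_X, ∇_Y]Z - ∇_{[X, Y]}Z`, that is, `R(∂ᵢ, ∂ⱼ)∂ₖ = Rˡₖᵢⱼ ∂ₗ`. -/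
def curvatureCoeff {n : ℕ} (G : EuclideanSpace ℝ (Fin n) → Matrix (Fin n) (Fin n) ℝ)
    (l k i j : Fin n) (u : EuclideanSpace ℝ (Fin n)) : ℝ :=
  partialD i (christoffel G l j k) u - partialD j (christoffel G l i k) u
    + ∑ s, (christoffel G l i s u * christoffel G s j k u
      - christoffel G l j s u * christoffel G s i k u)

/-- The coefficients of the Ricci tensor, `Ric(∂ⱼ, ∂ₖ) = trace (X ↦ R(X, ∂ⱼ)∂ₖ)`
(positive on round spheres). -/
def ricciCoeff {n : ℕ} (G : EuclideanSpace ℝ (Fin n) → Matrix (Fin n) (Fin n) ℝ)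
    (j k : Fin n) (u : EuclideanSpace ℝ (Fin n)) : ℝ :=
  ∑ i, curvatureCoeff G i k i j u

/-! ## Riemannian manifolds

The manifolds are smooth, without boundary, modelled on `ℝⁿ`.  A tangent vector at `x` is, in
Mathlib, the vector of `ℝⁿ` of its components with respect to the preferred chart at `x`; the
tensors below are evaluated at `x` through their components in that chart. -/

/-- A smooth Riemannian metric on a manifold of dimension `n`. -/
abbrev RMetric (n : ℕ) (M : Type*) [TopologicalSpace M] [ChartedSpace (EuclideanSpace ℝ (Fin n)) M]
    [IsManifold (𝓡 n) ∞ M] :=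
  ContMDiffRiemannianMetric (𝓡 n) ∞ (EuclideanSpace ℝ (Fin n))
    (fun x : M => TangentSpace (𝓡 n) x)

section Manifold

variable {m n : ℕ}
  {M : Type*} [TopologicalSpace M] [ChartedSpace (EuclideanSpace ℝ (Fin m)) M]
  [IsManifold (𝓡 m) ∞ M]
  {N : Type*} [TopologicalSpace N] [ChartedSpace (EuclideanSpace ℝ (Fin n)) N]
  [IsManifold (𝓡 n) ∞ N]

/-- The components of a tangent vector in the preferred chart at its base point. -/
def comps {x : M} (X : TangentSpace (𝓡 m) x) : EuclideanSpace ℝ (Fin m) := X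

/-- The tangent vector at `x` with given components in the preferred chart at `x`. -/
def ofComps (x : M) (X : Fin m → ℝ) : TangentSpace (𝓡 m) x :=
  (WithLp.toLp 2 X : EuclideanSpace ℝ (Fin m))

/-- The coordinate vector `∂ᵢ` at `x`, for the preferred chart at `x`. -/
def basisVec (x : M) (i : Fin m) : TangentSpace (𝓡 m) x :=
  (EuclideanSpace.single i 1 : EuclideanSpace ℝ (Fin m))

variable (M) in
/-- The coordinate vector field `∂ᵢ` of the chart at `x`, at the point with coordinates `u`. -/
def coordField (x : M) (u : EuclideanSpace ℝ (Fin m)) (i : Fin m) :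
    TangentSpace (𝓡 m) ((extChartAt (𝓡 m) x).symm u) :=
  mfderiv 𝓘(ℝ, EuclideanSpace ℝ (Fin m)) (𝓡 m) (extChartAt (𝓡 m) x).symm u
    (EuclideanSpace.single i 1 : EuclideanSpace ℝ (Fin m))

/-- The coefficient matrix `gᵢⱼ = g(∂ᵢ, ∂ⱼ)` of the metric in the chart at `x`, as a function of the
coordinates `u`. -/
def chartMetric (g : RMetric m M) (x : M) (u : EuclideanSpace ℝ (Fin m)) :
    Matrix (Fin m) (Fin m) ℝ :=
  Matrix.of fun i j => g.inner _ (coordField M x u i) (coordField M x u j)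

/-- The coefficients `gⁱʲ` at `x` of the inverse metric in the chart at `x`. -/
def invMetric (g : RMetric m M) (x : M) : Matrix (Fin m) (Fin m) ℝ :=
  (chartMetric g x (extChartAt (𝓡 m) x x))⁻¹

/-- The vector `V` at `x` with `g(V, Y) = α(Y)` for all `Y`, for a linear form `α` on `T_xM`
with `α(∂ⱼ) = a j`: `Vⁱ = gⁱʲ aⱼ`. -/
def sharp (g : RMetric m M) (x : M) (a : Fin m → ℝ) : TangentSpace (𝓡 m) x :=
  ofComps x ((invMetric g x).mulVec a)

/-- A real function on `M` in the coordinates of the chart at `x`. -/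
def inChart (x : M) (w : M → ℝ) : EuclideanSpace ℝ (Fin m) → ℝ :=
  w ∘ (extChartAt (𝓡 m) x).symm

/-- The gradient of a function. -/
def grad (g : RMetric m M) (w : M → ℝ) (x : M) : TangentSpace (𝓡 m) x :=
  sharp g x fun j => partialD j (inChart x w) (extChartAt (𝓡 m) x x)

/-- The Laplacian `Δw = div grad w = gⁱʲ (∂ᵢ∂ⱼ w - Γᵏᵢⱼ ∂ₖ w)`. -/
def laplacian (g : RMetric m M) (w : M → ℝ) (x : M) : ℝ :=
  ∑ i, ∑ j, invMetric g x i j *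
    (partialD i (partialD j (inChart x w)) (extChartAt (𝓡 m) x x)
      - ∑ k, christoffel (chartMetric g x) k i j (extChartAt (𝓡 m) x x)
          * partialD k (inChart x w) (extChartAt (𝓡 m) x x))

/-- The Ricci tensor `Ric(Z, W)`. -/
def ricci (g : RMetric m M) (x : M) (Z W : TangentSpace (𝓡 m) x) : ℝ :=
  ∑ j, ∑ k, ricciCoeff (chartMetric g x) j k (extChartAt (𝓡 m) x x) * comps Z j * comps W k

/-- The Ricci operator `Ric : T_xM → T_xM`, `⟨Ric(Z), W⟩ = Ric(Z, W)`. -/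
def ricciOp (g : RMetric m M) (x : M) (Z : TangentSpace (𝓡 m) x) : TangentSpace (𝓡 m) x :=
  sharp g x fun k => ricci g x Z (basisVec x k)

/-- The Riemannian volume of the chart domain at `x`, extended by zero: the image under the inverse
chart of `√(det gᵢⱼ) du`. -/
def chartVolume [MeasurableSpace M] (g : RMetric m M) (x : M) : Measure M :=
  Measure.map (extChartAt (𝓡 m) x).symm
    ((volume.restrict (extChartAt (𝓡 m) x).target).withDensity
      fun u => ENNReal.ofReal (Real.sqrt (chartMetric g x u).det))

/-- The Riemannian volume measure `v_g`: the least measure that dominates the Riemannian volume of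
every chart domain.  (These volumes agree on overlaps, so `v_g` restricts to each of them.) -/
def riemannianVolume [MeasurableSpace M] (g : RMetric m M) : Measure M :=
  ⨆ x : M, chartVolume g x

/-! ## Maps between Riemannian manifolds -/

/-- The components `φ^γ` of a map in the charts at `x` and at `φ x`. -/
def mapComp (φ : M → N) (x : M) (γ : Fin n) (u : EuclideanSpace ℝ (Fin m)) : ℝ :=
  (writtenInExtChartAt (𝓡 m) (𝓡 n) x φ u : EuclideanSpace ℝ (Fin n)) γ

/-- The components of `∇dφ(∂ᵢ, ∂ⱼ) = ∇^φ_{∂ᵢ}(dφ ∂ⱼ) - dφ(∇^M_{∂ᵢ} ∂ⱼ)` at `x`: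
`∂ᵢ∂ⱼ φ^γ - Γᵏᵢⱼ ∂ₖ φ^γ + (Γ^N)^γ_{αβ} ∂ᵢ φ^α ∂ⱼ φ^β`. -/
def hessCoeff (g : RMetric m M) (h : RMetric n N) (φ : M → N) (x : M) (γ : Fin n)
    (i j : Fin m) : ℝ :=
  let u := extChartAt (𝓡 m) x x
  partialD i (partialD j (mapComp φ x γ)) u
    - ∑ k, christoffel (chartMetric g x) k i j u * partialD k (mapComp φ x γ) u
    + ∑ α, ∑ β, christoffel (chartMetric h (φ x)) γ α β (extChartAt (𝓡 n) (φ x) (φ x))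
        * partialD i (mapComp φ x α) u * partialD j (mapComp φ x β) u

/-- The second fundamental form `∇dφ(X, Y) ∈ T_{φ x}N` of a map `φ : (M, g) → (N, h)`.
For an isometric immersion this is, by the Gauss formula, the (normal valued) second fundamental
form `B(X, Y) = ∇^N_X Y - ∇^M_X Y` of the submanifold. -/
def secondFundamentalForm (g : RMetric m M) (h : RMetric n N) (φ : M → N) (x : M)
    (X Y : TangentSpace (𝓡 m) x) : TangentSpace (𝓡 n) (φ x) :=
  ofComps (φ x) fun γ => ∑ i, ∑ j, hessCoeff g h φ x γ i j * comps X i * comps Y j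

/-- The tension field `τ(φ) = Trace_g ∇dφ`. -/
def tension (g : RMetric m M) (h : RMetric n N) (φ : M → N) (x : M) :
    TangentSpace (𝓡 n) (φ x) :=
  ∑ i, ∑ j, invMetric g x i j • secondFundamentalForm g h φ x (basisVec x i) (basisVec x j)

/-- The `f`-bienergy `½ ∫_Ω f |τ(φ)|² v_g`. -/
def fBienergy [MeasurableSpace M] (g : RMetric m M) (h : RMetric n N) (f : M → ℝ) (Ω : Set M)
    (φ : M → N) : ℝ :=
  (1 / 2) * ∫ x in Ω, f x * h.inner (φ x) (tension g h φ x) (tension g h φ x) ∂(riemannianVolume g)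

/-- `φ : (M, g) → (N, h)` is `f`-biharmonic: it is a critical point of the `f`-bienergy, i.e. for
every compact `Ω ⊆ M` and every smooth one-parameter variation `Φ_t` of `φ = Φ_0` that is fixed
outside `Ω`, the derivative of the `f`-bienergy over `Ω` along the variation exists at `t = 0`
and vanishes. -/
def IsFBiharmonic [MeasurableSpace M] (g : RMetric m M) (h : RMetric n N) (f : M → ℝ)
    (φ : M → N) : Prop :=
  ∀ Ω : Set M, IsCompact Ω → ∀ Φ : ℝ → M → N,
    ContMDiff (𝓘(ℝ, ℝ).prod (𝓡 m)) (𝓡 n) ∞ (Function.uncurry Φ) →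
    Φ 0 = φ → (∀ t, ∀ x ∉ Ω, Φ t x = φ x) →
    HasDerivAt (fun t => fBienergy g h f Ω (Φ t)) 0 0

/-! ## Isometric immersions and hypersurfaces -/

/-- `φ` is a smooth isometric immersion: `φ^*h = g`. -/
def IsIsometricImmersion (g : RMetric m M) (h : RMetric n N) (φ : M → N) : Prop :=
  ContMDiff (𝓡 m) (𝓡 n) ∞ φ ∧
    ∀ (x : M) (X Y : TangentSpace (𝓡 m) x),
      h.inner (φ x) (mfderiv (𝓡 m) (𝓡 n) φ x X) (mfderiv (𝓡 m) (𝓡 n) φ x Y) = g.inner x X Y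

/-- `ξ` is a smooth unit normal vector field along `φ`. -/
def IsUnitNormal (h : RMetric n N) (φ : M → N) (ξ : ∀ x : M, TangentSpace (𝓡 n) (φ x)) : Prop :=
  ContMDiff (𝓡 m) (𝓡 n).tangent ∞ (fun x => (⟨φ x, ξ x⟩ : TangentBundle (𝓡 n) N)) ∧
    (∀ x, h.inner (φ x) (ξ x) (ξ x) = 1) ∧
    ∀ (x : M) (X : TangentSpace (𝓡 m) x), h.inner (φ x) (ξ x) (mfderiv (𝓡 m) (𝓡 n) φ x X) = 0

/-- The mean curvature vector `η = (1/m) Trace_g B`. -/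
def meanCurvatureVector (g : RMetric m M) (h : RMetric n N) (φ : M → N) (x : M) :
    TangentSpace (𝓡 n) (φ x) :=
  (1 / (m : ℝ)) •
    ∑ i, ∑ j, invMetric g x i j • secondFundamentalForm g h φ x (basisVec x i) (basisVec x j)

/-- The shape operator `A` with respect to `ξ`: `g(A X, Y) = h(B(X, Y), ξ)`. -/
def shapeOperator (g : RMetric m M) (h : RMetric n N) (φ : M → N)
    (ξ : ∀ x : M, TangentSpace (𝓡 n) (φ x)) (x : M) (X : TangentSpace (𝓡 m) x) :
    TangentSpace (𝓡 m) x :=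
  sharp g x fun j => h.inner (φ x) (secondFundamentalForm g h φ x X (basisVec x j)) (ξ x)

/-- `|A|² = gⁱʲ g(A ∂ᵢ, A ∂ⱼ)`. -/
def shapeNormSq (g : RMetric m M) (h : RMetric n N) (φ : M → N)
    (ξ : ∀ x : M, TangentSpace (𝓡 n) (φ x)) (x : M) : ℝ :=
  ∑ i, ∑ j, invMetric g x i j *
    g.inner x (shapeOperator g h φ ξ x (basisVec x i)) (shapeOperator g h φ ξ x (basisVec x j))

/-- The tangential part `v^⊤` of `v ∈ T_{φ x}N`, as a vector of `T_xM`: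
`g(v^⊤, Y) = h(v, dφ Y)` for all `Y ∈ T_xM`. -/
def tangentialPart (g : RMetric m M) (h : RMetric n N) (φ : M → N) (x : M)
    (v : TangentSpace (𝓡 n) (φ x)) : TangentSpace (𝓡 m) x :=
  sharp g x fun j => h.inner (φ x) v (mfderiv (𝓡 m) (𝓡 n) φ x (basisVec x j))

end Manifold

end

/-! Let `J V = Trace ∇²V + Trace R(V, dφ)dφ` be the Jacobi operator on vector fields along `φ`.
Differentiating the tension field along a variation with field `V` gives `∇_t τ = J V`
(`covD_familyTension`): time and space derivatives commute up to curvature, and this produces the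
curvature term of `J`. Hence the derivative of the `f`-bienergy is `∫ f ⟨J V, τ⟩`. Since `J` is
formally self-adjoint (`setIntegral_jacobiOp_symm`, resting on the pair symmetry of the curvature
and the divergence theorem), this equals `∫ ⟨V, J(fτ)⟩`, and `φ` is critical exactly when `J(fτ) =
0` (`isFBiharmonic_iff_eulerLagrange`).

For a hypersurface `τ = mHξ`, so the equation reads `J(wξ) = 0` with `w = m f H`. The Leibniz rule
(`jacobiOp_smul_normal`) gives `J(wξ) = (Δw)ξ + 2∇_{grad w} ξ + w Jξ`. Here `∇ξ` is minus the shape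
operator, the normal part of `Jξ` is `-|A|² + Ric(ξ, ξ)`, and its tangential part is `-m grad H + 2
Ric(ξ)^⊤`; Codazzi's equation supplies `grad H` and one of the two Ricci terms. So the normal part
of the equation is `m` times the first equation of the system and the tangential part is `-2m` times
the second (`eulerLagrange_hypersurface_iff`).

All differential geometry is done in coordinates, for a map `P` between open sets of Euclidean
spaces carrying metrics given by matrices (`IsMetricOn`), with the covariant derivative `covD` along
`P` as basic operation. The manifold quantities are defined at each point through the charts
preferred at that point and at its image, which change with the point. Naturality under isometric
coordinate changes (`IsChartChange`) therefore serves to express them near a point in one fixed pair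
of charts (`bienergyDensity_eq`, `chartDeriv_coordTension`, `eulerLagrange_eq_zero_of_center`).
Likewise the supremum defining the Riemannian measure is shown to restrict to `√(det g) du` in each
chart (`riemannianVolume_restrict_source`).

For sufficiency of `J(fτ) = 0`, a variation need not be supported in one chart. A partition of unity
`ρ_i` replaces `Φ_t(y)` by the variations `Φ_{tρ_i(y)}(y)`, whose fields are `ρ_i V`; because the
first variation is linear in the field, it is enough to treat each of them in a chart. For
necessity, variations `P + ε sin(t) χ v` in a chart are inserted and the fundamental lemma of the
calculus of variations applies. In dimension `m = 0` the convention `1/0 = 0` forces `H = 0`, and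
both sides of the equivalence hold. -/

set_option maxSynthPendingDepth 3
set_option linter.unusedSectionVars false

noncomputable section

/-! ## Multilinear algebra in coordinates -/

/-- The Euclidean coordinate space. -/
abbrev Eu (n : ℕ) := EuclideanSpace ℝ (Fin n)

/-- The `i`-th standard basis vector. -/
abbrev stdVec {n : ℕ} (i : Fin n) : Eu n := EuclideanSpace.single i 1

section Multilinear

variable {n m : ℕ} {Z : Type*} [NormedAddCommGroup Z] [NormedSpace ℝ Z]
  {Y : Type*} [NormedAddCommGroup Y] [NormedSpace ℝ Y]

theorem sum_coord_smul (x : Eu n) : ∑ i, x i • (stdVec i : Eu n) = x := by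
  simpa using (EuclideanSpace.basisFun (Fin n) ℝ).sum_repr x

/-- Multilinear identities reduce to coordinate vectors. In the form of an induction principle the
reduction can be nested, one argument at a time. -/
theorem coord_induction {p : Eu n → Prop} (hadd : ∀ x y, p x → p y → p (x + y))
    (hsmul : ∀ (c : ℝ) x, p x → p (c • x)) (h0 : p 0) (hb : ∀ i, p (stdVec i)) (x : Eu n) : p x := by
  rw [← sum_coord_smul x]
  exact Finset.sum_induction _ p hadd h0 fun i _ => hsmul _ _ (hb i)

/-- The bilinear map with given components. -/
def bilin (C : Fin n → Fin n → Z) : Eu n →L[ℝ] Eu n →L[ℝ] Z :=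
  ∑ i, ∑ j, (EuclideanSpace.proj i : Eu n →L[ℝ] ℝ).smulRight
    ((EuclideanSpace.proj j : Eu n →L[ℝ] ℝ).smulRight (C i j))

theorem bilin_apply (C : Fin n → Fin n → Z) (x y : Eu n) :
    bilin C x y = ∑ i, ∑ j, x i • y j • C i j := by
  simp [bilin]

theorem bilin_single (C : Fin n → Fin n → Z) (i j : Fin n) :
    bilin C (stdVec i) (stdVec j) = C i j := by
  simp [bilin_apply, PiLp.single_apply]

theorem bilin_ext {β γ : Eu n →L[ℝ] Eu n →L[ℝ] Z}
    (h : ∀ i j, β (stdVec i) (stdVec j) = γ (stdVec i) (stdVec j)) : β = γ := by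
  ext1 x
  ext1 y
  induction x using coord_induction with
  | hadd a b ha hb => simp [ha, hb]
  | hsmul c a ha => simp [ha]
  | h0 => simp
  | hb i =>
    induction y using coord_induction with
    | hadd a b ha hb => simp [ha, hb]
    | hsmul c a ha => simp [ha]
    | h0 => simp
    | hb j => exact h i j

theorem bilin_eq (β : Eu n →L[ℝ] Eu n →L[ℝ] Z) :
    bilin (fun i j => β (stdVec i) (stdVec j)) = β :=
  bilin_ext fun i j => bilin_single _ i j

theorem ContDiffOn.bilin {X : Type*} [NormedAddCommGroup X] [NormedSpace ℝ X] {k : WithTop ℕ∞}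
    {C : X → Fin n → Fin n → Z} {S : Set X} (h : ∀ i j, ContDiffOn ℝ k (fun u => C u i j) S) :
    ContDiffOn ℝ k (fun u => _root_.bilin (C u)) S := by
  rw [contDiffOn_clm_apply]
  intro x
  rw [contDiffOn_clm_apply]
  intro y
  simp only [bilin_apply]
  exact ContDiffOn.sum fun i _ => ContDiffOn.sum fun j _ => ((h i j).const_smul _).const_smul _

/-- The bilinear form with a given coefficient matrix. -/
def metricForm (A : Matrix (Fin n) (Fin n) ℝ) : Eu n →L[ℝ] Eu n →L[ℝ] ℝ :=
  bilin fun i j => A i j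

theorem metricForm_single (A : Matrix (Fin n) (Fin n) ℝ) (i j : Fin n) :
    metricForm A (stdVec i) (stdVec j) = A i j := bilin_single _ i j

theorem metricForm_apply (A : Matrix (Fin n) (Fin n) ℝ) (x y : Eu n) :
    metricForm A x y = ∑ i, ∑ j, x i * (y j * A i j) := by
  simp [metricForm, bilin_apply]

theorem metricForm_comm {A : Matrix (Fin n) (Fin n) ℝ} (hA : A.PosDef) (x y : Eu n) :
    metricForm A x y = metricForm A y x := by
  rw [metricForm_apply, metricForm_apply, Finset.sum_comm]
  refine Finset.sum_congr rfl fun i _ => Finset.sum_congr rfl fun j _ => ?_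
  have : A j i = A i j := by simpa using hA.1.apply i j
  rw [this]; ring

theorem metricForm_pos {A : Matrix (Fin n) (Fin n) ℝ} (hA : A.PosDef) {x : Eu n} (hx : x ≠ 0) :
    0 < metricForm A x x := by
  have h := hA.dotProduct_mulVec_pos (x := x.ofLp) (by
    intro h; apply hx; ext i; simpa using congrFun h i)
  rw [metricForm_apply]
  refine h.trans_eq ?_
  simp only [dotProduct, Matrix.mulVec, Finset.mul_sum, star_trivial]
  refine Finset.sum_congr rfl fun i _ => Finset.sum_congr rfl fun j _ => ?_
  ring

theorem posDef_of_metricForm {A : Matrix (Fin n) (Fin n) ℝ}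
    (hs : ∀ x y, metricForm A x y = metricForm A y x)
    (hp : ∀ x, x ≠ 0 → 0 < metricForm A x x) : A.PosDef := by
  refine Matrix.PosDef.of_dotProduct_mulVec_pos ?_ ?_
  · ext i j
    simpa [metricForm_single] using hs (stdVec j) (stdVec i)
  · intro x hx
    have h := hp (WithLp.toLp 2 x) (by
      intro h; apply hx; ext i; simpa using congrArg (fun v : Eu n => v i) h)
    rw [metricForm_apply] at h
    refine h.trans_eq ?_
    simp only [dotProduct, Matrix.mulVec, Finset.mul_sum, star_trivial]
    refine Finset.sum_congr rfl fun i _ => Finset.sum_congr rfl fun j _ => ?_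
    show x i * (x j * A i j) = x i * (A i j * x j)
    ring

theorem metricForm_nondeg {A : Matrix (Fin n) (Fin n) ℝ} (hA : A.PosDef) {x : Eu n}
    (h : ∀ y, metricForm A x y = 0) : x = 0 := by
  by_contra hx
  exact (metricForm_pos hA hx).ne' (h x)

/-- The way vectors are identified below: formulas such as Koszul's determine only their inner
products. -/
theorem metricForm_right_cancel {A : Matrix (Fin n) (Fin n) ℝ} (hA : A.PosDef) {x x' : Eu n}
    (h : ∀ y, metricForm A x y = metricForm A x' y) : x = x' := by
  refine sub_eq_zero.1 (metricForm_nondeg hA fun y => ?_)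
  simp [h y]

/-! ### Traces with respect to an inverse matrix -/

/-- The trace `Aⁱʲ β(eᵢ, eⱼ)` of a bilinear map. -/
def metricTrace (A : Matrix (Fin n) (Fin n) ℝ) (β : Eu n →L[ℝ] Eu n →L[ℝ] Z) : Z :=
  ∑ i, ∑ j, A⁻¹ i j • β (stdVec i) (stdVec j)

theorem inv_symm {A : Matrix (Fin n) (Fin n) ℝ} (hA : A.PosDef) (i j : Fin n) :
    A⁻¹ i j = A⁻¹ j i := by
  simpa using hA.inv.1.apply j i

theorem sum_inv_mul {A : Matrix (Fin n) (Fin n) ℝ} (hA : A.PosDef) (i k : Fin n) :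
    ∑ j, A⁻¹ i j * A j k = if i = k then 1 else 0 := by
  have := congrFun (congrFun (Matrix.nonsing_inv_mul A hA.det_pos.ne'.isUnit) i) k
  simpa [Matrix.mul_apply, Matrix.one_apply] using this

theorem sum_mul_inv {A : Matrix (Fin n) (Fin n) ℝ} (hA : A.PosDef) (i k : Fin n) :
    ∑ j, A i j * A⁻¹ j k = if i = k then 1 else 0 := by
  have := congrFun (congrFun (Matrix.mul_nonsing_inv A hA.det_pos.ne'.isUnit) i) k
  simpa [Matrix.mul_apply, Matrix.one_apply] using this

/-- Lowering the index of `v` and raising it again: the pairs of coordinate vectors, weighted by the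
inverse matrix, resolve the identity. -/
theorem sum_metricForm_inv_smul {A : Matrix (Fin n) (Fin n) ℝ} (hA : A.PosDef) (v : Eu n) :
    ∑ i, ∑ j, (A⁻¹ i j * metricForm A v (stdVec i)) • (stdVec j : Eu n) = v := by
  induction v using coord_induction with
  | hadd a b ha hb =>
    conv_rhs => rw [← ha, ← hb]
    simp [mul_add, add_smul, Finset.sum_add_distrib]
  | hsmul c a ha =>
    conv_rhs => rw [← ha]
    simp only [map_smul, smul_apply, smul_eq_mul, Finset.smul_sum, smul_smul]
    refine Finset.sum_congr rfl fun i _ => Finset.sum_congr rfl fun j _ => ?_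
    congr 1; ring
  | h0 => simp
  | hb k =>
    simp only [metricForm_single]
    rw [Finset.sum_comm]
    have : ∀ j, ∑ i, (A⁻¹ i j * A k i) • (stdVec j : Eu n) = (if k = j then (1 : ℝ) else 0) • stdVec j := by
      intro j
      rw [← Finset.sum_smul, ← sum_mul_inv hA k j]
      congr 1
      exact Finset.sum_congr rfl fun i _ => mul_comm _ _
    simp [this]

/-- A trace may be computed with any family of pairs that resolves the identity. -/
theorem metricTrace_eq_sum {A : Matrix (Fin n) (Fin n) ℝ} (hA : A.PosDef) {ι : Type*} [Fintype ι]
    (c : ι → ℝ) (a b : ι → Eu n) (hab : ∀ v, ∑ s, (c s * metricForm A v (a s)) • b s = v)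
    (β : Eu n →L[ℝ] Eu n →L[ℝ] Z) : metricTrace A β = ∑ s, c s • β (a s) (b s) := by
  -- The resolution `hab` expands the second slot of `β`. The inverse matrix left over then
  -- reassembles the first slot into `a s` by `sum_metricForm_inv_smul`.
  have h1 : ∀ j : Fin n, β.flip (stdVec j) = ∑ s, (c s * metricForm A (stdVec j) (a s)) • β.flip (b s) := by
    intro j
    conv_lhs => rw [← hab (stdVec j)]
    simp
  have h2 : metricTrace A β = ∑ i, ∑ j, ∑ s, (A⁻¹ i j * (c s * metricForm A (stdVec j) (a s))) •
      β (stdVec i) (b s) := by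
    refine Finset.sum_congr rfl fun i _ => Finset.sum_congr rfl fun j _ => ?_
    have := congrArg (fun L : Eu n →L[ℝ] Z => L (stdVec i)) (h1 j)
    simp only [ContinuousLinearMap.flip_apply, sum_apply,
      smul_apply] at this
    rw [this, Finset.smul_sum]
    simp [smul_smul]
  have h3 : ∀ s, β (a s) (b s) = ∑ i, ∑ j, (A⁻¹ i j * metricForm A (stdVec j) (a s)) • β (stdVec i) (b s) := by
    intro s
    conv_lhs => rw [← sum_metricForm_inv_smul hA (a s)]
    rw [Finset.sum_comm]
    simp only [map_sum, map_smul, sum_apply, smul_apply]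
    refine Finset.sum_congr rfl fun i _ => Finset.sum_congr rfl fun j _ => ?_
    rw [inv_symm hA, metricForm_comm hA]
  rw [h2]
  simp_rw [h3, Finset.smul_sum, smul_smul]
  rw [Finset.sum_comm' (t' := Finset.univ) (s' := fun _ => Finset.univ) (by simp)]
  rw [← Finset.sum_comm]
  conv_rhs => rw [Finset.sum_comm]
  refine Finset.sum_congr rfl fun i _ => ?_
  rw [Finset.sum_comm]
  refine Finset.sum_congr rfl fun j _ => Finset.sum_congr rfl fun s _ => ?_
  congr 1; ring

theorem metricTrace_add (A : Matrix (Fin n) (Fin n) ℝ) (β γ : Eu n →L[ℝ] Eu n →L[ℝ] Z) :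
    metricTrace A (β + γ) = metricTrace A β + metricTrace A γ := by
  simp [metricTrace, Finset.sum_add_distrib]

theorem map_metricTrace (A : Matrix (Fin n) (Fin n) ℝ) (L : Z →L[ℝ] Y)
    (β : Eu n →L[ℝ] Eu n →L[ℝ] Z) :
    L (metricTrace A β) = ∑ i, ∑ j, A⁻¹ i j • L (β (stdVec i) (stdVec j)) := by
  simp [metricTrace]

/-- Traces are invariant under isometries. -/
theorem metricTrace_congr_of_isometry {A A' : Matrix (Fin n) (Fin n) ℝ} (hA : A.PosDef)
    (hA' : A'.PosDef) (L : Eu n →L[ℝ] Eu n)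
    (hL : ∀ x y, metricForm A' (L x) (L y) = metricForm A x y)
    {β β' : Eu n →L[ℝ] Eu n →L[ℝ] Z} (hβ : ∀ x y, β' (L x) (L y) = β x y) :
    metricTrace A' β' = metricTrace A β := by
  have hinj : Function.Injective L := by
    rw [injective_iff_map_eq_zero]
    intro x hx
    refine metricForm_nondeg hA fun y => ?_
    rw [← hL, hx]; simp
  have hsurj : Function.Surjective L :=
    (LinearMap.injective_iff_surjective (f := (L : Eu n →ₗ[ℝ] Eu n))).1 hinj
  rw [metricTrace_eq_sum hA' (fun s : Fin n × Fin n => A⁻¹ s.1 s.2) (fun s => L (stdVec s.1))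
    (fun s => L (stdVec s.2)) ?_ β']
  · rw [Fintype.sum_prod_type, metricTrace]
    simp [hβ]
  · intro v
    obtain ⟨w, rfl⟩ := hsurj v
    rw [Fintype.sum_prod_type]
    simp only [hL]
    conv_rhs => rw [← sum_metricForm_inv_smul hA w]
    simp

/-- The map `(w, c) ↦ L w + c ξ` is injective, since pairing with `ξ` isolates `c`. Source and
target both have dimension `m + 1`, so it is onto. -/
theorem exists_eq_tangent_add_normal {A : Matrix (Fin m) (Fin m) ℝ} (hA : A.PosDef)
    {B : Matrix (Fin (m + 1)) (Fin (m + 1)) ℝ} (hB : B.PosDef) (L : Eu m →L[ℝ] Eu (m + 1))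
    (hL : ∀ x y, metricForm B (L x) (L y) = metricForm A x y) {ξ : Eu (m + 1)}
    (hξ : metricForm B ξ ξ = 1) (hξL : ∀ x, metricForm B ξ (L x) = 0) (v : Eu (m + 1)) :
    ∃ w : Eu m, v = L w + metricForm B v ξ • ξ := by
  have hinj : Function.Injective L := by
    rw [injective_iff_map_eq_zero]
    intro x hx
    refine metricForm_nondeg hA fun y => ?_
    rw [← hL, hx]; simp
  let T : Eu m × ℝ →ₗ[ℝ] Eu (m + 1) :=
    (L : Eu m →ₗ[ℝ] Eu (m + 1)).coprod (LinearMap.toSpanSingleton ℝ _ ξ)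
  have hT : Function.Injective T := by
    rw [injective_iff_map_eq_zero]
    rintro ⟨x, c⟩ hx
    have hx' : L x + c • ξ = 0 := by simpa [T] using hx
    have hc : c = 0 := by
      have := congrArg (metricForm B ξ) hx'
      simpa [hξ, hξL] using this
    subst hc
    have : L x = 0 := by simpa using hx'
    simpa using hinj (this.trans (map_zero L).symm)
  have hfr : Module.finrank ℝ (Eu m × ℝ) = Module.finrank ℝ (Eu (m + 1)) := by simp
  obtain ⟨⟨w, c⟩, hw⟩ := (LinearMap.injective_iff_surjective_of_finrank_eq_finrank hfr).1 hT v
  have hw' : L w + c • ξ = v := by simpa [T] using hw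
  refine ⟨w, ?_⟩
  have hc : metricForm B v ξ = c := by
    rw [metricForm_comm hB, ← hw']; simp [hξ, hξL]
  rw [hc, hw']

/-- The trace in a space of one dimension more, computed with an adapted frame. -/
theorem metricTrace_hypersurface {A : Matrix (Fin m) (Fin m) ℝ} (hA : A.PosDef)
    {B : Matrix (Fin (m + 1)) (Fin (m + 1)) ℝ} (hB : B.PosDef) (L : Eu m →L[ℝ] Eu (m + 1))
    (hL : ∀ x y, metricForm B (L x) (L y) = metricForm A x y) {ξ : Eu (m + 1)}
    (hξ : metricForm B ξ ξ = 1) (hξL : ∀ x, metricForm B ξ (L x) = 0)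
    (β : Eu (m + 1) →L[ℝ] Eu (m + 1) →L[ℝ] Z) :
    metricTrace B β = (∑ i, ∑ j, A⁻¹ i j • β (L (stdVec i)) (L (stdVec j))) + β ξ ξ := by
  -- The index `none` stands for the pair `(ξ, ξ)` with weight `1`; the other indices are the pushed
  -- forward coordinate pairs, weighted by `A⁻¹`.
  rw [metricTrace_eq_sum hB (ι := Option (Fin m × Fin m))
    (fun s => s.elim 1 fun s => A⁻¹ s.1 s.2) (fun s => s.elim ξ fun s => L (stdVec s.1))
    (fun s => s.elim ξ fun s => L (stdVec s.2)) ?_ β]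
  · rw [Fintype.sum_option, Fintype.sum_prod_type, add_comm]
    simp
  · intro v
    obtain ⟨w, hw⟩ := exists_eq_tangent_add_normal hA hB L hL hξ hξL v
    rw [Fintype.sum_option, Fintype.sum_prod_type]
    have h1 : ∀ x, metricForm B v (L x) = metricForm A w x := by
      intro x
      rw [hw, ← hL]; simp [hξL]
    simp only [Option.elim, h1, one_mul]
    have h2 := congrArg L (sum_metricForm_inv_smul hA w)
    simp only [map_sum, map_smul] at h2
    rw [h2]
    exact (add_comm _ _).trans hw.symm

end Multilinear

/-! ## Metrics on open sets of `ℝⁿ` -/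

section CoordMetric

/-- A smooth Riemannian metric on an open set of `ℝⁿ`, given by its coefficient matrix. -/
structure IsMetricOn {n : ℕ} (G : Eu n → Matrix (Fin n) (Fin n) ℝ) (S : Set (Eu n)) : Prop where
  isOpen : IsOpen S
  smooth : ∀ i j, ContDiffOn ℝ ∞ (fun u => G u i j) S
  posDef : ∀ u ∈ S, (G u).PosDef

/-! ### Determinants and inverses of matrices of functions -/

section Determinant

variable {n : ℕ} {X : Type*} [NormedAddCommGroup X] [NormedSpace ℝ X]

theorem ContDiffOn.matrix_det {k : WithTop ℕ∞} {A : X → Matrix (Fin n) (Fin n) ℝ} {S : Set X}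
    (h : ∀ i j, ContDiffOn ℝ k (fun u => A u i j) S) : ContDiffOn ℝ k (fun u => (A u).det) S := by
  simp only [Matrix.det_apply]
  exact ContDiffOn.sum fun σ _ => ContDiffOn.const_smul _ (contDiffOn_prod fun i _ => h _ _)

/-- Cramer's rule: the entries of the inverse are cofactors divided by the determinant. -/
theorem ContDiffOn.matrix_inv {k : WithTop ℕ∞} {A : X → Matrix (Fin n) (Fin n) ℝ} {S : Set X}
    (h : ∀ i j, ContDiffOn ℝ k (fun u => A u i j) S) (h0 : ∀ u ∈ S, (A u).det ≠ 0) (i j : Fin n) :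
    ContDiffOn ℝ k (fun u => (A u)⁻¹ i j) S := by
  simp only [Matrix.inv_def, Ring.inverse_eq_inv', Matrix.smul_apply, smul_eq_mul,
    Matrix.adjugate_apply]
  refine ((ContDiffOn.matrix_det h).inv h0).mul (ContDiffOn.matrix_det fun a b => ?_)
  by_cases hab : a = j
  · subst hab; simpa using contDiffOn_const
  · simpa [Matrix.updateRow_ne hab] using h a b

/-- Jacobi's formula. -/
theorem HasFDerivAt.matrix_det {A : X → Matrix (Fin n) (Fin n) ℝ} {A' : Fin n → Fin n → X →L[ℝ] ℝ}
    {u : X} (h : ∀ i j, HasFDerivAt (fun u => A u i j) (A' i j) u) (h0 : (A u).det ≠ 0) :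
    HasFDerivAt (fun u => (A u).det) ((A u).det • ∑ i, ∑ j, (A u)⁻¹ i j • A' j i) u := by
  let D : (Fin n → Fin n → ℝ) → ℝ := fun B => (Matrix.of B).det
  have hD : Differentiable ℝ D := by
    have : ContDiffOn ℝ 1 D Set.univ := ContDiffOn.matrix_det (k := 1) (A := fun B : Fin n → Fin n → ℝ => Matrix.of B)
      (fun i j => (contDiff_apply_apply ℝ ℝ i j).contDiffOn)
    exact (contDiffOn_univ.1 this).differentiable one_ne_zero
  have hA : HasFDerivAt (fun u => (A u : Fin n → Fin n → ℝ))
      (ContinuousLinearMap.pi fun i => ContinuousLinearMap.pi fun j => A' i j) u :=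
    hasFDerivAt_pi.2 fun i => hasFDerivAt_pi.2 fun j => h i j
  have hc := (hD (A u)).hasFDerivAt.comp u hA
  refine hc.congr_fderiv ?_
  ext x
  simp only [ContinuousLinearMap.comp_apply]
  set B : Fin n → Fin n → ℝ := (ContinuousLinearMap.pi fun i => ContinuousLinearMap.pi fun j => A' i j) x
    with hB
  obtain ⟨A₀, hA₀⟩ : ∃ A₀ : Fin n → Fin n → ℝ, A₀ = A u := ⟨_, rfl⟩
  rw [← hA₀]
  have h1 : HasDerivAt (fun r : ℝ => D (A₀ + r • B)) (fderiv ℝ D A₀ B) 0 := by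
    have := (hD A₀).hasFDerivAt.comp_hasDerivAt_of_eq (0 : ℝ)
      (((hasDerivAt_id (0 : ℝ)).smul_const B).const_add A₀) (by simp)
    simpa [Function.comp_def] using this
  -- On the line `A₀ + r B` the determinant factors as `det A · det(1 + r A⁻¹B)`, so its derivative
  -- at `0` is `det A · trace(A⁻¹B)`.
  have h2 : ∀ r : ℝ, D (A₀ + r • B)
      = (A u).det * (1 + r • ((A u)⁻¹ * Matrix.of B)).det := by
    intro r
    rw [← Matrix.det_mul, mul_add, mul_one, Matrix.mul_smul, ← mul_assoc,
      Matrix.mul_nonsing_inv _ h0.isUnit, one_mul, hA₀]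
    rfl
  have h3 : HasDerivAt (fun r : ℝ => (A u).det * (1 + r • ((A u)⁻¹ * Matrix.of B)).det)
      ((A u).det * ((A u)⁻¹ * Matrix.of B).trace) 0 := by
    refine HasDerivAt.const_mul _ ?_
    -- In `Matrix.det_one_add_smul` the remainder is `r²` times an unspecified polynomial in `r`,
    -- which cannot affect the derivative at `0`.
    have hp : ∀ q : Polynomial ℝ, HasDerivAt (fun r : ℝ => 1 + ((A u)⁻¹ * Matrix.of B).trace * r
        + q.eval r * r ^ 2) ((A u)⁻¹ * Matrix.of B).trace 0 := by
      intro q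
      have := (((hasDerivAt_id (0 : ℝ)).const_mul ((A u)⁻¹ * Matrix.of B).trace).const_add 1).add
        ((q.hasDerivAt 0).mul ((hasDerivAt_id (0 : ℝ)).pow 2))
      refine (this.congr_deriv (by simp)).congr_of_eventuallyEq
        (Filter.Eventually.of_forall fun r => by simp)
    exact (hp _).congr_of_eventuallyEq
      (Filter.Eventually.of_forall fun r => Matrix.det_one_add_smul r _)
  have h4 := h1.unique (h3.congr_of_eventuallyEq (Filter.Eventually.of_forall h2))
  rw [h4, hA₀]
  simp [Matrix.trace, Matrix.mul_apply, hB]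

end Determinant

/-! ### Christoffel symbols -/

section Christoffel

theorem fderiv_clm_apply₂ {X Z : Type*} [NormedAddCommGroup X] [NormedSpace ℝ X]
    [NormedAddCommGroup Z] [NormedSpace ℝ Z] {n l : ℕ} {β : X → Eu n →L[ℝ] Eu l →L[ℝ] Z} {u : X}
    (hβ : DifferentiableAt ℝ β u) (x : X) (a : Eu n) (b : Eu l) :
    fderiv ℝ β u x a b = fderiv ℝ (fun w => β w a b) u x := by
  have h1 : HasFDerivAt (fun w => β w a) ((fderiv ℝ β u).flip a) u := by
    simpa using hβ.hasFDerivAt.clm_apply (hasFDerivAt_const a u)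
  have h2 : HasFDerivAt (fun w => β w a b) (((fderiv ℝ β u).flip a).flip b) u := by
    simpa using h1.clm_apply (hasFDerivAt_const b u)
  rw [h2.fderiv]; rfl

/-- The derivative of a metric as a trilinear form. -/
def dForm {n : ℕ} (G : Eu n → Matrix (Fin n) (Fin n) ℝ) (u x a b : Eu n) : ℝ :=
  fderiv ℝ (fun w => metricForm (G w)) u x a b

section dForm

variable {n : ℕ} (G : Eu n → Matrix (Fin n) (Fin n) ℝ) (u x y a b : Eu n) (c : ℝ)

theorem dForm_add₁ : dForm G u (x + y) a b = dForm G u x a b + dForm G u y a b := by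
  unfold dForm; rw [ContinuousLinearMap.map_add]; rfl

theorem dForm_smul₁ : dForm G u (c • x) a b = c * dForm G u x a b := by
  unfold dForm; rw [ContinuousLinearMap.map_smul]; rfl

theorem dForm_zero₁ : dForm G u 0 a b = 0 := by
  unfold dForm; rw [ContinuousLinearMap.map_zero]; rfl

theorem dForm_add₂ : dForm G u a (x + y) b = dForm G u a x b + dForm G u a y b := by
  unfold dForm; rw [ContinuousLinearMap.map_add]; rfl

theorem dForm_smul₂ : dForm G u a (c • x) b = c * dForm G u a x b := by
  unfold dForm; rw [ContinuousLinearMap.map_smul]; rfl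

theorem dForm_zero₂ : dForm G u a 0 b = 0 := by
  unfold dForm; rw [ContinuousLinearMap.map_zero]; rfl

theorem dForm_add₃ : dForm G u a b (x + y) = dForm G u a b x + dForm G u a b y := by
  unfold dForm; rw [ContinuousLinearMap.map_add]

theorem dForm_smul₃ : dForm G u a b (c • x) = c * dForm G u a b x := by
  unfold dForm; rw [ContinuousLinearMap.map_smul]; rfl

theorem dForm_zero₃ : dForm G u a b 0 = 0 := by
  unfold dForm; rw [ContinuousLinearMap.map_zero]

end dForm

/-- The Christoffel symbols as a bilinear map. -/
def gamma {n : ℕ} (G : Eu n → Matrix (Fin n) (Fin n) ℝ) (u : Eu n) : Eu n →L[ℝ] Eu n →L[ℝ] Eu n :=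
  bilin fun i j => WithLp.toLp 2 fun k => christoffel G k i j u

theorem gamma_single_apply {n : ℕ} (G : Eu n → Matrix (Fin n) (Fin n) ℝ) (u : Eu n)
    (i j k : Fin n) : gamma G u (stdVec i) (stdVec j) k = christoffel G k i j u := by
  rw [gamma, bilin_single]

theorem contDiffOn_partialD {n : ℕ} {F : Eu n → ℝ} {S : Set (Eu n)} (hS : IsOpen S)
    (hF : ContDiffOn ℝ ∞ F S) (i : Fin n) : ContDiffOn ℝ ∞ (partialD i F) S :=
  (hF.fderiv_of_isOpen hS (m := ∞) (by simp)).clm_apply contDiffOn_const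

end Christoffel

/-! ### The Levi-Civita connection of a coordinate metric -/

namespace IsMetricOn

variable {n : ℕ} {G : Eu n → Matrix (Fin n) (Fin n) ℝ} {S : Set (Eu n)}

theorem inv_smooth (hG : IsMetricOn G S) (i j : Fin n) :
    ContDiffOn ℝ ∞ (fun u => (G u)⁻¹ i j) S :=
  ContDiffOn.matrix_inv hG.smooth (fun u hu => (hG.posDef u hu).det_pos.ne') i j

theorem form_smooth (hG : IsMetricOn G S) : ContDiffOn ℝ ∞ (fun u => metricForm (G u)) S :=
  ContDiffOn.bilin hG.smooth

theorem christoffel_smooth (hG : IsMetricOn G S) (k i j : Fin n) :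
    ContDiffOn ℝ ∞ (christoffel G k i j) S := by
  unfold christoffel
  refine contDiffOn_const.mul (ContDiffOn.sum fun l _ => (hG.inv_smooth k l).mul ?_)
  exact ((contDiffOn_partialD hG.isOpen (hG.smooth j l) i).add
    (contDiffOn_partialD hG.isOpen (hG.smooth i l) j)).sub
    (contDiffOn_partialD hG.isOpen (hG.smooth i j) l)

theorem gamma_smooth (hG : IsMetricOn G S) : ContDiffOn ℝ ∞ (gamma G) S :=
  ContDiffOn.bilin fun i j => contDiffOn_euclidean.2 fun k => hG.christoffel_smooth k i j

theorem form_differentiableAt (hG : IsMetricOn G S) {u : Eu n} (hu : u ∈ S) :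
    DifferentiableAt ℝ (fun w => metricForm (G w)) u :=
  (hG.form_smooth.contDiffAt (hG.isOpen.mem_nhds hu)).differentiableAt (by simp)

theorem dForm_single (hG : IsMetricOn G S) {u : Eu n} (hu : u ∈ S) (i j k : Fin n) :
    dForm G u (stdVec i) (stdVec j) (stdVec k)
      = partialD i (fun w => G w j k) u := by
  rw [dForm, fderiv_clm_apply₂ (hG.form_differentiableAt hu)]
  simp only [metricForm_single]; rfl

theorem dForm_comm (hG : IsMetricOn G S) {u : Eu n} (hu : u ∈ S) (x a b : Eu n) :
    dForm G u x a b = dForm G u x b a := by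
  rw [dForm, dForm, fderiv_clm_apply₂ (hG.form_differentiableAt hu),
    fderiv_clm_apply₂ (hG.form_differentiableAt hu)]
  congr 1
  refine Filter.EventuallyEq.fderiv_eq ?_
  filter_upwards [hG.isOpen.mem_nhds hu] with w hw using metricForm_comm (hG.posDef w hw) a b

/-- Koszul's formula. -/
theorem form_gamma (hG : IsMetricOn G S) {u : Eu n} (hu : u ∈ S) (a b c : Eu n) :
    metricForm (G u) (gamma G u a b) c = (1 / 2) *
      (dForm G u a b c + dForm G u b a c
        - dForm G u c a b) := by
  induction a using coord_induction with
  | hadd x y hx hy =>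
    simp only [map_add, add_apply, hx, hy, dForm_add₁, dForm_add₂]; ring
  | hsmul r x hx =>
    simp only [map_smul, smul_apply, hx, smul_eq_mul, dForm_smul₁, dForm_smul₂]; ring
  | h0 => simp [dForm_zero₁, dForm_zero₂]
  | hb i =>
  induction b using coord_induction with
  | hadd x y hx hy =>
    simp only [map_add, add_apply, hx, hy, dForm_add₁, dForm_add₂, dForm_add₃]; ring
  | hsmul r x hx =>
    simp only [map_smul, smul_apply, hx, smul_eq_mul, dForm_smul₁, dForm_smul₂, dForm_smul₃]; ring
  | h0 => simp [dForm_zero₁, dForm_zero₂, dForm_zero₃]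
  | hb j =>
  induction c using coord_induction with
  | hadd x y hx hy =>
    simp only [map_add, hx, hy, dForm_add₁, dForm_add₃]; ring
  | hsmul r x hx =>
    simp only [map_smul, hx, smul_eq_mul, dForm_smul₁, dForm_smul₃]; ring
  | h0 => simp [dForm_zero₁, dForm_zero₃]
  | hb k =>
  rw [hG.dForm_single hu, hG.dForm_single hu, hG.dForm_single hu,
    ← sum_coord_smul (gamma G u (stdVec i) (stdVec j))]
  simp only [gamma_single_apply, map_sum, sum_apply, map_smul, smul_apply, metricForm_single,
    smul_eq_mul, christoffel, mul_assoc, ← Finset.mul_sum, Finset.sum_mul]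
  congr 1
  rw [Finset.sum_comm]
  have : ∀ l, ∑ x, (G u)⁻¹ x l * ((partialD i (fun w => G w j l) u + partialD j (fun w => G w i l) u
      - partialD l (fun w => G w i j) u) * G u x k) =
      (if l = k then 1 else 0) * (partialD i (fun w => G w j l) u + partialD j (fun w => G w i l) u
      - partialD l (fun w => G w i j) u) := by
    intro l
    rw [← sum_inv_mul (hG.posDef u hu) l k, Finset.sum_mul]
    refine Finset.sum_congr rfl fun x _ => ?_
    rw [inv_symm (hG.posDef u hu) l x]; ring
  simp [this]

theorem gamma_comm (hG : IsMetricOn G S) {u : Eu n} (hu : u ∈ S) (a b : Eu n) :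
    gamma G u a b = gamma G u b a := by
  refine metricForm_right_cancel (hG.posDef u hu) fun c => ?_
  rw [hG.form_gamma hu, hG.form_gamma hu, hG.dForm_comm hu c a b]; ring

/-- Metric compatibility of the Levi-Civita connection. -/
theorem dForm_eq (hG : IsMetricOn G S) {u : Eu n} (hu : u ∈ S) (x a b : Eu n) :
    dForm G u x a b
      = metricForm (G u) (gamma G u x a) b + metricForm (G u) a (gamma G u x b) := by
  rw [metricForm_comm (hG.posDef u hu) a, hG.form_gamma hu, hG.form_gamma hu,
    hG.dForm_comm hu x b a, hG.dForm_comm hu a x b, hG.dForm_comm hu b x a]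
  ring

/-- Uniqueness of the Levi-Civita connection. -/
theorem gamma_unique (hG : IsMetricOn G S) {u : Eu n} (hu : u ∈ S)
    (T : Eu n → Eu n → Eu n) (hT : ∀ a b, T a b = T b a)
    (hc : ∀ x a b, dForm G u x a b
      = metricForm (G u) (T x a) b + metricForm (G u) a (T x b)) (a b : Eu n) :
    gamma G u a b = T a b := by
  refine metricForm_right_cancel (hG.posDef u hu) fun c => ?_
  rw [hG.form_gamma hu, hc, hc, hc, hT b a, hT c a, hT c b,
    metricForm_comm (hG.posDef u hu) b, metricForm_comm (hG.posDef u hu) a (T b c)]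
  ring

/-- The inverse metric is parallel. -/
theorem fderiv_inv (hG : IsMetricOn G S) {u : Eu n} (hu : u ∈ S) (x : Eu n) (i j : Fin n) :
    fderiv ℝ (fun w => (G w)⁻¹ i j) u x = -∑ l, ((G u)⁻¹ l j * gamma G u x (stdVec l) i
      + (G u)⁻¹ i l * gamma G u x (stdVec l) j) := by
  have hp := hG.posDef u hu
  have hdi : ∀ i j, DifferentiableAt ℝ (fun w => (G w)⁻¹ i j) u := fun i j =>
    ((hG.inv_smooth i j).contDiffAt (hG.isOpen.mem_nhds hu)).differentiableAt (by simp)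
  have hd : ∀ i j, DifferentiableAt ℝ (fun w => G w i j) u := fun i j =>
    ((hG.smooth i j).contDiffAt (hG.isOpen.mem_nhds hu)).differentiableAt (by simp)
  have hdG : ∀ j k, fderiv ℝ (fun w => G w j k) u x =
      ∑ p, (gamma G u x (stdVec j) p * G u p k + G u j p * gamma G u x (stdVec k) p) := by
    intro j k
    have := hG.dForm_eq hu x (stdVec j) (stdVec k)
    rw [dForm, fderiv_clm_apply₂ (hG.form_differentiableAt hu)] at this
    simp only [metricForm_single] at this
    rw [this, Finset.sum_add_distrib]
    conv_lhs => rw [← sum_coord_smul (gamma G u x (stdVec j)), ← sum_coord_smul (gamma G u x (stdVec k))]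
    simp [metricForm_single, mul_comm]
  -- Differentiate the constant entry `(i, k)` of `G⁻¹ G = 1`; multiplying the result by `G⁻¹` on
  -- the right then isolates the derivative of the inverse.
  have key : ∀ k, ∑ q, fderiv ℝ (fun w => (G w)⁻¹ i q) u x * G u q k
      = -∑ q, (G u)⁻¹ i q * fderiv ℝ (fun w => G w q k) u x := by
    intro k
    have h1 : HasFDerivAt (fun w => ∑ q, (G w)⁻¹ i q * G w q k)
        (∑ q, ((G u)⁻¹ i q • fderiv ℝ (fun w => G w q k) u
          + G u q k • fderiv ℝ (fun w => (G w)⁻¹ i q) u)) u :=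
      HasFDerivAt.fun_sum fun q _ => (hdi i q).hasFDerivAt.mul (hd q k).hasFDerivAt
    have h2 : HasFDerivAt (fun w => ∑ q, (G w)⁻¹ i q * G w q k) (0 : Eu n →L[ℝ] ℝ) u := by
      refine (hasFDerivAt_const (if i = k then (1 : ℝ) else 0) u).congr_of_eventuallyEq ?_
      filter_upwards [hG.isOpen.mem_nhds hu] with w hw using sum_inv_mul (hG.posDef w hw) i k
    have := congrArg (fun L : Eu n →L[ℝ] ℝ => L x) (h1.unique h2)
    simp only [sum_apply, add_apply, smul_apply, smul_eq_mul, zero_apply,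
      Finset.sum_add_distrib] at this
    rw [eq_neg_iff_add_eq_zero, ← this, add_comm]
    congr 1
    exact Finset.sum_congr rfl fun q _ => mul_comm _ _
  have hcancel : fderiv ℝ (fun w => (G w)⁻¹ i j) u x
      = ∑ k, (∑ q, fderiv ℝ (fun w => (G w)⁻¹ i q) u x * G u q k) * (G u)⁻¹ k j := by
    simp_rw [Finset.sum_mul, mul_assoc]
    rw [Finset.sum_comm]
    simp [← Finset.mul_sum, sum_mul_inv hp]
  rw [hcancel]
  simp_rw [key, hdG, neg_mul, Finset.sum_neg_distrib]
  congr 1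
  have e1 : ∀ k, ∑ q, (G u)⁻¹ i q * ∑ p, (gamma G u x (stdVec q) p * G u p k
      + G u q p * gamma G u x (stdVec k) p)
      = (∑ q, ∑ p, (G u)⁻¹ i q * gamma G u x (stdVec q) p * G u p k) + gamma G u x (stdVec k) i := by
    intro k
    simp_rw [Finset.sum_add_distrib, mul_add, Finset.sum_add_distrib, Finset.mul_sum]
    congr 1
    · simp_rw [mul_assoc]
    · rw [Finset.sum_comm]
      simp_rw [← mul_assoc, ← Finset.sum_mul, sum_inv_mul hp]
      simp
  simp_rw [e1, add_mul, Finset.sum_add_distrib]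
  rw [add_comm]
  congr 1
  · exact Finset.sum_congr rfl fun k _ => mul_comm _ _
  · simp_rw [Finset.sum_mul]
    rw [Finset.sum_comm]
    refine Finset.sum_congr rfl fun q _ => ?_
    rw [Finset.sum_comm]
    simp_rw [mul_assoc, ← Finset.mul_sum, sum_mul_inv hp]
    simp

/-- The derivative of the volume density. -/
theorem fderiv_sqrt_det (hG : IsMetricOn G S) {u : Eu n} (hu : u ∈ S) (x : Eu n) :
    fderiv ℝ (fun w => Real.sqrt (G w).det) u x
      = Real.sqrt (G u).det * ∑ l, gamma G u x (stdVec l) l := by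
  have hp := hG.posDef u hu
  have hd : ∀ i j, DifferentiableAt ℝ (fun w => G w i j) u := fun i j =>
    ((hG.smooth i j).contDiffAt (hG.isOpen.mem_nhds hu)).differentiableAt (by simp)
  have h1 := (HasFDerivAt.matrix_det (fun i j => (hd i j).hasFDerivAt) hp.det_pos.ne').sqrt
    hp.det_pos.ne'
  rw [h1.fderiv]
  -- By metric compatibility the derivative of `G` is a sum of two Christoffel terms, and
  -- contraction with `G⁻¹` turns each into the same trace. The resulting `2` cancels the `1/2` from
  -- the square root.
  have h2 : ∑ i, ∑ j, (G u)⁻¹ i j * fderiv ℝ (fun w => G w j i) u x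
      = 2 * ∑ l, gamma G u x (stdVec l) l := by
    have hdG : ∀ j k, fderiv ℝ (fun w => G w j k) u x =
        ∑ p, (gamma G u x (stdVec j) p * G u p k + G u j p * gamma G u x (stdVec k) p) := by
      intro j k
      have := hG.dForm_eq hu x (stdVec j) (stdVec k)
      rw [dForm, fderiv_clm_apply₂ (hG.form_differentiableAt hu)] at this
      simp only [metricForm_single] at this
      rw [this, Finset.sum_add_distrib]
      conv_lhs => rw [← sum_coord_smul (gamma G u x (stdVec j)), ← sum_coord_smul (gamma G u x (stdVec k))]
      simp [metricForm_single, mul_comm]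
    simp_rw [hdG, Finset.sum_add_distrib, mul_add, Finset.sum_add_distrib, two_mul]
    congr 1
    · rw [Finset.sum_comm]
      refine Finset.sum_congr rfl fun j _ => ?_
      simp_rw [Finset.mul_sum]
      rw [Finset.sum_comm]
      have : ∀ p, ∑ i, (G u)⁻¹ i j * (gamma G u x (stdVec j) p * G u p i)
          = gamma G u x (stdVec j) p * if p = j then 1 else 0 := by
        intro p
        rw [← sum_mul_inv hp p j, Finset.mul_sum]
        exact Finset.sum_congr rfl fun i _ => by ring
      simp [this]
    · refine Finset.sum_congr rfl fun i _ => ?_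
      simp_rw [Finset.mul_sum]
      rw [Finset.sum_comm]
      simp_rw [← mul_assoc, ← Finset.sum_mul, sum_inv_mul hp]
      simp
  simp only [smul_apply, sum_apply, smul_eq_mul, h2]
  have h3 : Real.sqrt (G u).det ≠ 0 := (Real.sqrt_pos.2 hp.det_pos).ne'
  have h4 : Real.sqrt (G u).det * Real.sqrt (G u).det = (G u).det := Real.mul_self_sqrt hp.det_pos.le
  field_simp
  rw [pow_two, h4]

end IsMetricOn
end CoordMetric

/-! ## Covariant derivatives along maps -/

section CovariantDerivative

variable {n : ℕ} {X : Type*} [NormedAddCommGroup X] [NormedSpace ℝ X]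

/-- The covariant derivative of a vector field `V` along a map `P`. -/
def covD (K : Eu n → Matrix (Fin n) (Fin n) ℝ) (P V : X → Eu n) (u : X) : X →L[ℝ] Eu n :=
  fderiv ℝ V u + ((gamma K (P u)).flip (V u)).comp (fderiv ℝ P u)

theorem covD_apply (K : Eu n → Matrix (Fin n) (Fin n) ℝ) (P V : X → Eu n) (u x : X) :
    covD K P V u x = fderiv ℝ V u x + gamma K (P u) (fderiv ℝ P u x) (V u) := rfl

theorem covD_congr {K : Eu n → Matrix (Fin n) (Fin n) ℝ} {P P' V V' : X → Eu n} {u : X}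
    (hP : P =ᶠ[nhds u] P') (hV : V =ᶠ[nhds u] V') : covD K P V u = covD K P' V' u := by
  rw [covD, covD, hP.fderiv_eq, hV.fderiv_eq, hP.eq_of_nhds, hV.eq_of_nhds]

/-- The Christoffel term is linear in the derivative of the map, so the ordinary chain rule handles
both terms. -/
theorem covD_comp {Y : Type*} [NormedAddCommGroup Y] [NormedSpace ℝ Y]
    (K : Eu n → Matrix (Fin n) (Fin n) ℝ) {P V : X → Eu n} {θ : Y → X} {u : Y}
    (hθ : DifferentiableAt ℝ θ u) (hP : DifferentiableAt ℝ P (θ u))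
    (hV : DifferentiableAt ℝ V (θ u)) (y : Y) :
    covD K (fun w => P (θ w)) (fun w => V (θ w)) u y = covD K P V (θ u) (fderiv ℝ θ u y) := by
  rw [covD_apply, covD_apply, fderiv_fun_comp _ hP hθ, fderiv_fun_comp _ hV hθ]; rfl

theorem covD_add (K : Eu n → Matrix (Fin n) (Fin n) ℝ) (P : X → Eu n) {V W : X → Eu n} {u : X}
    (hV : DifferentiableAt ℝ V u) (hW : DifferentiableAt ℝ W u) (x : X) :
    covD K P (fun w => V w + W w) u x = covD K P V u x + covD K P W u x := by
  simp only [covD_apply, fderiv_fun_add hV hW, map_add, add_apply]; abel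

theorem covD_sub (K : Eu n → Matrix (Fin n) (Fin n) ℝ) (P : X → Eu n) {V W : X → Eu n} {u : X}
    (hV : DifferentiableAt ℝ V u) (hW : DifferentiableAt ℝ W u) (x : X) :
    covD K P (fun w => V w - W w) u x = covD K P V u x - covD K P W u x := by
  simp only [covD_apply, fderiv_fun_sub hV hW, map_sub, sub_apply]; abel

theorem covD_smul (K : Eu n → Matrix (Fin n) (Fin n) ℝ) (P : X → Eu n) {a : X → ℝ} {V : X → Eu n}
    {u : X} (ha : DifferentiableAt ℝ a u) (hV : DifferentiableAt ℝ V u) (x : X) :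
    covD K P (fun w => a w • V w) u x = fderiv ℝ a u x • V u + a u • covD K P V u x := by
  simp only [covD_apply, fderiv_fun_smul ha hV, map_smul, add_apply, smul_apply,
    ContinuousLinearMap.smulRight_apply, smul_add]; abel

theorem covD_sum (K : Eu n → Matrix (Fin n) (Fin n) ℝ) (P : X → Eu n) {ι : Type*} (s : Finset ι)
    {V : ι → X → Eu n} {u : X} (hV : ∀ i ∈ s, DifferentiableAt ℝ (V i) u) (x : X) :
    covD K P (fun w => ∑ i ∈ s, V i w) u x = ∑ i ∈ s, covD K P (V i) u x := by
  simp only [covD_apply, fderiv_fun_sum hV, map_sum, sum_apply, Finset.sum_add_distrib]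

/-- The curvature operator `R(a, b)v` of the Levi-Civita connection. -/
def curv (K : Eu n → Matrix (Fin n) (Fin n) ℝ) (q a b v : Eu n) : Eu n :=
  fderiv ℝ (gamma K) q a b v - fderiv ℝ (gamma K) q b a v
    + gamma K q a (gamma K q b v) - gamma K q b (gamma K q a v)

section

variable {K : Eu n → Matrix (Fin n) (Fin n) ℝ} {S : Set (Eu n)} {P V W : X → Eu n} {O : Set X}

theorem differentiableAt_of_contDiffOn {Z : Type*} [NormedAddCommGroup Z] [NormedSpace ℝ Z]
    {O : Set X} (hO : IsOpen O) {V : X → Z} (hV : ContDiffOn ℝ ∞ V O) {u : X} (hu : u ∈ O) :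
    DifferentiableAt ℝ V u :=
  (hV.contDiffAt (hO.mem_nhds hu)).differentiableAt (by simp)

theorem contDiffOn_fderiv {Z : Type*} [NormedAddCommGroup Z] [NormedSpace ℝ Z]
    {O : Set X} (hO : IsOpen O) {V : X → Z} (hV : ContDiffOn ℝ ∞ V O) :
    ContDiffOn ℝ ∞ (fderiv ℝ V) O := hV.fderiv_of_isOpen hO (by simp)

theorem contDiffOn_fderiv_apply {Z : Type*} [NormedAddCommGroup Z] [NormedSpace ℝ Z]
    {O : Set X} (hO : IsOpen O) {V : X → Z} (hV : ContDiffOn ℝ ∞ V O) (x : X) :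
    ContDiffOn ℝ ∞ (fun u => fderiv ℝ V u x) O :=
  (contDiffOn_fderiv hO hV).clm_apply contDiffOn_const

theorem fderiv_fderiv_apply {Z : Type*} [NormedAddCommGroup Z] [NormedSpace ℝ Z]
    {O : Set X} (hO : IsOpen O) {V : X → Z} (hV : ContDiffOn ℝ ∞ V O) {u : X} (hu : u ∈ O) (x y : X) :
    fderiv ℝ (fun w => fderiv ℝ V w y) u x = fderiv ℝ (fderiv ℝ V) u x y := by
  rw [fderiv_clm_apply (differentiableAt_of_contDiffOn hO (contDiffOn_fderiv hO hV) hu)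
    (differentiableAt_const y)]
  simp

theorem fderiv_fderiv_comm {Z : Type*} [NormedAddCommGroup Z] [NormedSpace ℝ Z]
    {O : Set X} (hO : IsOpen O) {V : X → Z} (hV : ContDiffOn ℝ ∞ V O) {u : X} (hu : u ∈ O) (x y : X) :
    fderiv ℝ (fun w => fderiv ℝ V w y) u x = fderiv ℝ (fun w => fderiv ℝ V w x) u y := by
  rw [fderiv_fderiv_apply hO hV hu, fderiv_fderiv_apply hO hV hu]
  refine (hV.contDiffAt (hO.mem_nhds hu)).isSymmSndFDerivAt ?_ x y
  rw [minSmoothness_of_isRCLikeNormedField]; exact WithTop.coe_le_coe.2 le_top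

theorem covD_contDiffOn (hK : IsMetricOn K S) (hO : IsOpen O) (hP : ContDiffOn ℝ ∞ P O)
    (hPS : Set.MapsTo P O S) (hV : ContDiffOn ℝ ∞ V O) : ContDiffOn ℝ ∞ (covD K P V) O := by
  unfold covD
  refine (contDiffOn_fderiv hO hV).add (ContDiffOn.clm_comp ?_ (contDiffOn_fderiv hO hP))
  refine ContDiffOn.clm_apply ?_ hV
  exact (ContinuousLinearMap.flipₗᵢ ℝ (Eu n) (Eu n) (Eu n)).contDiff.comp_contDiffOn
    (hK.gamma_smooth.comp hP hPS)

theorem covD_apply_contDiffOn (hK : IsMetricOn K S) (hO : IsOpen O) (hP : ContDiffOn ℝ ∞ P O)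
    (hPS : Set.MapsTo P O S) (hV : ContDiffOn ℝ ∞ V O) (x : X) :
    ContDiffOn ℝ ∞ (fun u => covD K P V u x) O :=
  (covD_contDiffOn hK hO hP hPS hV).clm_apply contDiffOn_const

/-- The product rule for the metric. -/
theorem fderiv_metricForm (hK : IsMetricOn K S) {u : X} (hu : P u ∈ S)
    (hP : DifferentiableAt ℝ P u) (hV : DifferentiableAt ℝ V u) (hW : DifferentiableAt ℝ W u) (x : X) :
    fderiv ℝ (fun w => metricForm (K (P w)) (V w) (W w)) u x
      = metricForm (K (P u)) (covD K P V u x) (W u) + metricForm (K (P u)) (V u) (covD K P W u x) := by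
  have h1 : HasFDerivAt (fun w => metricForm (K (P w)))
      ((fderiv ℝ (fun q => metricForm (K q)) (P u)).comp (fderiv ℝ P u)) u :=
    (hK.form_differentiableAt hu).hasFDerivAt.comp u hP.hasFDerivAt
  have h2 := (h1.clm_apply hV.hasFDerivAt).clm_apply hW.hasFDerivAt
  rw [h2.fderiv]
  have h3 := hK.dForm_eq hu (fderiv ℝ P u x) (V u) (W u)
  rw [dForm] at h3
  simp only [add_apply, ContinuousLinearMap.comp_apply, ContinuousLinearMap.flip_apply, covD_apply,
    map_add, h3]
  ring

theorem contDiffOn_metricForm (hK : IsMetricOn K S) (hP : ContDiffOn ℝ ∞ P O)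
    (hPS : Set.MapsTo P O S) (hV : ContDiffOn ℝ ∞ V O) (hW : ContDiffOn ℝ ∞ W O) :
    ContDiffOn ℝ ∞ (fun w => metricForm (K (P w)) (V w) (W w)) O :=
  ((hK.form_smooth.comp hP hPS).clm_apply hV).clm_apply hW

/-- The connection has no torsion. -/
theorem covD_fderiv_comm (hK : IsMetricOn K S) (hO : IsOpen O) (hP : ContDiffOn ℝ ∞ P O)
    (hPS : Set.MapsTo P O S) {u : X} (hu : u ∈ O) (x y : X) :
    covD K P (fun w => fderiv ℝ P w y) u x = covD K P (fun w => fderiv ℝ P w x) u y := by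
  rw [covD_apply, covD_apply, fderiv_fderiv_comm hO hP hu, hK.gamma_comm (hPS hu)]

/-- Written out so that the commutator can be read off: only the term with the derivative of `gamma`
and the one quadratic in `gamma` fail to be symmetric in `x` and `y`, and these make up the
curvature. -/
theorem covD_covD (hK : IsMetricOn K S) (hO : IsOpen O) (hP : ContDiffOn ℝ ∞ P O)
    (hPS : Set.MapsTo P O S) (hV : ContDiffOn ℝ ∞ V O) {u : X} (hu : u ∈ O) (x y : X) :
    covD K P (fun w => covD K P V w y) u x
      = fderiv ℝ (fun w => fderiv ℝ V w y) u x
        + fderiv ℝ (gamma K) (P u) (fderiv ℝ P u x) (fderiv ℝ P u y) (V u)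
        + gamma K (P u) (fderiv ℝ (fun w => fderiv ℝ P w y) u x) (V u)
        + gamma K (P u) (fderiv ℝ P u y) (fderiv ℝ V u x)
        + gamma K (P u) (fderiv ℝ P u x) (fderiv ℝ V u y)
        + gamma K (P u) (fderiv ℝ P u x) (gamma K (P u) (fderiv ℝ P u y) (V u)) := by
  have h1 : HasFDerivAt (fun w => gamma K (P w))
      ((fderiv ℝ (gamma K) (P u)).comp (fderiv ℝ P u)) u :=
    (differentiableAt_of_contDiffOn hK.isOpen hK.gamma_smooth (hPS hu)).hasFDerivAt.comp u
      (differentiableAt_of_contDiffOn hO hP hu).hasFDerivAt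
  have h2 := (h1.clm_apply (differentiableAt_of_contDiffOn hO
    (contDiffOn_fderiv_apply hO hP y) hu).hasFDerivAt).clm_apply
    (differentiableAt_of_contDiffOn hO hV hu).hasFDerivAt
  have h3 := (differentiableAt_of_contDiffOn hO
    (contDiffOn_fderiv_apply hO hV y) hu).hasFDerivAt.add h2
  have h4 : (fun w => covD K P V w y) =
      ((fun w => fderiv ℝ V w y) + fun w => gamma K (P w) (fderiv ℝ P w y) (V w)) := rfl
  rw [covD_apply, h4, h3.fderiv]
  simp only [add_apply, ContinuousLinearMap.comp_apply, ContinuousLinearMap.flip_apply]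
  rw [covD_apply, map_add]
  abel

/-- The Ricci identity: covariant derivatives commute up to curvature. -/
theorem covD_covD_sub (hK : IsMetricOn K S) (hO : IsOpen O) (hP : ContDiffOn ℝ ∞ P O)
    (hPS : Set.MapsTo P O S) (hV : ContDiffOn ℝ ∞ V O) {u : X} (hu : u ∈ O) (x y : X) :
    covD K P (fun w => covD K P V w y) u x - covD K P (fun w => covD K P V w x) u y
      = curv K (P u) (fderiv ℝ P u x) (fderiv ℝ P u y) (V u) := by
  rw [covD_covD hK hO hP hPS hV hu, covD_covD hK hO hP hPS hV hu, fderiv_fderiv_comm hO hV hu x y,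
    fderiv_fderiv_comm hO hP hu x y, curv]
  abel

end

end CovariantDerivative

/-! ## Symmetries of the curvature -/

section Curvature

variable {n : ℕ} {K : Eu n → Matrix (Fin n) (Fin n) ℝ} {S : Set (Eu n)}

theorem curv_antisymm (K : Eu n → Matrix (Fin n) (Fin n) ℝ) (q a b v : Eu n) :
    curv K q a b v = -curv K q b a v := by
  unfold curv; abel

theorem fderiv_gamma_comm (hK : IsMetricOn K S) {q : Eu n} (hq : q ∈ S) (a b c : Eu n) :
    fderiv ℝ (gamma K) q a b c = fderiv ℝ (gamma K) q a c b := by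
  have hd := differentiableAt_of_contDiffOn hK.isOpen hK.gamma_smooth hq
  rw [fderiv_clm_apply₂ hd, fderiv_clm_apply₂ hd]
  congr 1
  refine Filter.EventuallyEq.fderiv_eq ?_
  filter_upwards [hK.isOpen.mem_nhds hq] with w hw using hK.gamma_comm hw b c

/-- Absence of torsion: `gamma` and its derivative are symmetric in the vector arguments, and the
twelve terms cancel in pairs. -/
theorem curv_bianchi (hK : IsMetricOn K S) {q : Eu n} (hq : q ∈ S) (a b c : Eu n) :
    curv K q a b c + curv K q b c a + curv K q c a b = 0 := by
  unfold curv
  rw [fderiv_gamma_comm hK hq a c b, fderiv_gamma_comm hK hq b a c, fderiv_gamma_comm hK hq c b a,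
    hK.gamma_comm hq c b, hK.gamma_comm hq c a, hK.gamma_comm hq b a]
  abel

/-- The Ricci identity for constant vector fields. -/
theorem covD_id_covD_sub (hK : IsMetricOn K S) {q : Eu n} (hq : q ∈ S) (a b v : Eu n) :
    covD K (fun w => w) (fun w => covD K (fun w => w) (fun _ => v) w b) q a
      - covD K (fun w => w) (fun w => covD K (fun w => w) (fun _ => v) w a) q b
      = curv K q a b v := by
  have := covD_covD_sub hK hK.isOpen (P := fun w => w) contDiffOn_id (Set.mapsTo_id S)
    (V := fun _ => v) contDiffOn_const hq a b
  rw [fderiv_fun_id] at this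
  exact this

/-- The second derivatives of the function `⟨v, w⟩`, for constant `v` and `w`, commute. Expanding
both orders with the product rule, the products of first covariant derivatives cancel and `⟨R(a,b)v,
w⟩ + ⟨v, R(a,b)w⟩ = 0` is left. -/
theorem metricForm_curv_antisymm (hK : IsMetricOn K S) {q : Eu n} (hq : q ∈ S) (a b v w : Eu n) :
    metricForm (K q) (curv K q a b v) w = -metricForm (K q) (curv K q a b w) v := by
  have hid : ∀ {q : Eu n}, DifferentiableAt ℝ (fun w : Eu n => w) q := differentiableAt_id
  have hD : ∀ v x : Eu n, ContDiffOn ℝ ∞ (fun q => covD K (fun w => w) (fun _ => v) q x) S :=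
    fun v x => covD_apply_contDiffOn hK hK.isOpen contDiffOn_id (Set.mapsTo_id S) contDiffOn_const x
  have hD' : ∀ v x : Eu n, DifferentiableAt ℝ (fun q => covD K (fun w => w) (fun _ => v) q x) q :=
    fun v x => differentiableAt_of_contDiffOn hK.isOpen (hD v x) hq
  have hF : ContDiffOn ℝ ∞ (fun q => metricForm (K q) v w) S :=
    (hK.form_smooth.clm_apply contDiffOn_const).clm_apply contDiffOn_const
  have h1 : ∀ b, (fun q => fderiv ℝ (fun q => metricForm (K q) v w) q b) =ᶠ[nhds q]
      fun q => metricForm (K q) (covD K (fun w => w) (fun _ => v) q b) w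
        + metricForm (K q) v (covD K (fun w => w) (fun _ => w) q b) := by
    intro b
    filter_upwards [hK.isOpen.mem_nhds hq] with p hp
    exact fderiv_metricForm hK (P := fun w => w) (V := fun _ => v) (W := fun _ => w) hp hid
      (differentiableAt_const _) (differentiableAt_const _) b
  have hdm : ∀ {V W : Eu n → Eu n}, ContDiffOn ℝ ∞ V S → ContDiffOn ℝ ∞ W S →
      DifferentiableAt ℝ (fun q => metricForm (K q) (V q) (W q)) q := fun hV hW =>
    differentiableAt_of_contDiffOn hK.isOpen
      (contDiffOn_metricForm hK contDiffOn_id (Set.mapsTo_id S) hV hW) hq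
  have h2 : ∀ a b, fderiv ℝ (fun q => fderiv ℝ (fun q => metricForm (K q) v w) q b) q a
      = metricForm (K q) (covD K (fun w => w) (fun q => covD K (fun w => w) (fun _ => v) q b) q a) w
      + metricForm (K q) (covD K (fun w => w) (fun _ => v) q b) (covD K (fun w => w) (fun _ => w) q a)
      + (metricForm (K q) (covD K (fun w => w) (fun _ => v) q a) (covD K (fun w => w) (fun _ => w) q b)
      + metricForm (K q) v (covD K (fun w => w) (fun q => covD K (fun w => w) (fun _ => w) q b) q a)) := by
    intro a b
    rw [(h1 b).fderiv_eq, fderiv_fun_add (hdm (hD v b) contDiffOn_const) (hdm contDiffOn_const (hD w b)),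
      add_apply, fderiv_metricForm hK (P := fun w => w) hq hid (hD' v b) (differentiableAt_const _),
      fderiv_metricForm hK (P := fun w => w) hq hid (differentiableAt_const _) (hD' w b)]
  have h3 := fderiv_fderiv_comm hK.isOpen hF hq a b
  rw [h2, h2] at h3
  rw [← covD_id_covD_sub hK hq a b v, ← covD_id_covD_sub hK hq a b w, map_sub, map_sub, sub_apply,
    sub_apply, metricForm_comm (hK.posDef q hq) _ v, metricForm_comm (hK.posDef q hq) _ v]
  rw [metricForm_comm (hK.posDef q hq) v, metricForm_comm (hK.posDef q hq) v] at h3 ⊢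
  linarith

/-- The pair symmetry of the curvature tensor. -/
theorem metricForm_curv_pair (hK : IsMetricOn K S) {q : Eu n} (hq : q ∈ S) (a b c d : Eu n) :
    metricForm (K q) (curv K q a b c) d = metricForm (K q) (curv K q c d a) b := by
  have B : ∀ a b c d, metricForm (K q) (curv K q a b c) d + metricForm (K q) (curv K q b c a) d
      + metricForm (K q) (curv K q c a b) d = 0 := by
    intro a b c d
    have := congrArg (fun v => metricForm (K q) v d) (curv_bianchi hK hq a b c)
    simpa using this
  have A : ∀ a b c d, metricForm (K q) (curv K q a b c) d = -metricForm (K q) (curv K q b a c) d := by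
    intro a b c d
    rw [curv_antisymm K q a b c]; simp
  have C := fun a b c d => metricForm_curv_antisymm hK hq a b c d
  -- Pair symmetry is a linear consequence of the four cyclic identities `B` for the rotations of
  -- `(a, b, c, d)` and of the skew-symmetries `A` and `C` in the two pairs of arguments.
  linarith [B a b c d, B b c d a, B c d a b, B d a b c, A a b c d, A b c a d, A c a b d, A b c d a,
    A c d b a, A d b c a, A c d a b, A d a c b, A a c d b, A d a b c, A a b d c, A b d a c,
    C a b c d, C b c a d, C c a b d, C c d b a, C d b c a, C c d a b, C d a c b, C a c d b,
    C d a b c, C b d a c]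

end Curvature

/-! ## Behaviour under isometric changes of coordinates -/

section Transform

variable {n : ℕ} {K K' : Eu n → Matrix (Fin n) (Fin n) ℝ} {S S' : Set (Eu n)}

/-- `ψ` is a smooth isometry from the metric `K` on `S` into the metric `K'` on `S'`. -/
structure IsIsometryOn (K K' : Eu n → Matrix (Fin n) (Fin n) ℝ) (S S' : Set (Eu n))
    (ψ : Eu n → Eu n) : Prop where
  source : IsMetricOn K S
  target : IsMetricOn K' S'
  smooth : ContDiffOn ℝ ∞ ψ S
  mapsTo : Set.MapsTo ψ S S'
  isometry : ∀ q ∈ S, ∀ a b,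
    metricForm (K' (ψ q)) (fderiv ℝ ψ q a) (fderiv ℝ ψ q b) = metricForm (K q) a b

namespace IsIsometryOn

variable {ψ : Eu n → Eu n}

theorem injective (h : IsIsometryOn K K' S S' ψ) {q : Eu n} (hq : q ∈ S) :
    Function.Injective (fderiv ℝ ψ q) := by
  rw [injective_iff_map_eq_zero]
  intro x hx
  refine metricForm_nondeg (h.source.posDef q hq) fun y => ?_
  rw [← h.isometry q hq, hx]; simp

theorem surjective (h : IsIsometryOn K K' S S' ψ) {q : Eu n} (hq : q ∈ S) :
    Function.Surjective (fderiv ℝ ψ q) :=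
  (LinearMap.injective_iff_surjective (f := (fderiv ℝ ψ q : Eu n →ₗ[ℝ] Eu n))).1 (h.injective hq)

/-- The transformation law of the Christoffel symbols. -/
theorem fderiv_gamma (h : IsIsometryOn K K' S S' ψ) {q : Eu n} (hq : q ∈ S) (x a : Eu n) :
    fderiv ℝ ψ q (gamma K q x a) = covD K' ψ (fun w => fderiv ℝ ψ w a) q x := by
  -- `T` is the connection of `K'` pulled back by `ψ`. It is symmetric and compatible with `K`, so
  -- uniqueness of the Levi-Civita connection makes it `gamma K`.
  choose T hT using fun x a => h.surjective hq (covD K' ψ (fun w => fderiv ℝ ψ w a) q x)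
  have hd : ∀ a, DifferentiableAt ℝ (fun w => fderiv ℝ ψ w a) q := fun a =>
    differentiableAt_of_contDiffOn h.source.isOpen (contDiffOn_fderiv_apply h.source.isOpen h.smooth a) hq
  rw [h.source.gamma_unique hq T, hT]
  · intro a b
    refine h.injective hq ?_
    rw [hT, hT, covD_fderiv_comm h.target h.source.isOpen h.smooth h.mapsTo hq]
  · intro x a b
    rw [dForm, fderiv_clm_apply₂ (h.source.form_differentiableAt hq), ← h.isometry q hq,
      ← h.isometry q hq, hT, hT, ← fderiv_metricForm h.target (h.mapsTo hq)
        (differentiableAt_of_contDiffOn h.source.isOpen h.smooth hq) (hd a) (hd b)]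
    congr 1
    refine Filter.EventuallyEq.fderiv_eq ?_
    filter_upwards [h.source.isOpen.mem_nhds hq] with w hw using (h.isometry w hw a b).symm

variable {X : Type*} [NormedAddCommGroup X] [NormedSpace ℝ X] {P V : X → Eu n} {u : X}

/-- Naturality of the covariant derivative. -/
theorem covD_map (h : IsIsometryOn K K' S S' ψ) (hu : P u ∈ S) (hP : DifferentiableAt ℝ P u)
    (hV : DifferentiableAt ℝ V u) (x : X) :
    covD K' (fun w => ψ (P w)) (fun w => fderiv ℝ ψ (P w) (V w)) u x
      = fderiv ℝ ψ (P u) (covD K P V u x) := by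
  have hψ := differentiableAt_of_contDiffOn h.source.isOpen h.smooth hu
  have h1 : HasFDerivAt (fun w => fderiv ℝ ψ (P w))
      ((fderiv ℝ (fderiv ℝ ψ) (P u)).comp (fderiv ℝ P u)) u :=
    (differentiableAt_of_contDiffOn h.source.isOpen
      (contDiffOn_fderiv h.source.isOpen h.smooth) hu).hasFDerivAt.comp u hP.hasFDerivAt
  rw [covD_apply, (h1.clm_apply hV.hasFDerivAt).fderiv, covD_apply K P, map_add,
    h.fderiv_gamma hu, covD_apply, fderiv_fderiv_apply h.source.isOpen h.smooth hu,
    fderiv_fun_comp _ hψ hP]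
  simp only [add_apply, ContinuousLinearMap.comp_apply, ContinuousLinearMap.flip_apply]
  abel

/-- Naturality of the curvature. -/
theorem curv_map (h : IsIsometryOn K K' S S' ψ) {q : Eu n} (hq : q ∈ S) (a b v : Eu n) :
    curv K' (ψ q) (fderiv ℝ ψ q a) (fderiv ℝ ψ q b) (fderiv ℝ ψ q v)
      = fderiv ℝ ψ q (curv K q a b v) := by
  have hO := h.source.isOpen
  have hid : ∀ {q : Eu n}, DifferentiableAt ℝ (fun w : Eu n => w) q := differentiableAt_id
  -- Both curvatures are written as commutators of covariant derivatives: of `dψ(v)` along `ψ` in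
  -- the target, and of the constant field `v` along the identity in the source. Two applications of
  -- `covD_map` then match them.
  rw [← covD_covD_sub h.target hO h.smooth h.mapsTo (V := fun w => fderiv ℝ ψ w v)
    (contDiffOn_fderiv_apply hO h.smooth v) hq, ← covD_id_covD_sub h.source hq, map_sub]
  have hD : ∀ x : Eu n, DifferentiableAt ℝ (fun q => covD K (fun w => w) (fun _ => v) q x) q :=
    fun x => differentiableAt_of_contDiffOn hO (covD_apply_contDiffOn h.source hO contDiffOn_id
      (Set.mapsTo_id S) contDiffOn_const x) hq
  have key : ∀ a b, covD K' ψ (fun w => covD K' ψ (fun w => fderiv ℝ ψ w v) w b) q a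
      = fderiv ℝ ψ q (covD K (fun w => w) (fun w => covD K (fun w => w) (fun _ => v) w b) q a) := by
    intro a b
    rw [← h.covD_map (P := fun w => w) hq hid (hD b)]
    refine DFunLike.congr_fun (covD_congr Filter.EventuallyEq.rfl ?_) a
    filter_upwards [hO.mem_nhds hq] with w hw
    exact h.covD_map (P := fun w => w) (V := fun _ => v) hw hid (differentiableAt_const _) b
  rw [key, key]

end IsIsometryOn

end Transform

/-! ## The covariant derivative of vector-valued one-forms -/

section OneForms

variable {m n : ℕ}

/-- `(∇_x α)(y) = D_x (α y) - α(∇_x y)`. -/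
def nabla (G : Eu m → Matrix (Fin m) (Fin m) ℝ) (K : Eu n → Matrix (Fin n) (Fin n) ℝ)
    (P : Eu m → Eu n) (α : Eu m → Eu m →L[ℝ] Eu n) (u : Eu m) : Eu m →L[ℝ] Eu m →L[ℝ] Eu n :=
  fderiv ℝ α u + (gamma K (P u)).bilinearComp (fderiv ℝ P u) (α u)
    - (ContinuousLinearMap.compL ℝ (Eu m) (Eu m) (Eu n) (α u)).comp (gamma G u)

theorem nabla_apply {G : Eu m → Matrix (Fin m) (Fin m) ℝ} {K : Eu n → Matrix (Fin n) (Fin n) ℝ}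
    {P : Eu m → Eu n} {α : Eu m → Eu m →L[ℝ] Eu n} {u : Eu m} (hα : DifferentiableAt ℝ α u)
    (x y : Eu m) :
    nabla G K P α u x y = covD K P (fun w => α w y) u x - α u (gamma G u x y) := by
  rw [covD_apply, fderiv_clm_apply hα (differentiableAt_const y)]
  simp [nabla]

variable {G G' : Eu m → Matrix (Fin m) (Fin m) ℝ} {K K' : Eu n → Matrix (Fin n) (Fin n) ℝ}
  {R R' : Set (Eu m)} {S S' : Set (Eu n)} {θ : Eu m → Eu m} {ψ : Eu n → Eu n}
  {P P' : Eu m → Eu n} {α α' : Eu m → Eu m →L[ℝ] Eu n} {u : Eu m}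

/-- Naturality of the covariant derivative of one-forms. -/
theorem nabla_map (hθ : IsIsometryOn G G' R R' θ) (hψ : IsIsometryOn K K' S S' ψ) (hu : u ∈ R)
    (hPu : P u ∈ S) (hP : DifferentiableAt ℝ P u) (hP' : DifferentiableAt ℝ P' (θ u))
    (hα : DifferentiableAt ℝ α u) (hα' : DifferentiableAt ℝ α' (θ u))
    (hPP : ∀ᶠ w in nhds u, P' (θ w) = ψ (P w))
    (hαα : ∀ᶠ w in nhds u, ∀ x, α' (θ w) (fderiv ℝ θ w x) = fderiv ℝ ψ (P w) (α w x)) (x y : Eu m) :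
    nabla G' K' P' α' (θ u) (fderiv ℝ θ u x) (fderiv ℝ θ u y)
      = fderiv ℝ ψ (P u) (nabla G K P α u x y) := by
  have hR := hθ.source.isOpen
  have hθd := differentiableAt_of_contDiffOn hR hθ.smooth hu
  have e1 : covD K' (fun w => P' (θ w)) (fun w => α' (θ w) (fderiv ℝ θ w y)) u x
      = fderiv ℝ ψ (P u) (covD K P (fun w => α w y) u x) := by
    rw [← hψ.covD_map hPu hP (hα.clm_apply (differentiableAt_const y))]
    refine DFunLike.congr_fun (covD_congr hPP ?_) x
    filter_upwards [hαα] with w hw using hw y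
  rw [nabla_apply hα, nabla_apply hα', map_sub, ← e1, ← hαα.self_of_nhds,
    hθ.fderiv_gamma hu, covD_apply, covD_apply, covD_apply, map_add]
  -- In `e1` the argument `fderiv ℝ θ w y` of `α'` varies with `w`. Its derivative contributes `α'`
  -- of the second derivative of `θ`, which cancels the same term in the transformation law of
  -- `gamma G`.
  have h1 : HasFDerivAt (fun w => α' (θ w)) ((fderiv ℝ α' (θ u)).comp (fderiv ℝ θ u)) u :=
    hα'.hasFDerivAt.comp u hθd.hasFDerivAt
  have h2 := h1.clm_apply (differentiableAt_of_contDiffOn hR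
    (contDiffOn_fderiv_apply hR hθ.smooth y) hu).hasFDerivAt
  rw [h2.fderiv, fderiv_clm_apply hα' (differentiableAt_const _), fderiv_fun_comp _ hP' hθd]
  simp only [add_apply, ContinuousLinearMap.comp_apply, ContinuousLinearMap.flip_apply,
    fderiv_fun_const, Pi.zero_apply, ContinuousLinearMap.comp_zero, zero_apply]
  abel

end OneForms

/-! ## The tension field and its first variation in coordinates -/

section Variation

variable {m n : ℕ}

/-- The tension field of a map between open sets with metrics `G` and `K`. -/
def coordTension (G : Eu m → Matrix (Fin m) (Fin m) ℝ) (K : Eu n → Matrix (Fin n) (Fin n) ℝ)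
    (P : Eu m → Eu n) (u : Eu m) : Eu n :=
  metricTrace (G u) (nabla G K P (fderiv ℝ P) u)

/-- The rough Laplacian `Trace ∇²V` of a vector field along a map. -/
def roughLaplacian (G : Eu m → Matrix (Fin m) (Fin m) ℝ) (K : Eu n → Matrix (Fin n) (Fin n) ℝ)
    (P V : Eu m → Eu n) (u : Eu m) : Eu n :=
  metricTrace (G u) (nabla G K P (covD K P V) u)

/-- The Jacobi operator `Trace ∇²V + Trace R(V, dP)dP`. -/
def jacobiOp (G : Eu m → Matrix (Fin m) (Fin m) ℝ) (K : Eu n → Matrix (Fin n) (Fin n) ℝ)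
    (P V : Eu m → Eu n) (u : Eu m) : Eu n :=
  roughLaplacian G K P V u + ∑ i, ∑ j, (G u)⁻¹ i j •
    curv K (P u) (V u) (fderiv ℝ P u (stdVec i)) (fderiv ℝ P u (stdVec j))

variable {G : Eu m → Matrix (Fin m) (Fin m) ℝ} {K : Eu n → Matrix (Fin n) (Fin n) ℝ}
  {R : Set (Eu m)} {S : Set (Eu n)}

theorem fderiv_comp_prodMk {Z : Type*} [NormedAddCommGroup Z] [NormedSpace ℝ Z]
    {Q : ℝ × Eu m → Z} {t : ℝ} {u : Eu m} (hQ : DifferentiableAt ℝ Q (t, u)) (x : Eu m) :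
    fderiv ℝ (fun w => Q (t, w)) u x = fderiv ℝ Q (t, u) (0, x) := by
  have h : HasFDerivAt (fun w : Eu m => (t, w)) (ContinuousLinearMap.inr ℝ ℝ (Eu m)) u :=
    hasFDerivAt_prodMk_right t u
  have := hQ.hasFDerivAt.comp u h
  rw [show (fun w => Q (t, w)) = Q ∘ fun w => (t, w) from rfl, this.fderiv]
  simp

theorem covD_comp_prodMk {Q V : ℝ × Eu m → Eu n} {t : ℝ} {u : Eu m}
    (hQ : DifferentiableAt ℝ Q (t, u)) (hV : DifferentiableAt ℝ V (t, u)) (x : Eu m) :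
    covD K (fun w => Q (t, w)) (fun w => V (t, w)) u x = covD K Q V (t, u) (0, x) := by
  rw [covD_apply, covD_apply, fderiv_comp_prodMk hQ, fderiv_comp_prodMk hV]

theorem isOpen_slice {O : Set (ℝ × Eu m)} (hO : IsOpen O) (t : ℝ) : IsOpen {w : Eu m | (t, w) ∈ O} :=
  hO.preimage (Continuous.prodMk_right t)

theorem contDiffOn_slice {Z : Type*} [NormedAddCommGroup Z] [NormedSpace ℝ Z]
    {O : Set (ℝ × Eu m)} {Q : ℝ × Eu m → Z} (hQ : ContDiffOn ℝ ∞ Q O) (t : ℝ) :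
    ContDiffOn ℝ ∞ (fun w => Q (t, w)) {w : Eu m | (t, w) ∈ O} :=
  hQ.comp (contDiff_prodMk_right t).contDiffOn fun _ hw => hw

/-! ### First variation of the tension field in a family of maps -/

section Family

variable {Q : ℝ × Eu m → Eu n} {O : Set (ℝ × Eu m)}

/-- The tension field of the members of a family of maps. -/
def familyTension (G : Eu m → Matrix (Fin m) (Fin m) ℝ) (K : Eu n → Matrix (Fin n) (Fin n) ℝ)
    (Q : ℝ × Eu m → Eu n) (p : ℝ × Eu m) : Eu n :=
  ∑ i, ∑ j, (G p.2)⁻¹ i j • (covD K Q (fun p => fderiv ℝ Q p (0, stdVec j)) p (0, stdVec i)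
    - ∑ k, gamma G p.2 (stdVec i) (stdVec j) k • fderiv ℝ Q p (0, stdVec k))

/-- Moves the tension field of each member to the product `ℝ × Eu m`, where the time direction `(1,
0)` and the space directions `(0, x)` are arguments of one covariant derivative and can be
interchanged. -/
theorem coordTension_family (hO : IsOpen O) (hQ : ContDiffOn ℝ ∞ Q O) {t : ℝ} {u : Eu m}
    (hp : (t, u) ∈ O) :
    coordTension G K (fun w => Q (t, w)) u = familyTension G K Q (t, u) := by
  have hu : u ∈ {w : Eu m | (t, w) ∈ O} := hp
  have hQt := contDiffOn_slice hQ t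
  have hOt := isOpen_slice hO t
  rw [coordTension, metricTrace, familyTension]
  refine Finset.sum_congr rfl fun i _ => Finset.sum_congr rfl fun j _ => ?_
  rw [nabla_apply (differentiableAt_of_contDiffOn hOt (contDiffOn_fderiv hOt hQt) hu)]
  congr 2
  · rw [← covD_comp_prodMk (differentiableAt_of_contDiffOn hO hQ hp)
      (differentiableAt_of_contDiffOn hO (contDiffOn_fderiv_apply hO hQ _) hp)]
    refine DFunLike.congr_fun (covD_congr Filter.EventuallyEq.rfl ?_) _
    filter_upwards [hOt.mem_nhds hu] with w hw
    exact fderiv_comp_prodMk (differentiableAt_of_contDiffOn hO hQ hw) _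
  · conv_lhs => rw [← sum_coord_smul (gamma G u (stdVec i) (stdVec j))]
    rw [map_sum]
    refine Finset.sum_congr rfl fun k _ => ?_
    rw [map_smul, fderiv_comp_prodMk (differentiableAt_of_contDiffOn hO hQ hp)]

theorem familyTension_contDiffOn (hG : IsMetricOn G R) (hK : IsMetricOn K S) (hO : IsOpen O)
    (hQ : ContDiffOn ℝ ∞ Q O) (hOR : ∀ p ∈ O, p.2 ∈ R) (hQS : Set.MapsTo Q O S) :
    ContDiffOn ℝ ∞ (familyTension G K Q) O := by
  unfold familyTension
  have hgam : ∀ i j k, ContDiffOn ℝ ∞ (fun w => gamma G w (stdVec i) (stdVec j) k) R := fun i j k => by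
    simp only [gamma_single_apply]
    exact hG.christoffel_smooth k i j
  exact ContDiffOn.sum fun i _ => ContDiffOn.sum fun j _ =>
    ((hG.inv_smooth i j).comp contDiff_snd.contDiffOn hOR).smul
      ((covD_apply_contDiffOn hK hO hQ hQS (contDiffOn_fderiv_apply hO hQ _) _).sub
        (ContDiffOn.sum fun k _ => ((hgam i j k).comp contDiff_snd.contDiffOn hOR).smul
          (contDiffOn_fderiv_apply hO hQ _)))

theorem covD_smul_snd {a : Eu m → ℝ} {V : ℝ × Eu m → Eu n} {p : ℝ × Eu m}
    (ha : DifferentiableAt ℝ a p.2) (hV : DifferentiableAt ℝ V p) :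
    covD K Q (fun p => a p.2 • V p) p (1, 0) = a p.2 • covD K Q V p (1, 0) := by
  have h : HasFDerivAt (fun p : ℝ × Eu m => a p.2)
      ((fderiv ℝ a p.2).comp (ContinuousLinearMap.snd ℝ ℝ (Eu m))) p :=
    ha.hasFDerivAt.comp p hasFDerivAt_snd
  rw [covD_smul K Q h.differentiableAt hV, h.fderiv]
  simp

/-- The first variation of the tension field. -/
theorem covD_familyTension (hG : IsMetricOn G R) (hK : IsMetricOn K S) (hO : IsOpen O)
    (hQ : ContDiffOn ℝ ∞ Q O) (hOR : ∀ p ∈ O, p.2 ∈ R) (hQS : Set.MapsTo Q O S) {t : ℝ} {u : Eu m}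
    (hp : (t, u) ∈ O) :
    covD K Q (familyTension G K Q) (t, u) (1, 0)
      = jacobiOp G K (fun w => Q (t, w)) (fun w => fderiv ℝ Q (t, w) (1, 0)) u := by
  have hu : u ∈ {w : Eu m | (t, w) ∈ O} := hp
  have hQt := contDiffOn_slice hQ t
  have hOt := isOpen_slice hO t
  have hdQ : ∀ x, ContDiffOn ℝ ∞ (fun p => fderiv ℝ Q p x) O := contDiffOn_fderiv_apply hO hQ
  have hdif := fun {V : ℝ × Eu m → Eu n} (hV : ContDiffOn ℝ ∞ V O) =>
    differentiableAt_of_contDiffOn hO hV hp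
  have hDD : ∀ x y, ContDiffOn ℝ ∞ (fun p => covD K Q (fun p => fderiv ℝ Q p y) p x) O :=
    fun x y => covD_apply_contDiffOn hK hO hQ hQS (hdQ y) x
  have hginv : ∀ i j, DifferentiableAt ℝ (fun w => (G w)⁻¹ i j) u := fun i j =>
    differentiableAt_of_contDiffOn hG.isOpen (hG.inv_smooth i j) (hOR _ hp)
  have hgam : ∀ i j k, ContDiffOn ℝ ∞ (fun w => gamma G w (stdVec i) (stdVec j) k) R := fun i j k => by
    simp only [gamma_single_apply]
    exact hG.christoffel_smooth k i j
  have hgs : ∀ i j k, ContDiffOn ℝ ∞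
      (fun p : ℝ × Eu m => gamma G p.2 (stdVec i) (stdVec j) k • fderiv ℝ Q p (0, stdVec k)) O :=
    fun i j k => ((hgam i j k).comp contDiff_snd.contDiffOn hOR).smul (hdQ _)
  have hsum : ∀ i j, ContDiffOn ℝ ∞ (fun p : ℝ × Eu m =>
      ∑ k, gamma G p.2 (stdVec i) (stdVec j) k • fderiv ℝ Q p (0, stdVec k)) O :=
    fun i j => ContDiffOn.sum fun k _ => hgs i j k
  have hall : ∀ i j, ContDiffOn ℝ ∞ (fun p : ℝ × Eu m =>
      (G p.2)⁻¹ i j • (covD K Q (fun p => fderiv ℝ Q p (0, stdVec j)) p (0, stdVec i)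
    - ∑ k, gamma G p.2 (stdVec i) (stdVec j) k • fderiv ℝ Q p (0, stdVec k))) O := fun i j =>
    ((hG.inv_smooth i j).comp contDiff_snd.contDiffOn hOR).smul ((hDD _ _).sub (hsum i j))
  have hDV : ∀ x, ContDiffOn ℝ ∞ (fun p => covD K Q (fun p => fderiv ℝ Q p (1, 0)) p x) O :=
    fun x => hDD x _
  unfold familyTension
  rw [covD_sum _ _ _ fun i _ => hdif (ContDiffOn.sum fun j _ => hall i j), jacobiOp, roughLaplacian,
    metricTrace, ← Finset.sum_add_distrib]
  refine Finset.sum_congr rfl fun i _ => ?_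
  rw [covD_sum _ _ _ fun j _ => hdif (hall i j), ← Finset.sum_add_distrib]
  refine Finset.sum_congr rfl fun j _ => ?_
  rw [covD_smul_snd (a := fun w => (G w)⁻¹ i j) (hginv i j) (hdif ((hDD _ _).sub (hsum i j))),
    ← smul_add]
  congr 1
  rw [covD_sub _ _ (hdif (hDD _ _)) (hdif (hsum i j)), covD_sum _ _ _ fun k _ => hdif (hgs i j k)]
  have e1 : ∀ k, covD K Q (fun p : ℝ × Eu m =>
      gamma G p.2 (stdVec i) (stdVec j) k • fderiv ℝ Q p (0, stdVec k)) (t, u) (1, 0)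
      = gamma G u (stdVec i) (stdVec j) k •
        covD K Q (fun p => fderiv ℝ Q p (1, 0)) (t, u) (0, stdVec k) := by
    intro k
    rw [covD_smul_snd (a := fun w => gamma G w (stdVec i) (stdVec j) k)
      (differentiableAt_of_contDiffOn hG.isOpen (hgam i j k) (hOR _ hp)) (hdif (hdQ _)),
      covD_fderiv_comm hK hO hQ hQS hp]
  -- Moving the time derivative past the outer space derivative costs `R(V, dP eᵢ) dP eⱼ`, the
  -- curvature term of the Jacobi operator. Past the inner one (`e5`) it costs nothing, because the
  -- connection has no torsion.
  have e2 := covD_covD_sub hK hO hQ hQS (hdQ (0, stdVec j)) hp (1, 0) (0, stdVec i)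
  rw [sub_eq_iff_eq_add] at e2
  have hV' : ContDiffOn ℝ ∞ (fun w => fderiv ℝ Q (t, w) (1, 0)) {w : Eu m | (t, w) ∈ O} :=
    contDiffOn_slice (hdQ (1, 0)) t
  have hPS : Set.MapsTo (fun w => Q (t, w)) {w : Eu m | (t, w) ∈ O} S := fun w hw => hQS hw
  have e3 : ∀ w ∈ {w : Eu m | (t, w) ∈ O}, ∀ x,
      covD K (fun w => Q (t, w)) (fun w => fderiv ℝ Q (t, w) (1, 0)) w x
      = covD K Q (fun p => fderiv ℝ Q p (1, 0)) (t, w) (0, x) := fun w hw x =>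
    covD_comp_prodMk (V := fun p => fderiv ℝ Q p (1, 0)) (differentiableAt_of_contDiffOn hO hQ hw)
      (differentiableAt_of_contDiffOn hO (hdQ _) hw) x
  rw [e2, Finset.sum_congr rfl fun k _ => e1 k,
    nabla_apply (differentiableAt_of_contDiffOn hOt (covD_contDiffOn hK hOt hQt hPS hV') hu),
    e3 u hu, fderiv_comp_prodMk (hdif hQ), fderiv_comp_prodMk (hdif hQ)]
  have e4 : covD K (fun w => Q (t, w))
      (fun w => covD K (fun w => Q (t, w)) (fun w => fderiv ℝ Q (t, w) (1, 0)) w (stdVec j)) u (stdVec i)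
      = covD K Q (fun p => covD K Q (fun p => fderiv ℝ Q p (1, 0)) p (0, stdVec j)) (t, u)
        (0, stdVec i) := by
    rw [← covD_comp_prodMk (hdif hQ) (hdif (hDV _))]
    refine DFunLike.congr_fun (covD_congr Filter.EventuallyEq.rfl ?_) _
    filter_upwards [hOt.mem_nhds hu] with w hw using e3 w hw _
  have e5 : covD K Q (fun p => covD K Q (fun p => fderiv ℝ Q p (0, stdVec j)) p (1, 0)) (t, u)
      (0, stdVec i) = covD K Q (fun p => covD K Q (fun p => fderiv ℝ Q p (1, 0)) p (0, stdVec j)) (t, u)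
        (0, stdVec i) := by
    refine DFunLike.congr_fun (covD_congr Filter.EventuallyEq.rfl ?_) _
    filter_upwards [hO.mem_nhds hp] with w hw using covD_fderiv_comm hK hO hQ hQS hw _ _
  have e6 : covD K Q (fun p => fderiv ℝ Q p (1, 0)) (t, u) (0, gamma G u (stdVec i) (stdVec j))
      = ∑ k, gamma G u (stdVec i) (stdVec j) k •
        covD K Q (fun p => fderiv ℝ Q p (1, 0)) (t, u) (0, stdVec k) := by
    have : ((0 : ℝ), gamma G u (stdVec i) (stdVec j))
        = ∑ k, gamma G u (stdVec i) (stdVec j) k • ((0 : ℝ), (stdVec k : Eu m)) := by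
      conv_lhs => rw [← sum_coord_smul (gamma G u (stdVec i) (stdVec j))]
      simp [Prod.ext_iff, Prod.fst_sum, Prod.snd_sum]
    rw [this, map_sum]
    simp_rw [map_smul]
  rw [e4, e5, e6]
  abel

/-- The first variation of the squared norm of the tension field. -/
theorem fderiv_normSq_familyTension (hG : IsMetricOn G R) (hK : IsMetricOn K S) (hO : IsOpen O)
    (hQ : ContDiffOn ℝ ∞ Q O) (hOR : ∀ p ∈ O, p.2 ∈ R) (hQS : Set.MapsTo Q O S) {t : ℝ} {u : Eu m}
    (hp : (t, u) ∈ O) :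
    fderiv ℝ (fun p => metricForm (K (Q p)) (familyTension G K Q p) (familyTension G K Q p))
        (t, u) (1, 0)
      = 2 * metricForm (K (Q (t, u)))
        (jacobiOp G K (fun w => Q (t, w)) (fun w => fderiv ℝ Q (t, w) (1, 0)) u)
        (coordTension G K (fun w => Q (t, w)) u) := by
  have h := differentiableAt_of_contDiffOn hO (familyTension_contDiffOn hG hK hO hQ hOR hQS) hp
  rw [fderiv_metricForm hK (hQS hp) (differentiableAt_of_contDiffOn hO hQ hp) h h,
    metricForm_comm (hK.posDef _ (hQS hp)) (familyTension G K Q (t, u)),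
    covD_familyTension hG hK hO hQ hOR hQS hp, coordTension_family hO hQ hp]
  ring

end Family

end Variation

/-! ## Integration by parts -/

section Divergence

variable {m n : ℕ}

/-- The open sets `O` and the complement of `C` cover the space; the extension by zero agrees with
`f` on the first and with `0` on the second. -/
theorem contDiff_indicator_of_compact {E : Type*} [NormedAddCommGroup E] [NormedSpace ℝ E]
    {O C : Set E} (hO : IsOpen O) (hC : IsCompact C) (hCO : C ⊆ O) {k : WithTop ℕ∞} {f : E → ℝ}
    (hf : ContDiffOn ℝ k f O) (h0 : ∀ u ∈ O, u ∉ C → f u = 0) : ContDiff ℝ k (O.indicator f) := by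
  rw [contDiff_iff_contDiffAt]
  intro u
  by_cases hu : u ∈ O
  · refine (hf.contDiffAt (hO.mem_nhds hu)).congr_of_eventuallyEq ?_
    filter_upwards [hO.mem_nhds hu] with w hw using Set.indicator_of_mem hw f
  · refine (contDiffAt_const (c := (0 : ℝ))).congr_of_eventuallyEq ?_
    filter_upwards [hC.isClosed.isOpen_compl.mem_nhds fun h => hu (hCO h)] with w hw
    by_cases hwO : w ∈ O
    · rw [Set.indicator_of_mem hwO, h0 w hwO hw]
    · exact Set.indicator_of_notMem hwO f

theorem hasCompactSupport_indicator {E : Type*} [TopologicalSpace E] [R1Space E]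
    {O C : Set E} (hC : IsCompact C) {f : E → ℝ}
    (h0 : ∀ u ∈ O, u ∉ C → f u = 0) : HasCompactSupport (O.indicator f) := by
  refine HasCompactSupport.intro hC fun u hu => ?_
  by_cases huO : u ∈ O
  · rw [Set.indicator_of_mem huO, h0 u huO hu]
  · exact Set.indicator_of_notMem huO f

theorem integrableOn_of_eq_zero_off_compact {O C : Set (Eu m)} (hO : IsOpen O) (hC : IsCompact C)
    (hCO : C ⊆ O) {f : Eu m → ℝ} (hf : ContDiffOn ℝ ∞ f O) (h0 : ∀ u ∈ O, u ∉ C → f u = 0) :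
    IntegrableOn f O := by
  rw [← integrable_indicator_iff hO.measurableSet]
  exact (contDiff_indicator_of_compact hO hC hCO hf h0).continuous.integrable_of_hasCompactSupport
    (hasCompactSupport_indicator hC h0)

/-- Integration by parts against the constant function `1`. -/
theorem integral_fderiv_eq_zero {f : Eu m → ℝ} (hf : ContDiff ℝ ∞ f) (hc : HasCompactSupport f)
    (x : Eu m) : ∫ u, fderiv ℝ f u x = 0 := by
  have hf' : Continuous fun u => fderiv ℝ f u x := (hf.continuous_fderiv (by simp)).clm_apply continuous_const
  have := integral_mul_fderiv_eq_neg_fderiv_mul_of_integrable (μ := (volume : Measure (Eu m)))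
    (f := f) (g := fun _ => (1 : ℝ)) (v := x) ?_ ?_ ?_
    (fun y _ => hf.differentiable (by simp) y) (fun _ _ => differentiableAt_const _)
  · simpa using this
  · simpa using hf'.integrable_of_hasCompactSupport (hc.fderiv_apply (𝕜 := ℝ) x)
  · simp
  · simpa using hf.continuous.integrable_of_hasCompactSupport hc

/-- The divergence theorem for fields of compact support. -/
theorem setIntegral_divergence_eq_zero {O C : Set (Eu m)} (hO : IsOpen O) (hC : IsCompact C)
    (hCO : C ⊆ O) {X : Fin m → Eu m → ℝ} (hX : ∀ i, ContDiffOn ℝ ∞ (X i) O)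
    (h0 : ∀ i, ∀ u ∈ O, u ∉ C → X i u = 0) :
    ∫ u in O, ∑ i, fderiv ℝ (X i) u (stdVec i) = 0 := by
  have hsm := fun i => contDiff_indicator_of_compact hO hC hCO (hX i) (h0 i)
  have hcs := fun i => hasCompactSupport_indicator (O := O) hC (h0 i)
  have h1 : ∀ i, ∫ u in O, fderiv ℝ (X i) u (stdVec i) = 0 := by
    intro i
    rw [← integral_fderiv_eq_zero (hsm i) (hcs i) (stdVec i)]
    have hout : ∀ u, u ∉ O → fderiv ℝ (O.indicator (X i)) u (stdVec i) = 0 := by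
      intro u hu
      have : O.indicator (X i) =ᶠ[nhds u] fun _ => (0 : ℝ) := by
        filter_upwards [hC.isClosed.isOpen_compl.mem_nhds fun h => hu (hCO h)] with w hw
        by_cases hwO : w ∈ O
        · rw [Set.indicator_of_mem hwO, h0 i w hwO hw]
        · exact Set.indicator_of_notMem hwO _
      rw [this.fderiv_eq]; simp
    rw [← setIntegral_eq_integral_of_forall_compl_eq_zero hout]
    refine setIntegral_congr_fun hO.measurableSet fun u hu => ?_
    have : X i =ᶠ[nhds u] O.indicator (X i) := by
      filter_upwards [hO.mem_nhds hu] with w hw using (Set.indicator_of_mem hw _).symm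
    exact DFunLike.congr_fun this.fderiv_eq _
  rw [integral_finsetSum, Finset.sum_eq_zero fun i _ => h1 i]
  intro i _
  refine integrableOn_of_eq_zero_off_compact hO hC hCO (contDiffOn_fderiv_apply hO (hX i) _) ?_
  intro u hu huC
  have : X i =ᶠ[nhds u] fun _ => (0 : ℝ) := by
    filter_upwards [hC.isClosed.isOpen_compl.mem_nhds huC, hO.mem_nhds hu] with w hw hwO
      using h0 i w hwO hw
  rw [this.fderiv_eq]; simp

variable {G : Eu m → Matrix (Fin m) (Fin m) ℝ} {K : Eu n → Matrix (Fin n) (Fin n) ℝ}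
  {O : Set (Eu m)} {S : Set (Eu n)} {P V W : Eu m → Eu n}

/-- The Riemannian divergence of a one-form in coordinates. -/
theorem sum_fderiv_sqrt_det_mul (hG : IsMetricOn G O) {a : Fin m → Eu m → ℝ} {u : Eu m} (hu : u ∈ O)
    (ha : ∀ j, DifferentiableAt ℝ (a j) u) :
    ∑ i, fderiv ℝ (fun w => Real.sqrt (G w).det * ∑ j, (G w)⁻¹ i j * a j w) u (stdVec i)
      = Real.sqrt (G u).det * ∑ i, ∑ j, (G u)⁻¹ i j *
        (fderiv ℝ (a j) u (stdVec i) - ∑ k, gamma G u (stdVec i) (stdVec j) k * a k u) := by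
  have hp := hG.posDef u hu
  have hs : DifferentiableAt ℝ (fun w => Real.sqrt (G w).det) u :=
    (differentiableAt_of_contDiffOn hG.isOpen (ContDiffOn.matrix_det hG.smooth) hu).sqrt hp.det_pos.ne'
  have hi : ∀ i j, DifferentiableAt ℝ (fun w => (G w)⁻¹ i j) u := fun i j =>
    differentiableAt_of_contDiffOn hG.isOpen (hG.inv_smooth i j) hu
  have h1 : ∀ i, fderiv ℝ (fun w => Real.sqrt (G w).det * ∑ j, (G w)⁻¹ i j * a j w) u (stdVec i)
      = Real.sqrt (G u).det * ((∑ j, (G u)⁻¹ i j * fderiv ℝ (a j) u (stdVec i))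
        - (∑ j, ∑ l, (G u)⁻¹ l j * gamma G u (stdVec i) (stdVec l) i * a j u)
        - (∑ j, ∑ l, (G u)⁻¹ i l * gamma G u (stdVec i) (stdVec l) j * a j u)
        + ∑ j, ∑ l, (G u)⁻¹ i j * gamma G u (stdVec i) (stdVec l) l * a j u) := by
    intro i
    have hsum : HasFDerivAt (fun w => ∑ j, (G w)⁻¹ i j * a j w)
        (∑ j, ((G u)⁻¹ i j • fderiv ℝ (a j) u + a j u • fderiv ℝ (fun w => (G w)⁻¹ i j) u)) u :=
      HasFDerivAt.fun_sum fun j _ => (hi i j).hasFDerivAt.mul (ha j).hasFDerivAt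
    have hmul : HasFDerivAt (fun w => Real.sqrt (G w).det * ∑ j, (G w)⁻¹ i j * a j w) _ u :=
      hs.hasFDerivAt.mul hsum
    rw [hmul.fderiv]
    simp only [add_apply, smul_apply, sum_apply, smul_eq_mul, hG.fderiv_sqrt_det hu,
      hG.fderiv_inv hu, Finset.sum_add_distrib]
    have e1 : ∑ j, a j u * -(∑ l, (G u)⁻¹ l j * gamma G u (stdVec i) (stdVec l) i
        + ∑ l, (G u)⁻¹ i l * gamma G u (stdVec i) (stdVec l) j)
        = - (∑ j, ∑ l, (G u)⁻¹ l j * gamma G u (stdVec i) (stdVec l) i * a j u)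
        - (∑ j, ∑ l, (G u)⁻¹ i l * gamma G u (stdVec i) (stdVec l) j * a j u) := by
      rw [← Finset.sum_neg_distrib, ← Finset.sum_sub_distrib]
      refine Finset.sum_congr rfl fun j _ => ?_
      rw [← Finset.sum_mul, ← Finset.sum_mul]; ring
    have e2 : (∑ j, (G u)⁻¹ i j * a j u) * ∑ l, gamma G u (stdVec i) (stdVec l) l
        = ∑ j, ∑ l, (G u)⁻¹ i j * gamma G u (stdVec i) (stdVec l) l * a j u := by
      rw [Finset.sum_mul]
      refine Finset.sum_congr rfl fun j _ => ?_
      rw [Finset.mul_sum]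
      exact Finset.sum_congr rfl fun l _ => by ring
    rw [e1, ← e2]; ring
  rw [Finset.sum_congr rfl fun i _ => h1 i, ← Finset.mul_sum, Finset.sum_add_distrib,
    Finset.sum_sub_distrib, Finset.sum_sub_distrib]
  -- The derivative of the volume density cancels one of the two Christoffel terms coming from the
  -- derivative of the inverse metric. The other, `h3`, is the correction that turns partial
  -- derivatives of the one-form into covariant ones.
  have h2 : ∑ i, ∑ j, ∑ l, (G u)⁻¹ l j * gamma G u (stdVec i) (stdVec l) i * a j u
      = ∑ i, ∑ j, ∑ l, (G u)⁻¹ i j * gamma G u (stdVec i) (stdVec l) l * a j u := by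
    have : ∀ i : Fin m, ∑ j, ∑ l, (G u)⁻¹ l j * gamma G u (stdVec i) (stdVec l) i * a j u
        = ∑ l, ∑ j, (G u)⁻¹ l j * gamma G u (stdVec i) (stdVec l) i * a j u := fun i =>
      Finset.sum_comm
    simp_rw [this]
    rw [Finset.sum_comm]
    refine Finset.sum_congr rfl fun l _ => ?_
    rw [Finset.sum_comm]
    refine Finset.sum_congr rfl fun j _ => Finset.sum_congr rfl fun i _ => ?_
    rw [hG.gamma_comm hu]
  have h3 : ∑ i, ∑ j, ∑ l, (G u)⁻¹ i l * gamma G u (stdVec i) (stdVec l) j * a j u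
      = ∑ i, ∑ j, (G u)⁻¹ i j * ∑ k, gamma G u (stdVec i) (stdVec j) k * a k u := by
    refine Finset.sum_congr rfl fun i _ => ?_
    rw [Finset.sum_comm]
    refine Finset.sum_congr rfl fun l _ => ?_
    rw [Finset.mul_sum]
    exact Finset.sum_congr rfl fun j _ => by ring
  rw [h2, h3]
  simp_rw [mul_sub, Finset.sum_sub_distrib]
  ring

theorem metricForm_jacobiOp_eq (V' W' : Eu m → Eu n) (u : Eu m) : metricForm (K (P u)) (jacobiOp G K P V' u) (W' u)
      = (∑ i, ∑ j, (G u)⁻¹ i j * metricForm (K (P u)) (nabla G K P (covD K P V') u (stdVec i) (stdVec j)) (W' u))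
      + ∑ i, ∑ j, (G u)⁻¹ i j * metricForm (K (P u)) (curv K (P u) (V' u) (fderiv ℝ P u (stdVec i))
        (fderiv ℝ P u (stdVec j))) (W' u) := by
  simp [jacobiOp, roughLaplacian, metricTrace, sum_apply]

/-- Green's identity for the Jacobi operator, pointwise. -/
theorem metricForm_jacobiOp_sub (hG : IsMetricOn G O) (hK : IsMetricOn K S)
    (hP : ContDiffOn ℝ ∞ P O) (hPS : Set.MapsTo P O S) (hV : ContDiffOn ℝ ∞ V O)
    (hW : ContDiffOn ℝ ∞ W O) {u : Eu m} (hu : u ∈ O) :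
    Real.sqrt (G u).det * (metricForm (K (P u)) (jacobiOp G K P V u) (W u)
        - metricForm (K (P u)) (V u) (jacobiOp G K P W u))
      = ∑ i, fderiv ℝ (fun w => Real.sqrt (G w).det * ∑ j, (G w)⁻¹ i j *
        (metricForm (K (P w)) (covD K P V w (stdVec j)) (W w)
          - metricForm (K (P w)) (V w) (covD K P W w (stdVec j)))) u (stdVec i) := by
  have hO := hG.isOpen
  have hp := hG.posDef u hu
  have hdif := fun {V : Eu m → Eu n} (hV : ContDiffOn ℝ ∞ V O) => differentiableAt_of_contDiffOn hO hV hu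
  have hDV := fun x => covD_apply_contDiffOn hK hO hP hPS hV x
  have hDW := fun x => covD_apply_contDiffOn hK hO hP hPS hW x
  have hpair := fun {V W : Eu m → Eu n} (hV : ContDiffOn ℝ ∞ V O) (hW : ContDiffOn ℝ ∞ W O) =>
    differentiableAt_of_contDiffOn hO (contDiffOn_metricForm hK hP hPS hV hW) hu
  rw [sum_fderiv_sqrt_det_mul hG hu (a := fun j w =>
      metricForm (K (P w)) (covD K P V w (stdVec j)) (W w)
          - metricForm (K (P w)) (V w) (covD K P W w (stdVec j)))
      fun j => (hpair (hDV _) hW).sub (hpair hV (hDW _))]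
  congr 1
  have hnV := differentiableAt_of_contDiffOn hO (covD_contDiffOn hK hO hP hPS hV) hu
  have hnW := differentiableAt_of_contDiffOn hO (covD_contDiffOn hK hO hP hPS hW) hu
  have hΓ : ∀ (V : Eu m → Eu n) (x y : Eu m), covD K P V u (gamma G u x y)
      = ∑ k, gamma G u x y k • covD K P V u (stdVec k) := by
    intro V x y
    conv_lhs => rw [← sum_coord_smul (gamma G u x y)]
    simp
  have hpt : ∀ i j, fderiv ℝ (fun w => metricForm (K (P w)) (covD K P V w (stdVec j)) (W w)
      - metricForm (K (P w)) (V w) (covD K P W w (stdVec j))) u (stdVec i)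
      - ∑ k, gamma G u (stdVec i) (stdVec j) k * (metricForm (K (P u)) (covD K P V u (stdVec k)) (W u)
          - metricForm (K (P u)) (V u) (covD K P W u (stdVec k)))
      = metricForm (K (P u)) (nabla G K P (covD K P V) u (stdVec i) (stdVec j)) (W u)
        - metricForm (K (P u)) (nabla G K P (covD K P W) u (stdVec i) (stdVec j)) (V u)
        + (metricForm (K (P u)) (covD K P V u (stdVec j)) (covD K P W u (stdVec i))
          - metricForm (K (P u)) (covD K P V u (stdVec i)) (covD K P W u (stdVec j))) := by
    intro i j
    rw [fderiv_fun_sub (hpair (hDV _) hW) (hpair hV (hDW _)), sub_apply,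
      fderiv_metricForm hK (hPS hu) (hdif hP) (hdif (hDV _)) (hdif hW),
      fderiv_metricForm hK (hPS hu) (hdif hP) (hdif hV) (hdif (hDW _)), nabla_apply hnV,
      nabla_apply hnW, hΓ V, hΓ W]
    simp only [map_sub, sub_apply, map_sum, sum_apply, map_smul, smul_apply, smul_eq_mul, mul_sub,
      Finset.sum_sub_distrib]
    have hc := fun y => metricForm_comm (hK.posDef _ (hPS hu)) (V u) y
    simp only [hc]
    ring
  simp_rw [hpt]
  rw [metricForm_comm (hK.posDef _ (hPS hu)) (V u), metricForm_jacobiOp_eq, metricForm_jacobiOp_eq]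
  simp_rw [mul_add, mul_sub, Finset.sum_add_distrib, Finset.sum_sub_distrib]
  -- After integration by parts the products of two first derivatives cancel by symmetry of the
  -- inverse metric, and the curvature terms cancel (`hcurv`) because `V ↦ R(V, a)b`, traced over
  -- `a` and `b`, is self-adjoint by pair symmetry.
  have hsymm : ∑ i, ∑ j, (G u)⁻¹ i j *
      metricForm (K (P u)) (covD K P V u (stdVec j)) (covD K P W u (stdVec i))
      = ∑ i, ∑ j, (G u)⁻¹ i j *
      metricForm (K (P u)) (covD K P V u (stdVec i)) (covD K P W u (stdVec j)) := by
    rw [Finset.sum_comm]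
    exact Finset.sum_congr rfl fun i _ => Finset.sum_congr rfl fun j _ => by rw [inv_symm hp]
  have hcurv : ∑ i, ∑ j, (G u)⁻¹ i j * metricForm (K (P u)) (curv K (P u) (V u)
      (fderiv ℝ P u (stdVec i)) (fderiv ℝ P u (stdVec j))) (W u)
      = ∑ i, ∑ j, (G u)⁻¹ i j * metricForm (K (P u)) (curv K (P u) (W u)
      (fderiv ℝ P u (stdVec i)) (fderiv ℝ P u (stdVec j))) (V u) := by
    rw [Finset.sum_comm]
    refine Finset.sum_congr rfl fun i _ => Finset.sum_congr rfl fun j _ => ?_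
    rw [inv_symm hp, metricForm_curv_pair hK (hPS hu), curv_antisymm, map_neg, neg_apply,
      metricForm_curv_antisymm hK (hPS hu), neg_neg]
  rw [hsymm, hcurv]
  ring

/-- The Jacobi operator is formally self-adjoint. -/
theorem setIntegral_jacobiOp_comm (hG : IsMetricOn G O) (hK : IsMetricOn K S)
    (hP : ContDiffOn ℝ ∞ P O) (hPS : Set.MapsTo P O S) (hV : ContDiffOn ℝ ∞ V O)
    (hW : ContDiffOn ℝ ∞ W O) {C : Set (Eu m)} (hC : IsCompact C) (hCO : C ⊆ O)
    (h0 : ∀ u ∈ O, u ∉ C → V u = 0) :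
    ∫ u in O, Real.sqrt (G u).det * (metricForm (K (P u)) (jacobiOp G K P V u) (W u)
        - metricForm (K (P u)) (V u) (jacobiOp G K P W u)) = 0 := by
  have hO := hG.isOpen
  rw [setIntegral_congr_fun hO.measurableSet fun u hu =>
    metricForm_jacobiOp_sub hG hK hP hPS hV hW hu]
  refine setIntegral_divergence_eq_zero hO hC hCO
    (X := fun i w => Real.sqrt (G w).det * ∑ j, (G w)⁻¹ i j *
        (metricForm (K (P w)) (covD K P V w (stdVec j)) (W w)
          - metricForm (K (P w)) (V w) (covD K P W w (stdVec j)))) ?_ ?_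
  · intro i
    refine ContDiffOn.mul ?_ (ContDiffOn.sum fun j _ => (hG.inv_smooth i j).mul ?_)
    · exact (ContDiffOn.matrix_det hG.smooth).sqrt fun u hu => (hG.posDef u hu).det_pos.ne'
    · exact (contDiffOn_metricForm hK hP hPS (covD_apply_contDiffOn hK hO hP hPS hV _) hW).sub
        (contDiffOn_metricForm hK hP hPS hV (covD_apply_contDiffOn hK hO hP hPS hW _))
  · intro i u hu huC
    have hV0 : V =ᶠ[nhds u] fun _ => 0 := by
      filter_upwards [hC.isClosed.isOpen_compl.mem_nhds huC, hO.mem_nhds hu] with w hw hwO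
        using h0 w hwO hw
    have hc : covD K P V u = 0 := by
      rw [covD, hV0.fderiv_eq, hV0.eq_of_nhds]; simp
    simp [hc, hV0.eq_of_nhds]

end Divergence

/-! ## Hypersurfaces in coordinates -/

section Hypersurface

/-- The Ricci tensor in coordinates, `Ric(Z, W) = trace (x ↦ R(x, Z)W)`. -/
def ricciForm {n : ℕ} (K : Eu n → Matrix (Fin n) (Fin n) ℝ) (q Z W : Eu n) : ℝ :=
  ∑ i, curv K q (stdVec i) Z W i

/-- The curvature operator as a linear map in its first argument. -/
def curvLeft {n : ℕ} (K : Eu n → Matrix (Fin n) (Fin n) ℝ) (q b v : Eu n) : Eu n →L[ℝ] Eu n :=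
  ((fderiv ℝ (gamma K) q).flip b).flip v - (fderiv ℝ (gamma K) q b).flip v
    + (gamma K q).flip (gamma K q b v) - (gamma K q b).comp ((gamma K q).flip v)

theorem curvLeft_apply {n : ℕ} (K : Eu n → Matrix (Fin n) (Fin n) ℝ) (q a b v : Eu n) :
    curvLeft K q b v a = curv K q a b v := rfl

/-- As a metric trace, the Ricci tensor can be evaluated in a frame adapted to the hypersurface. -/
theorem ricciForm_eq_metricTrace {n : ℕ} {K : Eu n → Matrix (Fin n) (Fin n) ℝ} {q : Eu n}
    (hK : (K q).PosDef) (Z W : Eu n) :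
    ricciForm K q Z W = metricTrace (K q) ((metricForm (K q)).comp (curvLeft K q Z W)) := by
  rw [ricciForm, metricTrace]
  refine Finset.sum_congr rfl fun i _ => ?_
  conv_lhs => rw [← sum_metricForm_inv_smul hK (curv K q (stdVec i) Z W)]
  rw [Finset.sum_comm]
  have : ∀ j : Fin n, ∑ k, ((K q)⁻¹ k j * metricForm (K q) (curv K q (stdVec i) Z W) (stdVec k)) •
      (stdVec j : Eu n) = (∑ k, ((K q)⁻¹ k j * metricForm (K q) (curv K q (stdVec i) Z W) (stdVec k))) •
      (stdVec j : Eu n) := fun j => (Finset.sum_smul).symm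
  simp_rw [this]
  simp only [WithLp.ofLp_sum, WithLp.ofLp_smul, Finset.sum_apply, Pi.smul_apply, PiLp.single_apply,
    smul_eq_mul, mul_ite, mul_one, mul_zero, Finset.sum_ite_eq, Finset.mem_univ, if_true]
  refine Finset.sum_congr rfl fun k _ => ?_
  rw [inv_symm hK k i]; rfl

variable {m : ℕ}

/-- An isometrically immersed hypersurface with unit normal `ξ`, in coordinates. -/
structure IsHypersurfaceOn (G : Eu m → Matrix (Fin m) (Fin m) ℝ)
    (K : Eu (m + 1) → Matrix (Fin (m + 1)) (Fin (m + 1)) ℝ) (P ξ : Eu m → Eu (m + 1))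
    (O : Set (Eu m)) (S : Set (Eu (m + 1))) : Prop where
  source : IsMetricOn G O
  target : IsMetricOn K S
  smooth : ContDiffOn ℝ ∞ P O
  mapsTo : Set.MapsTo P O S
  isometry : ∀ u ∈ O, ∀ x y,
    metricForm (K (P u)) (fderiv ℝ P u x) (fderiv ℝ P u y) = metricForm (G u) x y
  normal_smooth : ContDiffOn ℝ ∞ ξ O
  unit : ∀ u ∈ O, metricForm (K (P u)) (ξ u) (ξ u) = 1
  normal : ∀ u ∈ O, ∀ x, metricForm (K (P u)) (ξ u) (fderiv ℝ P u x) = 0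

/-- The form `⟨D_x ξ, dP y⟩`, the negative of the second fundamental form. -/
def weingarten (K : Eu (m + 1) → Matrix (Fin (m + 1)) (Fin (m + 1)) ℝ) (P ξ : Eu m → Eu (m + 1))
    (u : Eu m) : Eu m →L[ℝ] Eu m →L[ℝ] ℝ :=
  (metricForm (K (P u))).bilinearComp (covD K P ξ u) (fderiv ℝ P u)

/-- The Laplacian of a function in coordinates. -/
def coordLaplacian (G : Eu m → Matrix (Fin m) (Fin m) ℝ) (w : Eu m → ℝ) (u : Eu m) : ℝ :=
  ∑ i, ∑ j, (G u)⁻¹ i j * (fderiv ℝ (fun v => fderiv ℝ w v (stdVec j)) u (stdVec i)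
    - fderiv ℝ w u (gamma G u (stdVec i) (stdVec j)))

theorem weingarten_apply (K : Eu (m + 1) → Matrix (Fin (m + 1)) (Fin (m + 1)) ℝ)
    (P ξ : Eu m → Eu (m + 1)) (u x y : Eu m) :
    weingarten K P ξ u x y = metricForm (K (P u)) (covD K P ξ u x) (fderiv ℝ P u y) := rfl

/-- The derivative of the trace of a field of bilinear forms. -/
theorem IsMetricOn.fderiv_metricTrace {G : Eu m → Matrix (Fin m) (Fin m) ℝ} {O : Set (Eu m)}
    (hG : IsMetricOn G O) {β : Eu m → Eu m →L[ℝ] Eu m →L[ℝ] ℝ} {u : Eu m} (hu : u ∈ O)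
    (hβ : DifferentiableAt ℝ β u) (z : Eu m) :
    fderiv ℝ (fun w => metricTrace (G w) (β w)) u z = ∑ i, ∑ j, (G u)⁻¹ i j *
      (fderiv ℝ (fun w => β w (stdVec i) (stdVec j)) u z - β u (gamma G u z (stdVec i)) (stdVec j)
        - β u (stdVec i) (gamma G u z (stdVec j))) := by
  have hi : ∀ i j, DifferentiableAt ℝ (fun w => (G w)⁻¹ i j) u := fun i j =>
    differentiableAt_of_contDiffOn hG.isOpen (hG.inv_smooth i j) hu
  have hb : ∀ i j : Fin m, DifferentiableAt ℝ (fun w => β w (stdVec i) (stdVec j)) u := fun i j =>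
    (hβ.clm_apply (differentiableAt_const _)).clm_apply (differentiableAt_const _)
  have h1 : HasFDerivAt (fun w => metricTrace (G w) (β w))
      (∑ i, ∑ j, ((G u)⁻¹ i j • fderiv ℝ (fun w => β w (stdVec i) (stdVec j)) u
        + β u (stdVec i) (stdVec j) • fderiv ℝ (fun w => (G w)⁻¹ i j) u)) u :=
    HasFDerivAt.fun_sum fun i _ => HasFDerivAt.fun_sum fun j _ =>
      (hi i j).hasFDerivAt.mul (hb i j).hasFDerivAt
  rw [h1.fderiv]
  simp only [sum_apply, add_apply, smul_apply, smul_eq_mul, hG.fderiv_inv hu, mul_sub,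
    Finset.sum_add_distrib, Finset.sum_sub_distrib, mul_neg, Finset.sum_neg_distrib, mul_add]
  have e1 : ∑ i, ∑ j, (G u)⁻¹ i j * β u (gamma G u z (stdVec i)) (stdVec j)
      = ∑ i, ∑ j, β u (stdVec i) (stdVec j) * ∑ l, (G u)⁻¹ l j * gamma G u z (stdVec l) i := by
    have : ∀ i, β u (gamma G u z (stdVec i))
        = ∑ k, gamma G u z (stdVec i) k • β u (stdVec k) := by
      intro i
      conv_lhs => rw [← sum_coord_smul (gamma G u z (stdVec i))]
      simp
    simp_rw [this, sum_apply, smul_apply, smul_eq_mul, Finset.mul_sum]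
    rw [Finset.sum_comm]
    conv_rhs => rw [Finset.sum_comm]
    refine Finset.sum_congr rfl fun j _ => ?_
    rw [Finset.sum_comm]
    exact Finset.sum_congr rfl fun i _ => Finset.sum_congr rfl fun l _ => by ring
  have e2 : ∑ i, ∑ j, (G u)⁻¹ i j * β u (stdVec i) (gamma G u z (stdVec j))
      = ∑ i, ∑ j, β u (stdVec i) (stdVec j) * ∑ l, (G u)⁻¹ i l * gamma G u z (stdVec l) j := by
    refine Finset.sum_congr rfl fun i _ => ?_
    have : ∀ j, β u (stdVec i) (gamma G u z (stdVec j))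
        = ∑ k, gamma G u z (stdVec j) k * β u (stdVec i) (stdVec k) := by
      intro j
      conv_lhs => rw [← sum_coord_smul (gamma G u z (stdVec j))]
      simp
    simp_rw [this, Finset.mul_sum]
    rw [Finset.sum_comm]
    exact Finset.sum_congr rfl fun i _ => Finset.sum_congr rfl fun l _ => by ring
  rw [e1, e2]
  ring

/-! ### Gauss, Codazzi and the Jacobi operator on normal fields -/

namespace IsHypersurfaceOn

variable {G : Eu m → Matrix (Fin m) (Fin m) ℝ}
  {K : Eu (m + 1) → Matrix (Fin (m + 1)) (Fin (m + 1)) ℝ} {P ξ : Eu m → Eu (m + 1)}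
  {O : Set (Eu m)} {S : Set (Eu (m + 1))} {u : Eu m}

/-- In the adapted frame the normal direction contributes `R(ξ, ξ) = 0`, leaving the sum over
tangent directions. Thus the curvature term of the Jacobi operator at `ξ` is the Ricci operator
applied to `ξ`. -/
theorem ricciForm_normal (h : IsHypersurfaceOn G K P ξ O S) (hu : u ∈ O) (Y : Eu (m + 1)) :
    ricciForm K (P u) (ξ u) Y = ∑ i, ∑ j, (G u)⁻¹ i j * metricForm (K (P u))
      (curv K (P u) (ξ u) (fderiv ℝ P u (stdVec i)) (fderiv ℝ P u (stdVec j))) Y := by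
  have hK := h.target.posDef _ (h.mapsTo hu)
  have h0 : curv K (P u) (ξ u) (ξ u) Y = 0 := by
    unfold curv; abel
  rw [ricciForm_eq_metricTrace hK, metricTrace_hypersurface (h.source.posDef u hu) hK (fderiv ℝ P u)
    (h.isometry u hu) (h.unit u hu) (h.normal u hu)]
  simp only [ContinuousLinearMap.comp_apply, curvLeft_apply, h0, map_zero, zero_apply, add_zero,
    smul_eq_mul]
  refine Finset.sum_congr rfl fun i _ => Finset.sum_congr rfl fun j _ => ?_
  rw [metricForm_curv_antisymm h.target (h.mapsTo hu) _ _ Y, curv_antisymm]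
  simp

theorem normal_differentiableAt (h : IsHypersurfaceOn G K P ξ O S) (hu : u ∈ O) :
    DifferentiableAt ℝ ξ u := differentiableAt_of_contDiffOn h.source.isOpen h.normal_smooth hu

theorem differentiableAt (h : IsHypersurfaceOn G K P ξ O S) (hu : u ∈ O) :
    DifferentiableAt ℝ P u := differentiableAt_of_contDiffOn h.source.isOpen h.smooth hu

theorem field_differentiableAt (h : IsHypersurfaceOn G K P ξ O S) (hu : u ∈ O) (x : Eu m) :
    DifferentiableAt ℝ (fun w => fderiv ℝ P w x) u :=
  differentiableAt_of_contDiffOn h.source.isOpen (contDiffOn_fderiv_apply h.source.isOpen h.smooth x) hu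

theorem covD_normal_smooth (h : IsHypersurfaceOn G K P ξ O S) : ContDiffOn ℝ ∞ (covD K P ξ) O :=
  covD_contDiffOn h.target h.source.isOpen h.smooth h.mapsTo h.normal_smooth

theorem covD_normal_differentiableAt (h : IsHypersurfaceOn G K P ξ O S) (hu : u ∈ O) (x : Eu m) :
    DifferentiableAt ℝ (fun w => covD K P ξ w x) u :=
  differentiableAt_of_contDiffOn h.source.isOpen
    (h.covD_normal_smooth.clm_apply contDiffOn_const) hu

theorem comm (h : IsHypersurfaceOn G K P ξ O S) (hu : u ∈ O) (a b : Eu (m + 1)) :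
    metricForm (K (P u)) a b = metricForm (K (P u)) b a :=
  metricForm_comm (h.target.posDef _ (h.mapsTo hu)) a b

theorem fderiv_metricForm (h : IsHypersurfaceOn G K P ξ O S) (hu : u ∈ O) {V W : Eu m → Eu (m + 1)}
    (hV : DifferentiableAt ℝ V u) (hW : DifferentiableAt ℝ W u) (x : Eu m) :
    fderiv ℝ (fun w => metricForm (K (P w)) (V w) (W w)) u x
      = metricForm (K (P u)) (covD K P V u x) (W u) + metricForm (K (P u)) (V u) (covD K P W u x) :=
  _root_.fderiv_metricForm h.target (h.mapsTo hu) (h.differentiableAt hu) hV hW x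

/-- Differentiate `⟨ξ, ξ⟩ = 1`. -/
theorem covD_normal_normal (h : IsHypersurfaceOn G K P ξ O S) (hu : u ∈ O) (x : Eu m) :
    metricForm (K (P u)) (covD K P ξ u x) (ξ u) = 0 := by
  have hξ := h.normal_differentiableAt hu
  have h1 := h.fderiv_metricForm hu hξ hξ x
  have h2 : (fun w => metricForm (K (P w)) (ξ w) (ξ w)) =ᶠ[nhds u] fun _ => 1 := by
    filter_upwards [h.source.isOpen.mem_nhds hu] with w hw using h.unit w hw
  rw [h2.fderiv_eq, h.comm hu (ξ u)] at h1
  simp at h1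
  linarith

/-- Differentiate `⟨ξ, dP y⟩ = 0`. The second derivatives of `P` are symmetric, so this is also why
the form is symmetric. -/
theorem weingarten_eq (h : IsHypersurfaceOn G K P ξ O S) (hu : u ∈ O) (x y : Eu m) :
    weingarten K P ξ u x y
      = -metricForm (K (P u)) (covD K P (fun w => fderiv ℝ P w y) u x) (ξ u) := by
  have h1 := h.fderiv_metricForm hu (h.normal_differentiableAt hu) (h.field_differentiableAt hu y) x
  have h2 : (fun w => metricForm (K (P w)) (ξ w) (fderiv ℝ P w y)) =ᶠ[nhds u] fun _ => 0 := by
    filter_upwards [h.source.isOpen.mem_nhds hu] with w hw using h.normal w hw y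
  rw [h2.fderiv_eq, h.comm hu (ξ u)] at h1
  simp at h1
  rw [weingarten_apply]
  linarith

theorem weingarten_comm (h : IsHypersurfaceOn G K P ξ O S) (hu : u ∈ O) (x y : Eu m) :
    weingarten K P ξ u x y = weingarten K P ξ u y x := by
  rw [h.weingarten_eq hu, h.weingarten_eq hu,
    covD_fderiv_comm h.target h.source.isOpen h.smooth h.mapsTo hu]

/-- The tangential part of Gauss' formula. -/
theorem covD_field_tangent (h : IsHypersurfaceOn G K P ξ O S) (hu : u ∈ O) (x y z : Eu m) :
    metricForm (K (P u)) (covD K P (fun w => fderiv ℝ P w y) u x) (fderiv ℝ P u z)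
      = metricForm (G u) (gamma G u x y) z := by
  -- The derivative of the induced metric is computed in the ambient space. Inserting the result
  -- three times in Koszul's formula for `G`, together with the symmetry `hc`, leaves the single
  -- product wanted.
  have hd : ∀ x y z, dForm G u x y z
      = metricForm (K (P u)) (covD K P (fun w => fderiv ℝ P w y) u x) (fderiv ℝ P u z)
      + metricForm (K (P u)) (covD K P (fun w => fderiv ℝ P w z) u x) (fderiv ℝ P u y) := by
    intro x y z
    rw [dForm, fderiv_clm_apply₂ (h.source.form_differentiableAt hu),
      h.comm hu (covD K P (fun w => fderiv ℝ P w z) u x), ← h.fderiv_metricForm hu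
      (h.field_differentiableAt hu y) (h.field_differentiableAt hu z)]
    congr 1
    refine Filter.EventuallyEq.fderiv_eq ?_
    filter_upwards [h.source.isOpen.mem_nhds hu] with w hw using (h.isometry w hw y z).symm
  have hc := fun x y => covD_fderiv_comm h.target h.source.isOpen h.smooth h.mapsTo hu x y
  rw [h.source.form_gamma hu, hd x y z, hd y x z, hd z x y, hc y x, hc z x, hc z y]
  ring

theorem exists_covD_normal_eq (h : IsHypersurfaceOn G K P ξ O S) (hu : u ∈ O) (x : Eu m) :
    ∃ v, covD K P ξ u x = fderiv ℝ P u v := by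
  obtain ⟨v, hv⟩ := exists_eq_tangent_add_normal (h.source.posDef u hu)
    (h.target.posDef _ (h.mapsTo hu)) (fderiv ℝ P u) (h.isometry u hu) (h.unit u hu) (h.normal u hu)
    (covD K P ξ u x)
  rw [h.covD_normal_normal hu, zero_smul, add_zero] at hv
  exact ⟨v, hv⟩

/-- The derivative of `ξ` is tangent to the hypersurface, so it sees only the tangential part
`dP(gamma G u x y)` of the derivative of `dP y`. -/
theorem weingarten_gamma (h : IsHypersurfaceOn G K P ξ O S) (hu : u ∈ O) (x y z : Eu m) :
    metricForm (K (P u)) (covD K P ξ u z) (covD K P (fun w => fderiv ℝ P w y) u x)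
      = weingarten K P ξ u z (gamma G u x y) := by
  obtain ⟨v, hv⟩ := h.exists_covD_normal_eq hu z
  rw [weingarten_apply, hv, h.comm hu, h.covD_field_tangent hu, h.isometry u hu,
    metricForm_comm (h.source.posDef u hu)]

/-- Feeds `|A|²` into the normal equation: the derivatives of `ξ` are tangent, so their product is
obtained by contracting components with the inverse of the induced metric. -/
theorem metricForm_covD_normal (h : IsHypersurfaceOn G K P ξ O S) (hu : u ∈ O) (x y : Eu m) :
    metricForm (K (P u)) (covD K P ξ u x) (covD K P ξ u y)
      = ∑ k, ∑ l, (G u)⁻¹ k l * (weingarten K P ξ u x (stdVec k) * weingarten K P ξ u y (stdVec l)) := by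
  obtain ⟨v, hv⟩ := h.exists_covD_normal_eq hu x
  have h1 : ∀ k, weingarten K P ξ u x (stdVec k) = metricForm (G u) v (stdVec k) := fun k => by
    rw [weingarten_apply, hv, h.isometry u hu]
  rw [h.comm hu, hv, ← weingarten_apply]
  conv_lhs => rw [← sum_metricForm_inv_smul (h.source.posDef u hu) v]
  simp only [map_sum, map_smul, smul_eq_mul, h1]
  exact Finset.sum_congr rfl fun k _ => Finset.sum_congr rfl fun l _ => by ring

theorem weingarten_smooth (h : IsHypersurfaceOn G K P ξ O S) (x y : Eu m) :
    ContDiffOn ℝ ∞ (fun w => weingarten K P ξ w x y) O :=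
  contDiffOn_metricForm h.target h.smooth h.mapsTo (h.covD_normal_smooth.clm_apply contDiffOn_const)
    (contDiffOn_fderiv_apply h.source.isOpen h.smooth y)

theorem weingarten_differentiableAt (h : IsHypersurfaceOn G K P ξ O S) (hu : u ∈ O) :
    DifferentiableAt ℝ (weingarten K P ξ) u := by
  refine differentiableAt_of_contDiffOn h.source.isOpen (O := O) ?_ hu
  rw [contDiffOn_clm_apply]
  intro x
  rw [contDiffOn_clm_apply]
  exact fun y => h.weingarten_smooth x y

theorem fderiv_weingarten (h : IsHypersurfaceOn G K P ξ O S) (hu : u ∈ O) (x y z : Eu m) :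
    fderiv ℝ (fun w => weingarten K P ξ w y z) u x
      = metricForm (K (P u)) (covD K P (fun w => covD K P ξ w y) u x) (fderiv ℝ P u z)
        + weingarten K P ξ u y (gamma G u x z) := by
  rw [← h.weingarten_gamma hu]
  exact h.fderiv_metricForm hu (h.covD_normal_differentiableAt hu y) (h.field_differentiableAt hu z) x

/-- Codazzi's equation. -/
theorem codazzi (h : IsHypersurfaceOn G K P ξ O S) (hu : u ∈ O) (x y z : Eu m) :
    metricForm (K (P u)) (covD K P (fun w => covD K P ξ w y) u x) (fderiv ℝ P u z)
      = fderiv ℝ (fun w => weingarten K P ξ w x y) u z - weingarten K P ξ u x (gamma G u z y)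
        + metricForm (K (P u)) (curv K (P u) (fderiv ℝ P u x) (fderiv ℝ P u z) (ξ u)) (fderiv ℝ P u y)
        + weingarten K P ξ u z (gamma G u x y) - weingarten K P ξ u y (gamma G u x z) := by
  have h1 := h.fderiv_weingarten hu x y z
  have h2 := h.fderiv_weingarten hu x z y
  have h3 := h.fderiv_weingarten hu z x y
  have h4 : fderiv ℝ (fun w => weingarten K P ξ w y z) u x
      = fderiv ℝ (fun w => weingarten K P ξ w z y) u x := by
    congr 1
    refine Filter.EventuallyEq.fderiv_eq ?_
    filter_upwards [h.source.isOpen.mem_nhds hu] with w hw using h.weingarten_comm hw y z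
  have h5 := congrArg (fun v => metricForm (K (P u)) v (fderiv ℝ P u y))
    (covD_covD_sub h.target h.source.isOpen h.smooth h.mapsTo h.normal_smooth hu x z)
  simp only [map_sub, sub_apply] at h5
  -- Symmetry of the form exchanges `y` and `z` (`h1`, `h2`, `h4`); the Ricci identity `h5` then
  -- exchanges the two derivatives `x` and `z` of `ξ`, and `h3` rewrites the result as a derivative
  -- of the form in the direction `z`.
  linarith

/-- Pair the tension field with `ξ`: the term `dP(gamma G)` of `∇dP` is tangent and drops out, and
what remains is minus the form `weingarten`. -/
theorem metricTrace_weingarten (h : IsHypersurfaceOn G K P ξ O S) {μ : Eu m → ℝ}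
    (hτ : ∀ u ∈ O, coordTension G K P u = μ u • ξ u) (hu : u ∈ O) :
    metricTrace (G u) (weingarten K P ξ u) = -μ u := by
  have h1 : metricForm (K (P u)) (coordTension G K P u) (ξ u) = μ u := by
    rw [hτ u hu]; simp [h.unit u hu]
  have hd : DifferentiableAt ℝ (fderiv ℝ P) u :=
    differentiableAt_of_contDiffOn h.source.isOpen (contDiffOn_fderiv h.source.isOpen h.smooth) hu
  rw [← h1, coordTension, metricTrace, metricTrace]
  simp only [map_sum, map_smul, sum_apply, smul_apply, smul_eq_mul, ← Finset.sum_neg_distrib]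
  refine Finset.sum_congr rfl fun i _ => Finset.sum_congr rfl fun j _ => ?_
  rw [nabla_apply hd, map_sub, sub_apply, h.weingarten_eq hu, h.comm hu (fderiv ℝ P u _),
    h.normal u hu]
  ring

/-- The tangential part of the rough Laplacian of the unit normal. -/
theorem roughLaplacian_normal_tangent (h : IsHypersurfaceOn G K P ξ O S) {μ : Eu m → ℝ}
    (hτ : ∀ u ∈ O, coordTension G K P u = μ u • ξ u) (hu : u ∈ O) (z : Eu m) :
    metricForm (K (P u)) (roughLaplacian G K P ξ u) (fderiv ℝ P u z)
      = -fderiv ℝ μ u z + ricciForm K (P u) (ξ u) (fderiv ℝ P u z) := by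
  have hG := h.source.posDef u hu
  have hd := differentiableAt_of_contDiffOn h.source.isOpen h.covD_normal_smooth hu
  -- Since `μ` is minus the trace of `weingarten`, its derivative is a traced covariant derivative
  -- of that form in the direction `z`. Codazzi's equation brings the rough Laplacian of `ξ` to this
  -- shape, with the Ricci term `h2` as error.
  have h1 : fderiv ℝ (fun w => metricTrace (G w) (weingarten K P ξ w)) u z = -fderiv ℝ μ u z := by
    have : (fun w => metricTrace (G w) (weingarten K P ξ w)) =ᶠ[nhds u] fun w => -μ w := by
      filter_upwards [h.source.isOpen.mem_nhds hu] with w hw using h.metricTrace_weingarten hτ hw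
    rw [this.fderiv_eq, fderiv_fun_neg]; rfl
  have h2 : ricciForm K (P u) (ξ u) (fderiv ℝ P u z) = ∑ i, ∑ j, (G u)⁻¹ i j * metricForm (K (P u))
      (curv K (P u) (fderiv ℝ P u (stdVec i)) (fderiv ℝ P u z) (ξ u)) (fderiv ℝ P u (stdVec j)) := by
    rw [h.ricciForm_normal hu, Finset.sum_comm]
    refine Finset.sum_congr rfl fun i _ => Finset.sum_congr rfl fun j _ => ?_
    rw [inv_symm hG, metricForm_curv_pair h.target (h.mapsTo hu) (ξ u)]
  rw [← h1, h.source.fderiv_metricTrace hu (h.weingarten_differentiableAt hu), h2,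
    roughLaplacian, metricTrace]
  simp only [map_sum, map_smul, sum_apply, smul_apply, smul_eq_mul, ← Finset.sum_add_distrib,
    ← mul_add]
  refine Finset.sum_congr rfl fun i _ => Finset.sum_congr rfl fun j _ => ?_
  congr 1
  rw [nabla_apply hd, map_sub, sub_apply, h.codazzi hu, ← weingarten_apply K P ξ u _ z,
    h.weingarten_comm hu _ z, h.weingarten_comm hu (gamma G u z (stdVec i)),
    h.source.gamma_comm hu (stdVec i) z]
  ring

/-- Differentiate `⟨∇ξ, ξ⟩ = 0` once more. -/
theorem roughLaplacian_normal_normal (h : IsHypersurfaceOn G K P ξ O S) (hu : u ∈ O) :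
    metricForm (K (P u)) (roughLaplacian G K P ξ u) (ξ u)
      = -∑ i, ∑ j, (G u)⁻¹ i j * metricForm (K (P u)) (covD K P ξ u (stdVec i))
          (covD K P ξ u (stdVec j)) := by
  have hd := differentiableAt_of_contDiffOn h.source.isOpen h.covD_normal_smooth hu
  rw [roughLaplacian, metricTrace]
  simp only [map_sum, map_smul, sum_apply, smul_apply, smul_eq_mul, ← Finset.sum_neg_distrib]
  refine Finset.sum_congr rfl fun i _ => Finset.sum_congr rfl fun j _ => ?_
  have h1 := h.fderiv_metricForm hu (h.covD_normal_differentiableAt hu (stdVec j))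
    (h.normal_differentiableAt hu) (stdVec i)
  have h2 : (fun w => metricForm (K (P w)) (covD K P ξ w (stdVec j)) (ξ w)) =ᶠ[nhds u] fun _ => 0 := by
    filter_upwards [h.source.isOpen.mem_nhds hu] with w hw using h.covD_normal_normal hw _
  rw [h2.fderiv_eq, h.comm hu (covD K P ξ u (stdVec j))] at h1
  simp only [fderiv_fun_const, Pi.zero_apply, zero_apply] at h1
  rw [nabla_apply hd, map_sub, sub_apply, h.covD_normal_normal hu, eq_neg_of_add_eq_zero_left h1.symm]
  ring

/-- The Leibniz rule of second order: Hessian of `w`, the two mixed terms, and `w` times the second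
covariant derivative of `ξ`. -/
theorem nabla_covD_smul (h : IsHypersurfaceOn G K P ξ O S) {w : Eu m → ℝ} (hw : ContDiffOn ℝ ∞ w O)
    (hu : u ∈ O) (x y : Eu m) :
    nabla G K P (covD K P fun v => w v • ξ v) u x y
      = (fderiv ℝ (fun v => fderiv ℝ w v y) u x - fderiv ℝ w u (gamma G u x y)) • ξ u
        + (fderiv ℝ w u y • covD K P ξ u x + fderiv ℝ w u x • covD K P ξ u y)
        + w u • nabla G K P (covD K P ξ) u x y := by
  have hO := h.source.isOpen
  have hwd : ∀ {u}, u ∈ O → DifferentiableAt ℝ w u := fun hu => differentiableAt_of_contDiffOn hO hw hu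
  have hwy := contDiffOn_fderiv_apply hO hw y
  have hwξ : ContDiffOn ℝ ∞ (fun v => w v • ξ v) O := hw.smul h.normal_smooth
  have hDξ : ContDiffOn ℝ ∞ (fun v => covD K P ξ v y) O := h.covD_normal_smooth.clm_apply contDiffOn_const
  have e : (fun v => covD K P (fun v => w v • ξ v) v y)
      =ᶠ[nhds u] fun v => fderiv ℝ w v y • ξ v + w v • covD K P ξ v y := by
    filter_upwards [hO.mem_nhds hu] with v hv
    exact covD_smul K P (hwd hv) (h.normal_differentiableAt hv) y
  rw [nabla_apply (differentiableAt_of_contDiffOn hO h.covD_normal_smooth hu),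
    nabla_apply (differentiableAt_of_contDiffOn hO (covD_contDiffOn h.target hO h.smooth h.mapsTo
      hwξ) hu), DFunLike.congr_fun (covD_congr Filter.EventuallyEq.rfl e) x,
    covD_add (V := fun v => fderiv ℝ w v y • ξ v) (W := fun v => w v • covD K P ξ v y) _ _
      (differentiableAt_of_contDiffOn hO (hwy.smul h.normal_smooth) hu)
      (differentiableAt_of_contDiffOn hO (hw.smul hDξ) hu),
    covD_smul _ _ (differentiableAt_of_contDiffOn hO hwy hu) (h.normal_differentiableAt hu),
    covD_smul _ _ (hwd hu) (differentiableAt_of_contDiffOn hO hDξ hu),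
    covD_smul _ _ (hwd hu) (h.normal_differentiableAt hu)]
  module

/-- Trace the second order Leibniz rule. The two mixed terms agree after tracing because the inverse
metric is symmetric, whence the factor `2`; the curvature term is linear in the field. -/
theorem jacobiOp_smul_normal (h : IsHypersurfaceOn G K P ξ O S) {w : Eu m → ℝ}
    (hw : ContDiffOn ℝ ∞ w O) (hu : u ∈ O) :
    jacobiOp G K P (fun v => w v • ξ v) u
      = coordLaplacian G w u • ξ u
        + (2 : ℝ) • (∑ i, ∑ j, ((G u)⁻¹ i j * fderiv ℝ w u (stdVec i)) • covD K P ξ u (stdVec j))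
        + w u • jacobiOp G K P ξ u := by
  have hG := h.source.posDef u hu
  have hsymm : ∑ i, ∑ j, ((G u)⁻¹ i j * fderiv ℝ w u (stdVec j)) • covD K P ξ u (stdVec i)
      = ∑ i, ∑ j, ((G u)⁻¹ i j * fderiv ℝ w u (stdVec i)) • covD K P ξ u (stdVec j) := by
    rw [Finset.sum_comm]
    exact Finset.sum_congr rfl fun i _ => Finset.sum_congr rfl fun j _ => by rw [inv_symm hG]
  have hcurv : ∀ a b, curv K (P u) (w u • ξ u) a b = w u • curv K (P u) (ξ u) a b := by
    intro a b
    rw [← curvLeft_apply, map_smul, curvLeft_apply]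
  rw [two_smul]
  simp only [jacobiOp, roughLaplacian, metricTrace, h.nabla_covD_smul hw hu, hcurv, coordLaplacian,
    smul_add, Finset.sum_add_distrib, Finset.sum_smul, Finset.smul_sum, smul_smul, mul_comm (w u)]
  rw [hsymm]
  abel

/-- The normal part of the Jacobi operator. -/
theorem jacobiOp_normal (h : IsHypersurfaceOn G K P ξ O S) {w : Eu m → ℝ}
    (hw : ContDiffOn ℝ ∞ w O) (hu : u ∈ O) :
    metricForm (K (P u)) (jacobiOp G K P (fun v => w v • ξ v) u) (ξ u)
      = coordLaplacian G w u - w u * (∑ i, ∑ j, (G u)⁻¹ i j * ∑ k, ∑ l, (G u)⁻¹ k l *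
          (weingarten K P ξ u (stdVec i) (stdVec k) * weingarten K P ξ u (stdVec j) (stdVec l)))
        + w u * ricciForm K (P u) (ξ u) (ξ u) := by
  rw [h.jacobiOp_smul_normal hw hu, jacobiOp, h.ricciForm_normal hu]
  simp only [map_add, map_smul, add_apply, smul_apply, smul_eq_mul, h.unit u hu,
    h.roughLaplacian_normal_normal hu, map_sum, sum_apply, h.covD_normal_normal hu,
    h.metricForm_covD_normal hu]
  simp only [mul_zero, Finset.sum_const_zero]
  ring

/-- The tangential part of the Jacobi operator. -/
theorem jacobiOp_tangent (h : IsHypersurfaceOn G K P ξ O S) {μ : Eu m → ℝ}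
    (hτ : ∀ u ∈ O, coordTension G K P u = μ u • ξ u) {w : Eu m → ℝ}
    (hw : ContDiffOn ℝ ∞ w O) (hu : u ∈ O) (z : Eu m) :
    metricForm (K (P u)) (jacobiOp G K P (fun v => w v • ξ v) u) (fderiv ℝ P u z)
      = 2 * (∑ i, ∑ j, (G u)⁻¹ i j * fderiv ℝ w u (stdVec i) * weingarten K P ξ u (stdVec j) z)
        - w u * fderiv ℝ μ u z + 2 * w u * ricciForm K (P u) (ξ u) (fderiv ℝ P u z) := by
  -- The Ricci term counts twice: once from Codazzi's equation in the rough Laplacian, once as the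
  -- curvature term of the Jacobi operator.
  have h1 : metricForm (K (P u)) (jacobiOp G K P ξ u) (fderiv ℝ P u z)
      = -fderiv ℝ μ u z + 2 * ricciForm K (P u) (ξ u) (fderiv ℝ P u z) := by
    rw [jacobiOp, map_add, add_apply, h.roughLaplacian_normal_tangent hτ hu, h.ricciForm_normal hu]
    simp only [map_sum, map_smul, sum_apply, smul_apply, smul_eq_mul]
    ring
  rw [h.jacobiOp_smul_normal hw hu]
  simp only [map_add, map_smul, add_apply, smul_apply, smul_eq_mul, h.normal u hu, h1, map_sum,
    sum_apply, weingarten_apply]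
  ring

end IsHypersurfaceOn
end Hypersurface

/-! ## Naturality of the tension field and of the Jacobi operator -/

section Naturality

variable {m n : ℕ} {G G' : Eu m → Matrix (Fin m) (Fin m) ℝ} {K K' : Eu n → Matrix (Fin n) (Fin n) ℝ}
  {R R' : Set (Eu m)} {S S' : Set (Eu n)} {θ : Eu m → Eu m} {ψ : Eu n → Eu n}
  {P P' V V' : Eu m → Eu n} {O O' : Set (Eu m)} {u : Eu m}

theorem metricTrace_map_of_isometry {A A' : Matrix (Fin m) (Fin m) ℝ} (hA : A.PosDef)
    (hA' : A'.PosDef) (L : Eu m →L[ℝ] Eu m) (Ψ : Eu n →L[ℝ] Eu n)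
    (hL : ∀ x y, metricForm A' (L x) (L y) = metricForm A x y)
    {β β' : Eu m →L[ℝ] Eu m →L[ℝ] Eu n} (hβ : ∀ x y, β' (L x) (L y) = Ψ (β x y)) :
    metricTrace A' β' = Ψ (metricTrace A β) := by
  have hΨ : Ψ (metricTrace A β) = _ := map_metricTrace A Ψ β
  rw [hΨ]
  let γ : Eu m →L[ℝ] Eu m →L[ℝ] Eu n := (ContinuousLinearMap.compL ℝ (Eu m) (Eu n) (Eu n) Ψ).comp β
  exact metricTrace_congr_of_isometry hA hA' L hL (β := γ) hβ

theorem fderiv_field_map (hθ : IsIsometryOn G G' R R' θ) (hψ : IsIsometryOn K K' S S' ψ) (hu : u ∈ R)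
    (hPu : P u ∈ S) (hP : DifferentiableAt ℝ P u) (hP' : DifferentiableAt ℝ P' (θ u))
    (hPP : ∀ᶠ w in nhds u, P' (θ w) = ψ (P w)) (x : Eu m) :
    fderiv ℝ P' (θ u) (fderiv ℝ θ u x) = fderiv ℝ ψ (P u) (fderiv ℝ P u x) := by
  have hθd := differentiableAt_of_contDiffOn hθ.source.isOpen hθ.smooth hu
  have hψd := differentiableAt_of_contDiffOn hψ.source.isOpen hψ.smooth hPu
  have e : (fun w => P' (θ w)) =ᶠ[nhds u] fun w => ψ (P w) := hPP
  have h1 : HasFDerivAt (fun w => P' (θ w)) _ u := hP'.hasFDerivAt.comp u hθd.hasFDerivAt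
  have h2 : HasFDerivAt (fun w => ψ (P w)) _ u := hψd.hasFDerivAt.comp u hP.hasFDerivAt
  exact DFunLike.congr_fun (h1.unique (h2.congr_of_eventuallyEq e)) x

/-- The curvature operator, as a bilinear map of its last two arguments. -/
def curvRight (K : Eu n → Matrix (Fin n) (Fin n) ℝ) (q a : Eu n) : Eu n →L[ℝ] Eu n →L[ℝ] Eu n :=
  fderiv ℝ (gamma K) q a - (fderiv ℝ (gamma K) q).flip a
    + (ContinuousLinearMap.compL ℝ (Eu n) (Eu n) (Eu n) (gamma K q a)).comp (gamma K q)
    - (gamma K q).bilinearComp (ContinuousLinearMap.id ℝ (Eu n)) (gamma K q a)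

theorem jacobiOp_eq (G : Eu m → Matrix (Fin m) (Fin m) ℝ) (K : Eu n → Matrix (Fin n) (Fin n) ℝ)
    (P V : Eu m → Eu n) (u : Eu m) : jacobiOp G K P V u = roughLaplacian G K P V u
      + metricTrace (G u) ((curvRight K (P u) (V u)).bilinearComp (fderiv ℝ P u) (fderiv ℝ P u)) :=
  rfl

/-- Data for two coordinate expressions `P` and `P'` of the same map. -/
structure IsChartChange (G G' : Eu m → Matrix (Fin m) (Fin m) ℝ)
    (K K' : Eu n → Matrix (Fin n) (Fin n) ℝ) (S S' : Set (Eu n))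
    (θ : Eu m → Eu m) (ψ : Eu n → Eu n) (P P' : Eu m → Eu n) (O O' : Set (Eu m)) : Prop where
  domain : IsIsometryOn G G' O O' θ
  codomain : IsIsometryOn K K' S S' ψ
  smooth : ContDiffOn ℝ ∞ P O
  smooth' : ContDiffOn ℝ ∞ P' O'
  mapsTo : Set.MapsTo P O S
  mapsTo' : Set.MapsTo P' O' S'
  comm : ∀ w ∈ O, P' (θ w) = ψ (P w)

namespace IsChartChange

theorem fderiv_map (h : IsChartChange G G' K K' S S' θ ψ P P' O O') (hu : u ∈ O) (x : Eu m) :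
    fderiv ℝ P' (θ u) (fderiv ℝ θ u x) = fderiv ℝ ψ (P u) (fderiv ℝ P u x) := by
  have hO := h.domain.source.isOpen
  refine fderiv_field_map h.domain h.codomain hu (h.mapsTo hu)
    (differentiableAt_of_contDiffOn hO h.smooth hu)
    (differentiableAt_of_contDiffOn h.domain.target.isOpen h.smooth' (h.domain.mapsTo hu)) ?_ x
  filter_upwards [hO.mem_nhds hu] with w hw using h.comm w hw

theorem nabla_map (h : IsChartChange G G' K K' S S' θ ψ P P' O O')
    {α α' : Eu m → Eu m →L[ℝ] Eu n} (hα : ContDiffOn ℝ ∞ α O) (hα' : ContDiffOn ℝ ∞ α' O')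
    (hαα : ∀ w ∈ O, ∀ x, α' (θ w) (fderiv ℝ θ w x) = fderiv ℝ ψ (P w) (α w x)) (hu : u ∈ O)
    (x y : Eu m) :
    nabla G' K' P' α' (θ u) (fderiv ℝ θ u x) (fderiv ℝ θ u y)
      = fderiv ℝ ψ (P u) (nabla G K P α u x y) := by
  have hO := h.domain.source.isOpen
  have hO' := h.domain.target.isOpen
  have hu' := h.domain.mapsTo hu
  refine _root_.nabla_map h.domain h.codomain hu (h.mapsTo hu)
    (differentiableAt_of_contDiffOn hO h.smooth hu)
    (differentiableAt_of_contDiffOn hO' h.smooth' hu')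
    (differentiableAt_of_contDiffOn hO hα hu)
    (differentiableAt_of_contDiffOn hO' hα' hu') ?_ ?_ x y
  · filter_upwards [hO.mem_nhds hu] with w hw using h.comm w hw
  · filter_upwards [hO.mem_nhds hu] with w hw using hαα w hw

/-- The differential of the map is a natural one-form, `nabla` is natural, and traces are invariant
under isometries; so the tension field transforms as a vector of the target. -/
theorem coordTension_map (h : IsChartChange G G' K K' S S' θ ψ P P' O O') (hu : u ∈ O) :
    coordTension G' K' P' (θ u) = fderiv ℝ ψ (P u) (coordTension G K P u) := by
  have hO := h.domain.source.isOpen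
  have hO' := h.domain.target.isOpen
  exact metricTrace_map_of_isometry (h.domain.source.posDef u hu)
    (h.domain.target.posDef _ (h.domain.mapsTo hu)) (fderiv ℝ θ u) _ (h.domain.isometry u hu)
    (h.nabla_map (contDiffOn_fderiv hO h.smooth) (contDiffOn_fderiv hO' h.smooth')
      (fun w hw x => h.fderiv_map hw x) hu)

theorem covD_map (h : IsChartChange G G' K K' S S' θ ψ P P' O O')
    (hV : ContDiffOn ℝ ∞ V O) (hV' : ContDiffOn ℝ ∞ V' O')
    (hVV : ∀ w ∈ O, V' (θ w) = fderiv ℝ ψ (P w) (V w)) (hu : u ∈ O) (x : Eu m) :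
    covD K' P' V' (θ u) (fderiv ℝ θ u x) = fderiv ℝ ψ (P u) (covD K P V u x) := by
  have hO := h.domain.source.isOpen
  have hO' := h.domain.target.isOpen
  have hu' := h.domain.mapsTo hu
  rw [← covD_comp K' (differentiableAt_of_contDiffOn hO h.domain.smooth hu)
    (differentiableAt_of_contDiffOn hO' h.smooth' hu')
    (differentiableAt_of_contDiffOn hO' hV' hu'), ← h.codomain.covD_map (h.mapsTo hu)
    (differentiableAt_of_contDiffOn hO h.smooth hu) (differentiableAt_of_contDiffOn hO hV hu)]
  refine DFunLike.congr_fun (covD_congr ?_ ?_) x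
  · filter_upwards [hO.mem_nhds hu] with w hw using h.comm w hw
  · filter_upwards [hO.mem_nhds hu] with w hw using hVV w hw

/-- The same argument with the one-form `covD K P V`, together with the naturality of the curvature.
-/
theorem jacobiOp_map (h : IsChartChange G G' K K' S S' θ ψ P P' O O')
    (hV : ContDiffOn ℝ ∞ V O) (hV' : ContDiffOn ℝ ∞ V' O')
    (hVV : ∀ w ∈ O, V' (θ w) = fderiv ℝ ψ (P w) (V w)) (hu : u ∈ O) :
    jacobiOp G' K' P' V' (θ u) = fderiv ℝ ψ (P u) (jacobiOp G K P V u) := by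
  have hO := h.domain.source.isOpen
  have hO' := h.domain.target.isOpen
  have hA := h.domain.source.posDef u hu
  have hA' := h.domain.target.posDef _ (h.domain.mapsTo hu)
  have h1 : roughLaplacian G' K' P' V' (θ u) = fderiv ℝ ψ (P u) (roughLaplacian G K P V u) :=
    metricTrace_map_of_isometry hA hA' (fderiv ℝ θ u) _ (h.domain.isometry u hu)
      (h.nabla_map (covD_contDiffOn h.codomain.source hO h.smooth h.mapsTo hV)
        (covD_contDiffOn h.codomain.target hO' h.smooth' h.mapsTo' hV')
        (fun w hw x => h.covD_map hV hV' hVV hw x) hu)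
  rw [jacobiOp_eq, jacobiOp_eq, map_add, h1]
  congr 1
  refine metricTrace_map_of_isometry hA hA' (fderiv ℝ θ u) _ (h.domain.isometry u hu) fun x y => ?_
  change curv K' (P' (θ u)) (V' (θ u)) (fderiv ℝ P' (θ u) (fderiv ℝ θ u x))
    (fderiv ℝ P' (θ u) (fderiv ℝ θ u y)) = fderiv ℝ ψ (P u) (curv K (P u) (V u)
      (fderiv ℝ P u x) (fderiv ℝ P u y))
  rw [← h.codomain.curv_map (h.mapsTo hu), h.fderiv_map hu, h.fderiv_map hu, h.comm u hu, hVV u hu]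

end IsChartChange

end Naturality

/-! ## Charts of Riemannian manifolds -/

section Charts

variable {m n : ℕ}
  {M : Type*} [TopologicalSpace M] [ChartedSpace (EuclideanSpace ℝ (Fin m)) M]
  [IsManifold (𝓡 m) ∞ M]
  {N : Type*} [TopologicalSpace N] [ChartedSpace (EuclideanSpace ℝ (Fin n)) N]
  [IsManifold (𝓡 n) ∞ N]

/-- The metric at a point, as a bilinear form on the model space. -/
def innerForm (g : RMetric m M) (x : M) : Eu m →L[ℝ] Eu m →L[ℝ] ℝ := g.inner x

/-- The derivative of an inverse chart, as a map of the model space. -/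
def chartDeriv (x : M) (u : Eu m) : Eu m →L[ℝ] Eu m :=
  mfderiv 𝓘(ℝ, EuclideanSpace ℝ (Fin m)) (𝓡 m) (extChartAt (𝓡 m) x).symm u

/-- The derivative of a map, in the preferred charts. -/
def mapDeriv (φ : M → N) (x : M) : Eu m →L[ℝ] Eu n := mfderiv (𝓡 m) (𝓡 n) φ x

theorem metricForm_chartMetric (g : RMetric m M) (x : M) (u a b : Eu m) :
    metricForm (chartMetric g x u) a b
      = innerForm g ((extChartAt (𝓡 m) x).symm u) (chartDeriv x u a) (chartDeriv x u b) := by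
  have : metricForm (chartMetric g x u)
      = (innerForm g ((extChartAt (𝓡 m) x).symm u)).bilinearComp (chartDeriv x u) (chartDeriv x u) := by
    refine bilin_ext fun i j => ?_
    rw [metricForm_single]; rfl
  rw [this]; rfl

/-- A tangent vector at `x` is represented by its components in the chart at `x`, so at the centre
of its own chart the coordinate frame is the standard one. Every tensor defined through preferred
charts is compared with a coordinate expression by means of this. -/
theorem chartDeriv_self (x : M) : chartDeriv x (extChartAt (𝓡 m) x x) = ContinuousLinearMap.id ℝ _ := by
  have h := mfderivWithin_range_extChartAt_symm (I := 𝓡 m) (x := x)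
  rw [ModelWithCorners.range_eq_univ, mfderivWithin_univ] at h
  exact h

theorem metricForm_chartMetric_self (g : RMetric m M) (x : M) (a b : Eu m) :
    metricForm (chartMetric g x (extChartAt (𝓡 m) x x)) a b = innerForm g x a b := by
  rw [metricForm_chartMetric, chartDeriv_self, extChartAt_to_inv]; rfl

theorem chartDeriv_bijective (x : M) {u : Eu m} (hu : u ∈ (extChartAt (𝓡 m) x).target) :
    Function.Bijective (chartDeriv x u) := by
  have h := isInvertible_mfderivWithin_extChartAt_symm (I := 𝓡 m) (x := x) hu
  rw [ModelWithCorners.range_eq_univ, mfderivWithin_univ] at h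
  exact h.bijective

theorem chartMetric_smooth (g : RMetric m M) (x : M) (i j : Fin m) :
    ContDiffOn ℝ ∞ (fun u => chartMetric g x u i j) (extChartAt (𝓡 m) x).target := by
  have hs : ContMDiffOn 𝓘(ℝ, Eu m) (𝓡 m) ∞ (extChartAt (𝓡 m) x).symm (extChartAt (𝓡 m) x).target :=
    contMDiffOn_extChartAt_symm x
  have hT := isOpen_extChartAt_target (I := 𝓡 m) x
  have h1 : ContMDiffOn 𝓘(ℝ, Eu m) ((𝓡 m).prod 𝓘(ℝ, Eu m →L[ℝ] Eu m →L[ℝ] ℝ)) ∞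
      (fun u => (⟨(extChartAt (𝓡 m) x).symm u, g.inner ((extChartAt (𝓡 m) x).symm u)⟩ :
        TotalSpace (Eu m →L[ℝ] Eu m →L[ℝ] ℝ)
          (fun b : M => TangentSpace (𝓡 m) b →L[ℝ] TangentSpace (𝓡 m) b →L[ℝ] ℝ)))
      (extChartAt (𝓡 m) x).target := g.contMDiff.comp_contMDiffOn hs
  have h2 : ∀ i, ContMDiffOn 𝓘(ℝ, Eu m) (𝓡 m).tangent ∞
      (fun u => (⟨(extChartAt (𝓡 m) x).symm u, coordField M x u i⟩ : TangentBundle (𝓡 m) M))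
      (extChartAt (𝓡 m) x).target := by
    intro i
    have h3 := hs.contMDiffOn_tangentMapWithin (m := ∞) (by simp) hT.uniqueMDiffOn
    have h4 : ContMDiff 𝓘(ℝ, Eu m) 𝓘(ℝ, Eu m).tangent ∞
        (fun u : Eu m => (⟨u, (stdVec i : Eu m)⟩ : TangentBundle 𝓘(ℝ, Eu m) (Eu m))) := by
      refine fun u => (contMDiffAt_vectorSpace_iff_contDiffAt (V := fun _ => stdVec i)).2 contDiffAt_const
    -- The coordinate field is the tangent map of the inverse chart composed with a constant
    -- section; its smoothness is that of the tangent map.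
    refine (h3.comp h4.contMDiffOn (s := (extChartAt (𝓡 m) x).target) fun u hu => hu).congr ?_
    intro u hu
    simp only [tangentMapWithin, Function.comp, mfderivWithin_of_isOpen hT hu]
    rfl
  intro u hu
  have h5 : ContMDiffWithinAt 𝓘(ℝ, Eu m) ((𝓡 m).prod 𝓘(ℝ)) ∞
      (fun u => TotalSpace.mk' ℝ (E := Bundle.Trivial M ℝ) ((extChartAt (𝓡 m) x).symm u)
        (g.inner _ (coordField M x u i) (coordField M x u j))) (extChartAt (𝓡 m) x).target u := by
    apply ContMDiffWithinAt.clm_bundle_apply₂ (F₁ := Eu m) (F₂ := Eu m)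
    · exact h1 u hu
    · exact h2 i u hu
    · exact h2 j u hu
  simp only [contMDiffWithinAt_totalSpace] at h5
  exact h5.2.contDiffWithinAt

end Charts

/-! ## Maps between Riemannian manifolds in charts -/

theorem IsMetricOn.mono {n : ℕ} {G : Eu n → Matrix (Fin n) (Fin n) ℝ} {S S' : Set (Eu n)}
    (h : IsMetricOn G S) (hS' : IsOpen S') (hSS : S' ⊆ S) : IsMetricOn G S' :=
  ⟨hS', fun i j => (h.smooth i j).mono hSS, fun u hu => h.posDef u (hSS hu)⟩

section MapsInCharts

variable {m n : ℕ}
  {M : Type*} [TopologicalSpace M] [ChartedSpace (EuclideanSpace ℝ (Fin m)) M]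
  [IsManifold (𝓡 m) ∞ M]
  {N : Type*} [TopologicalSpace N] [ChartedSpace (EuclideanSpace ℝ (Fin n)) N]
  [IsManifold (𝓡 n) ∞ N]
  {g : RMetric m M} {h : RMetric n N} {φ : M → N} {x x' y : M} {z z' : N} {u : Eu m}

variable (g x) in
theorem isMetricOn_chartMetric : IsMetricOn (chartMetric g x) (extChartAt (𝓡 m) x).target := by
  refine ⟨isOpen_extChartAt_target x, chartMetric_smooth g x, fun u hu => posDef_of_metricForm ?_ ?_⟩
  · intro a b
    rw [metricForm_chartMetric, metricForm_chartMetric]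
    exact g.symm _ _ _
  · intro a ha
    rw [metricForm_chartMetric]
    refine g.pos _ _ fun h0 => ha ?_
    exact (chartDeriv_bijective x hu).1 (h0.trans (map_zero (chartDeriv x u)).symm)

variable (m n) in
/-- The domain of the expression of `φ` in the charts at `x` and `z`, in the manifold. -/
def chartSrc (φ : M → N) (x : M) (z : N) : Set M :=
  (extChartAt (𝓡 m) x).source ∩ φ ⁻¹' (extChartAt (𝓡 n) z).source

variable (m) in
/-- The part of the range of the chart at `x` which lies over `U`. -/
def chartPart (x : M) (U : Set M) : Set (Eu m) :=
  (extChartAt (𝓡 m) x).target ∩ (extChartAt (𝓡 m) x).symm ⁻¹' U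

variable (m n) in
/-- The domain of the expression of `φ` in the charts at `x` and `z`. -/
def chartDom (φ : M → N) (x : M) (z : N) : Set (Eu m) := chartPart m x (chartSrc m n φ x z)

variable (m n) in
/-- The expression of `φ` in the charts at `x` and `z`. -/
def inCharts (φ : M → N) (x : M) (z : N) (u : Eu m) : Eu n :=
  extChartAt (𝓡 n) z (φ ((extChartAt (𝓡 m) x).symm u))

theorem isOpen_chartSrc {φ : M → N} (hφ : Continuous φ) (x : M) (z : N) : IsOpen (chartSrc m n φ x z) :=
  (isOpen_extChartAt_source x).inter ((isOpen_extChartAt_source z).preimage hφ)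

theorem isOpen_chartPart {U : Set M} (hU : IsOpen U) (x : M) : IsOpen (chartPart m x U) :=
  (continuousOn_extChartAt_symm x).isOpen_inter_preimage (isOpen_extChartAt_target x) hU

theorem isOpen_chartDom (hφ : Continuous φ) (x : M) (z : N) : IsOpen (chartDom m n φ x z) :=
  isOpen_chartPart (isOpen_chartSrc hφ x z) x

theorem mem_chartSrc_self (φ : M → N) (x : M) : x ∈ chartSrc m n φ x (φ x) :=
  ⟨mem_extChartAt_source x, mem_extChartAt_source (φ x)⟩

theorem extChartAt_mem_chartPart {U : Set M} (hy : y ∈ U) (hx : y ∈ (extChartAt (𝓡 m) x).source) :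
    extChartAt (𝓡 m) x y ∈ chartPart m x U := by
  refine ⟨(extChartAt (𝓡 m) x).map_source hx, ?_⟩
  rwa [Set.mem_preimage, (extChartAt (𝓡 m) x).left_inv hx]

theorem extChartAt_mem_chartDom (hy : y ∈ chartSrc m n φ x z) : extChartAt (𝓡 m) x y ∈ chartDom m n φ x z :=
  extChartAt_mem_chartPart hy hy.1

theorem symm_mem_chartSrc (hu : u ∈ chartDom m n φ x z) : (extChartAt (𝓡 m) x).symm u ∈ chartSrc m n φ x z :=
  hu.2

theorem inCharts_contDiffOn (hφ : ContMDiff (𝓡 m) (𝓡 n) ∞ φ) (x : M) (z : N) :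
    ContDiffOn ℝ ∞ (inCharts m n φ x z) (chartDom m n φ x z) := by
  rw [← contMDiffOn_iff_contDiffOn]
  have h1 : ContMDiffOn 𝓘(ℝ, Eu m) (𝓡 m) ∞ (extChartAt (𝓡 m) x).symm (extChartAt (𝓡 m) x).target :=
    contMDiffOn_extChartAt_symm x
  have h2 := hφ.comp_contMDiffOn (h1.mono (Set.inter_subset_left (t := (extChartAt (𝓡 m) x).symm ⁻¹'
    chartSrc m n φ x z)))
  have h3 : ContMDiffOn (𝓡 n) 𝓘(ℝ, Eu n) ∞ (extChartAt (𝓡 n) z) (extChartAt (𝓡 n) z).source := by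
    rw [extChartAt_source]; exact contMDiffOn_extChartAt
  exact h3.comp h2 fun u hu => hu.2.2

theorem inCharts_mapsTo (φ : M → N) (x : M) (z : N) :
    Set.MapsTo (inCharts m n φ x z) (chartDom m n φ x z) (extChartAt (𝓡 n) z).target :=
  fun _ hu => (extChartAt (𝓡 n) z).map_source hu.2.2

theorem symm_inCharts (hu : u ∈ chartDom m n φ x z) :
    (extChartAt (𝓡 n) z).symm (inCharts m n φ x z u) = φ ((extChartAt (𝓡 m) x).symm u) :=
  (extChartAt (𝓡 n) z).left_inv hu.2.2

theorem inCharts_extChartAt (hy : y ∈ (extChartAt (𝓡 m) x).source) :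
    inCharts m n φ x z (extChartAt (𝓡 m) x y) = extChartAt (𝓡 n) z (φ y) := by
  rw [inCharts, (extChartAt (𝓡 m) x).left_inv hy]

theorem mdifferentiableAt_extChartAt_symm' (hu : u ∈ (extChartAt (𝓡 m) x).target) :
    MDifferentiableAt 𝓘(ℝ, Eu m) (𝓡 m) (extChartAt (𝓡 m) x).symm u := by
  have h1 : ContMDiffOn 𝓘(ℝ, Eu m) (𝓡 m) ∞ (extChartAt (𝓡 m) x).symm (extChartAt (𝓡 m) x).target :=
    contMDiffOn_extChartAt_symm x
  exact (h1.contMDiffAt ((isOpen_extChartAt_target x).mem_nhds hu)).mdifferentiableAt (by simp)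

/-- The chain rule for `φ` composed with the inverse chart at `x`, which near `u` equals the inverse
chart at `z` composed with the coordinate expression. -/
theorem chartDeriv_fderiv_inCharts (hφ : ContMDiff (𝓡 m) (𝓡 n) ∞ φ) (hu : u ∈ chartDom m n φ x z)
    (a : Eu m) : chartDeriv z (inCharts m n φ x z u) (fderiv ℝ (inCharts m n φ x z) u a)
      = mapDeriv φ ((extChartAt (𝓡 m) x).symm u) (chartDeriv x u a) := by
  have hO := isOpen_chartDom (m := m) (n := n) hφ.continuous x z
  have h1 := (mdifferentiableAt_extChartAt_symm' (inCharts_mapsTo φ x z hu)).hasMFDerivAt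
  have h2 := (mdifferentiableAt_extChartAt_symm' hu.1).hasMFDerivAt
  have h3 := (differentiableAt_of_contDiffOn hO (inCharts_contDiffOn hφ x z) hu).hasFDerivAt.hasMFDerivAt
  have h4 := (hφ.mdifferentiableAt (by simp) (x := (extChartAt (𝓡 m) x).symm u)).hasMFDerivAt
  have h5 := h1.comp u h3
  have h6 := h4.comp u h2
  have e : φ ∘ (extChartAt (𝓡 m) x).symm =ᶠ[nhds u] (extChartAt (𝓡 n) z).symm ∘ inCharts m n φ x z := by
    filter_upwards [hO.mem_nhds hu] with w hw using (symm_inCharts hw).symm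
  have h7 := h5.congr_of_eventuallyEq e
  exact DFunLike.congr_fun (hasMFDerivAt_unique h7 h6) a

theorem IsIsometricImmersion.metricForm_inCharts (hφ : IsIsometricImmersion g h φ)
    (hu : u ∈ chartDom m n φ x z) (a b : Eu m) :
    metricForm (chartMetric h z (inCharts m n φ x z u)) (fderiv ℝ (inCharts m n φ x z) u a)
      (fderiv ℝ (inCharts m n φ x z) u b) = metricForm (chartMetric g x u) a b := by
  rw [metricForm_chartMetric, metricForm_chartMetric, chartDeriv_fderiv_inCharts hφ.1 hu,
    chartDeriv_fderiv_inCharts hφ.1 hu, symm_inCharts hu]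
  exact hφ.2 _ _ _

variable (g) in
-- Transition maps are the coordinate expressions of the identity. Hence everything known about
-- isometric immersions in charts, here the isometry property, applies to them.
theorem isIsometricImmersion_id : IsIsometricImmersion g g (id : M → M) := by
  refine ⟨contMDiff_id, fun x X Y => ?_⟩
  rw [mfderiv_id]; rfl

variable (g) in
theorem isIsometryOn_chart_transition (x x' : M) {O : Set (Eu m)} (hO : IsOpen O)
    (hO' : O ⊆ chartDom m m (id : M → M) x x') {O' : Set (Eu m)} (hO'o : IsOpen O')
    (hO'' : O' ⊆ (extChartAt (𝓡 m) x').target) (hm : Set.MapsTo (inCharts m m (id : M → M) x x') O O') :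
    IsIsometryOn (chartMetric g x) (chartMetric g x') O O' (inCharts m m (id : M → M) x x') where
  source := (isMetricOn_chartMetric g x).mono hO fun _ hu => (hO' hu).1
  target := (isMetricOn_chartMetric g x').mono hO'o hO''
  smooth := (inCharts_contDiffOn contMDiff_id x x').mono hO'
  mapsTo := hm
  isometry _ hu a b := (isIsometricImmersion_id g).metricForm_inCharts (hO' hu) a b

variable (g h) in
/-- The change of charts for the coordinate expressions of a map. -/
theorem isChartChange (hφ : ContMDiff (𝓡 m) (𝓡 n) ∞ φ) (x x' : M) (z z' : N) :
    IsChartChange (chartMetric g x) (chartMetric g x') (chartMetric h z) (chartMetric h z')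
      (chartDom n n (id : N → N) z z') (extChartAt (𝓡 n) z').target (inCharts m m (id : M → M) x x')
      (inCharts n n (id : N → N) z z') (inCharts m n φ x z) (inCharts m n φ x' z')
      (chartPart m x (chartSrc m n φ x z ∩ chartSrc m n φ x' z')) (chartDom m n φ x' z') where
  domain := by
    refine isIsometryOn_chart_transition g x x' (isOpen_chartPart
      ((isOpen_chartSrc hφ.continuous x z).inter (isOpen_chartSrc hφ.continuous x' z')) x)
      (fun u hu => ⟨hu.1, hu.2.1.1, hu.2.2.1⟩) (isOpen_chartDom hφ.continuous x' z')
      (fun _ hu => hu.1) fun u hu => ?_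
    exact extChartAt_mem_chartPart hu.2.2 hu.2.2.1
  codomain := isIsometryOn_chart_transition h z z' (isOpen_chartDom continuous_id z z')
    subset_rfl (isOpen_extChartAt_target z') subset_rfl (inCharts_mapsTo _ z z')
  smooth := (inCharts_contDiffOn hφ x z).mono fun u hu => ⟨hu.1, hu.2.1⟩
  smooth' := inCharts_contDiffOn hφ x' z'
  mapsTo u hu := extChartAt_mem_chartPart (y := φ ((extChartAt (𝓡 m) x).symm u))
    ⟨hu.2.1.2, hu.2.2.2⟩ hu.2.1.2
  mapsTo' := inCharts_mapsTo φ x' z'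
  comm u hu := by
    rw [show inCharts m m (id : M → M) x x' u = extChartAt (𝓡 m) x' ((extChartAt (𝓡 m) x).symm u) from rfl,
      inCharts_extChartAt hu.2.2.1]
    rw [inCharts, symm_inCharts (φ := φ) (x := x) (z := z) ⟨hu.1, hu.2.1⟩]; rfl

theorem fderiv_coord {F : Eu m → Eu n} (hF : DifferentiableAt ℝ F u) (γ : Fin n) (a : Eu m) :
    fderiv ℝ (fun w => F w γ) u a = fderiv ℝ F u a γ := by
  have h := ((EuclideanSpace.proj γ : Eu n →L[ℝ] ℝ).hasFDerivAt (x := F u)).comp u hF.hasFDerivAt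
  have h' : HasFDerivAt (fun w => F w γ) ((EuclideanSpace.proj γ : Eu n →L[ℝ] ℝ).comp (fderiv ℝ F u)) u := h
  rw [h'.fderiv]; rfl

variable (g h) in
-- Links the pointwise definitions to the coordinate calculus: at the centre of the preferred
-- charts, the classical formula for the Hessian of a map is `nabla` of its differential.
theorem hessCoeff_eq (hφ : ContMDiff (𝓡 m) (𝓡 n) ∞ φ) (x : M) (γ : Fin n) (i j : Fin m) :
    hessCoeff g h φ x γ i j = nabla (chartMetric g x) (chartMetric h (φ x)) (inCharts m n φ x (φ x))
      (fderiv ℝ (inCharts m n φ x (φ x))) (extChartAt (𝓡 m) x x) (stdVec i) (stdVec j) γ := by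
  set P := inCharts m n φ x (φ x) with hP
  set u := extChartAt (𝓡 m) x x with hu
  have hO := isOpen_chartDom (m := m) (n := n) hφ.continuous x (φ x)
  have hs := inCharts_contDiffOn hφ x (φ x)
  have hu0 : u ∈ chartDom m n φ x (φ x) := extChartAt_mem_chartDom (mem_chartSrc_self φ x)
  have hd := differentiableAt_of_contDiffOn hO hs hu0
  have hdd := differentiableAt_of_contDiffOn hO (contDiffOn_fderiv hO hs) hu0
  have hPu : P u = extChartAt (𝓡 n) (φ x) (φ x) := inCharts_extChartAt (mem_extChartAt_source x)
  have h1 : ∀ k γ, partialD k (mapComp φ x γ) u = fderiv ℝ P u (stdVec k) γ := fun k γ =>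
    fderiv_coord hd γ _
  have h2 : partialD i (partialD j (mapComp φ x γ)) u = fderiv ℝ (fun w => fderiv ℝ P w (stdVec j)) u (stdVec i) γ := by
    rw [← fderiv_coord (hdd.clm_apply (differentiableAt_const _)), partialD]
    refine DFunLike.congr_fun (Filter.EventuallyEq.fderiv_eq ?_) _
    filter_upwards [hO.mem_nhds hu0] with w hw
    exact fderiv_coord (differentiableAt_of_contDiffOn hO hs hw) γ _
  rw [nabla_apply hdd, covD_apply, hessCoeff]
  simp only [h1, ← hu]
  rw [h2, ← hPu]
  rw [gamma, gamma, bilin_apply, bilin_single]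
  simp only [PiLp.sub_apply, PiLp.add_apply]
  have h3 : fderiv ℝ P u (WithLp.toLp 2 fun k => christoffel (chartMetric g x) k i j u)
      = ∑ k, christoffel (chartMetric g x) k i j u • fderiv ℝ P u (stdVec k) := by
    conv_lhs => rw [← sum_coord_smul (WithLp.toLp 2 fun k => christoffel (chartMetric g x) k i j u)]
    rw [map_sum]
    exact Finset.sum_congr rfl fun k _ => map_smul _ _ _
  rw [h3]
  simp only [WithLp.ofLp_sum, Finset.sum_apply, PiLp.smul_apply, smul_eq_mul]
  rw [sub_add_eq_add_sub]
  congr 2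
  refine Finset.sum_congr rfl fun α _ => Finset.sum_congr rfl fun β _ => ?_
  ring

variable (g h) in
theorem secondFundamentalForm_eq (hφ : ContMDiff (𝓡 m) (𝓡 n) ∞ φ) (x : M) (X Y : Eu m) :
    (secondFundamentalForm g h φ x X Y : Eu n) = nabla (chartMetric g x) (chartMetric h (φ x))
      (inCharts m n φ x (φ x)) (fderiv ℝ (inCharts m n φ x (φ x))) (extChartAt (𝓡 m) x x) X Y := by
  have hext : ∀ a b : Eu n, (∀ γ, a γ = b γ) → a = b := fun a b h => PiLp.ext h
  refine hext _ _ fun γ => ?_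
  conv_rhs => rw [← bilin_eq (nabla (chartMetric g x) (chartMetric h (φ x))
      (inCharts m n φ x (φ x)) (fderiv ℝ (inCharts m n φ x (φ x))) (extChartAt (𝓡 m) x x)), bilin_apply]
  change ∑ i, ∑ j, hessCoeff g h φ x γ i j * X i * Y j = _
  simp only [WithLp.ofLp_sum, Finset.sum_apply, PiLp.smul_apply, smul_eq_mul, hessCoeff_eq g h hφ]
  refine Finset.sum_congr rfl fun α _ => Finset.sum_congr rfl fun β _ => ?_
  ring

variable (g h) in
theorem tension_eq (hφ : ContMDiff (𝓡 m) (𝓡 n) ∞ φ) (x : M) :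
    (tension g h φ x : Eu n) = coordTension (chartMetric g x) (chartMetric h (φ x))
      (inCharts m n φ x (φ x)) (extChartAt (𝓡 m) x x) := by
  rw [coordTension, metricTrace]
  refine Finset.sum_congr rfl fun i _ => Finset.sum_congr rfl fun j _ => ?_
  rw [← secondFundamentalForm_eq g h hφ]; rfl

/-- The energy density `|τ(φ)|²`. -/
def bienergyDensity (g : RMetric m M) (h : RMetric n N) (φ : M → N) (x : M) : ℝ :=
  h.inner (φ x) (tension g h φ x) (tension g h φ x)

variable (g h) in
-- By definition the density at `y` uses the charts at `y` and `φ y`. Naturality of the tension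
-- field allows one fixed pair of charts to serve for all points of its domain, so that the density
-- can be differentiated.
theorem bienergyDensity_eq (hφ : ContMDiff (𝓡 m) (𝓡 n) ∞ φ) (hu : u ∈ chartDom m n φ x z) :
    bienergyDensity g h φ ((extChartAt (𝓡 m) x).symm u)
      = metricForm (chartMetric h z (inCharts m n φ x z u))
        (coordTension (chartMetric g x) (chartMetric h z) (inCharts m n φ x z) u)
        (coordTension (chartMetric g x) (chartMetric h z) (inCharts m n φ x z) u) := by
  set y := (extChartAt (𝓡 m) x).symm u with hy
  have hc := isChartChange g h hφ x y z (φ y)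
  have hu' : u ∈ chartPart m x (chartSrc m n φ x z ∩ chartSrc m n φ y (φ y)) :=
    ⟨hu.1, hu.2, mem_chartSrc_self φ y⟩
  have e : inCharts m m (id : M → M) x y u = extChartAt (𝓡 m) y y := rfl
  have e1 := hc.coordTension_map hu'
  rw [← hc.codomain.isometry _ (hc.mapsTo hu'), ← e1, ← hc.comm u hu', e,
    inCharts_extChartAt (mem_extChartAt_source y), metricForm_chartMetric_self,
    ← tension_eq g h hφ y]
  rfl

end MapsInCharts

/-! ## The Riemannian volume in charts -/

/-- In matrix form the hypothesis is `A = Bᵀ A' B`, with `B` the matrix of `L`. -/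
theorem det_eq_of_isometry {n : ℕ} {A A' : Matrix (Fin n) (Fin n) ℝ} (L : Eu n →L[ℝ] Eu n)
    (hL : ∀ x y, metricForm A' (L x) (L y) = metricForm A x y) : A.det = L.det ^ 2 * A'.det := by
  let B : Matrix (Fin n) (Fin n) ℝ := Matrix.of fun i j => L (stdVec j) i
  have hA : A = B.transpose * A' * B := by
    ext i j
    rw [← metricForm_single A i j, ← hL, metricForm_apply, Matrix.mul_apply]
    simp only [Matrix.mul_apply, Matrix.transpose_apply, Finset.sum_mul]
    rw [Finset.sum_comm]
    refine Finset.sum_congr rfl fun k _ => Finset.sum_congr rfl fun l _ => ?_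
    simp only [B, Matrix.of_apply]
    ring
  have hB : B.det = L.det := by
    have h1 : LinearMap.toMatrix (EuclideanSpace.basisFun (Fin n) ℝ).toBasis
        (EuclideanSpace.basisFun (Fin n) ℝ).toBasis (L : Eu n →ₗ[ℝ] Eu n) = B := by
      ext i j
      rw [LinearMap.toMatrix_apply]
      simp [B]
    rw [← h1, LinearMap.det_toMatrix]
  rw [hA, Matrix.det_mul, Matrix.det_mul, Matrix.det_transpose, hB]; ring

section Volume

variable {m : ℕ}
  {M : Type*} [TopologicalSpace M] [ChartedSpace (EuclideanSpace ℝ (Fin m)) M]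
  [IsManifold (𝓡 m) ∞ M] [MeasurableSpace M] [BorelSpace M]
  (g : RMetric m M) (x y : M)

theorem continuousOn_sqrt_det :
    ContinuousOn (fun u => Real.sqrt (chartMetric g x u).det) (extChartAt (𝓡 m) x).target :=
  Real.continuous_sqrt.comp_continuousOn
    (ContDiffOn.matrix_det (isMetricOn_chartMetric g x).smooth).continuousOn

theorem aemeasurable_volumeDensity : AEMeasurable
    (fun u => ENNReal.ofReal (Real.sqrt (chartMetric g x u).det))
    (volume.restrict (extChartAt (𝓡 m) x).target) :=
  ((continuousOn_sqrt_det g x).aemeasurable (isOpen_extChartAt_target x).measurableSet).ennreal_ofReal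

theorem aemeasurable_extChartAt_symm : AEMeasurable (extChartAt (𝓡 m) x).symm
    ((volume.restrict (extChartAt (𝓡 m) x).target).withDensity
      fun u => ENNReal.ofReal (Real.sqrt (chartMetric g x u).det)) :=
  ((continuousOn_extChartAt_symm x).aemeasurable (isOpen_extChartAt_target x).measurableSet).mono_ac
    (withDensity_absolutelyContinuous _ _)

theorem measurableSet_chartPart {A : Set M} (hA : MeasurableSet A) :
    MeasurableSet (chartPart m x A) := by
  have hT := (isOpen_extChartAt_target (I := 𝓡 m) x)
  -- The inverse chart is controlled only on its target, so measurability is proved on the subtype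
  -- and then transported to the ambient space.
  have h := measurableSet_preimage (continuousOn_iff_continuous_domRestrict.1
    (continuousOn_extChartAt_symm (I := 𝓡 m) x)).measurable hA
  have h2 := (MeasurableEmbedding.subtype_coe hT.measurableSet).measurableSet_image.2 h
  convert h2 using 1
  ext u
  constructor
  · rintro ⟨h1, h2⟩
    exact ⟨⟨u, h1⟩, h2, rfl⟩
  · rintro ⟨⟨v, hv⟩, h2, rfl⟩
    exact ⟨hv, h2⟩

theorem chartVolume_apply {A : Set M} (hA : MeasurableSet A) :
    chartVolume g x A = ∫⁻ u in chartPart m x A, ENNReal.ofReal (Real.sqrt (chartMetric g x u).det) := by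
  rw [chartVolume, Measure.map_apply_of_aemeasurable (aemeasurable_extChartAt_symm g x) hA]
  have hT := (isOpen_extChartAt_target (I := 𝓡 m) x).measurableSet
  rw [withDensity_apply', Measure.restrict_restrict' hT, Set.inter_comm]; rfl

theorem chartVolume_inter_source {A : Set M} (hA : MeasurableSet A) :
    chartVolume g x (A ∩ (extChartAt (𝓡 m) x).source) = chartVolume g x A := by
  rw [chartVolume_apply g x hA, chartVolume_apply g x
    (hA.inter (isOpen_extChartAt_source x).measurableSet)]
  congr 2
  ext u
  exact ⟨fun h => ⟨h.1, h.2.1⟩, fun h => ⟨h.1, h.2, (extChartAt (𝓡 m) x).map_target h.1⟩⟩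

/-- Change of variables along the transition map: its Jacobian is absorbed by the densities, since
`√(det g)` transforms with `|det|` under isometries. -/
theorem chartVolume_eq {A : Set M} (hA : MeasurableSet A) (hx : A ⊆ (extChartAt (𝓡 m) x).source)
    (hy : A ⊆ (extChartAt (𝓡 m) y).source) : chartVolume g x A = chartVolume g y A := by
  rw [chartVolume_apply g x hA, chartVolume_apply g y hA]
  set T := inCharts m m (id : M → M) x y
  have hD : chartPart m x A ⊆ chartDom m m (id : M → M) x y :=
    fun u hu => ⟨hu.1, hx hu.2, hy hu.2⟩
  have hO := isOpen_chartDom (m := m) (n := m) (continuous_id (X := M)) x y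
  have hT : ContDiffOn ℝ ∞ T _ := inCharts_contDiffOn contMDiff_id x y
  have himg : T '' chartPart m x A = chartPart m y A := by
    ext v
    constructor
    · rintro ⟨u, hu, rfl⟩
      exact extChartAt_mem_chartPart (y := (extChartAt (𝓡 m) x).symm u) hu.2 (hy hu.2)
    · intro hv
      refine ⟨extChartAt (𝓡 m) x ((extChartAt (𝓡 m) y).symm v),
        extChartAt_mem_chartPart hv.2 (hx hv.2), ?_⟩
      exact (inCharts_extChartAt (φ := id) (hx hv.2)).trans ((extChartAt (𝓡 m) y).right_inv hv.1)
  have hinj : Set.InjOn T (chartPart m x A) := by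
    intro u hu v hv huv
    have h1 := symm_inCharts (φ := id) (hD hu)
    have h2 := symm_inCharts (φ := id) (hD hv)
    have h3 : (extChartAt (𝓡 m) x).symm u = (extChartAt (𝓡 m) x).symm v :=
      h1.symm.trans ((congrArg _ huv).trans h2)
    rw [← (extChartAt (𝓡 m) x).right_inv hu.1, h3, (extChartAt (𝓡 m) x).right_inv hv.1]
  rw [← himg, lintegral_image_eq_lintegral_abs_det_fderiv_mul volume (measurableSet_chartPart x hA)
    (fun u hu => (differentiableAt_of_contDiffOn hO hT (hD hu)).hasFDerivAt.hasFDerivWithinAt) hinj]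
  refine setLIntegral_congr_fun (measurableSet_chartPart x hA) fun u hu => ?_
  rw [← ENNReal.ofReal_mul (abs_nonneg _), ← Real.sqrt_sq_eq_abs, ← Real.sqrt_mul (sq_nonneg _)]
  congr 2
  exact det_eq_of_isometry _ fun a b => (isIsometricImmersion_id g).metricForm_inCharts (hD hu) a b

variable [SecondCountableTopology M]

/-- One inequality is the definition of the supremum. For the other, countably many charts cover
`M`; gluing their volumes along disjoint pieces gives a measure that dominates every chart volume
and equals the volume of the chart at `x` on subsets of its domain. -/
theorem riemannianVolume_apply {A : Set M} (hA : MeasurableSet A)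
    (hx : A ⊆ (extChartAt (𝓡 m) x).source) : riemannianVolume g A = chartVolume g x A := by
  refine le_antisymm ?_ (Measure.le_iff'.1 (le_iSup (chartVolume g) x) A)
  obtain ⟨s, hs, hsU⟩ := TopologicalSpace.countable_cover_nhds
    (f := fun x : M => (extChartAt (𝓡 m) x).source) fun x => extChartAt_source_mem_nhds x
  have hne : s.Nonempty := by
    by_contra hne
    rw [Set.not_nonempty_iff_eq_empty.1 hne] at hsU
    simpa using hsU.ge (Set.mem_univ x)
  obtain ⟨σ, rfl⟩ := hs.exists_eq_range hne
  let D := disjointed fun k => (extChartAt (𝓡 m) (σ k)).source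
  have hDm : ∀ k, MeasurableSet (D k) := MeasurableSet.disjointed fun k =>
    (isOpen_extChartAt_source (σ k)).measurableSet
  have hDs : ∀ k, D k ⊆ (extChartAt (𝓡 m) (σ k)).source := fun k => disjointed_subset _ k
  have hDU : ⋃ k, D k = Set.univ := by
    rw [iUnion_disjointed, ← hsU, Set.biUnion_range]
  have hsum : ∀ (y : M) {B : Set M}, MeasurableSet B → B ⊆ (extChartAt (𝓡 m) y).source →
      chartVolume g y B = ∑' k, chartVolume g (σ k) (B ∩ D k) := by
    intro y B hB hBy
    conv_lhs => rw [← Set.inter_univ B, ← hDU, Set.inter_iUnion]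
    rw [measure_iUnion]
    · exact tsum_congr fun k => chartVolume_eq g y (σ k) (hB.inter (hDm k))
        (Set.inter_subset_left.trans hBy) (Set.inter_subset_right.trans (hDs k))
    · exact fun i j hij => (disjoint_disjointed _ hij).mono Set.inter_subset_right Set.inter_subset_right
    · exact fun k => hB.inter (hDm k)
  let ν : Measure M := Measure.sum fun k => (chartVolume g (σ k)).restrict (D k)
  have hν : ∀ {B : Set M}, MeasurableSet B → ν B = ∑' k, chartVolume g (σ k) (B ∩ D k) := fun hB => by
    rw [Measure.sum_apply _ hB]
    exact tsum_congr fun k => Measure.restrict_apply hB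
  have hle : riemannianVolume g ≤ ν := by
    refine iSup_le fun y => Measure.le_iff.2 fun B hB => ?_
    have hB' := hB.inter (isOpen_extChartAt_source (I := 𝓡 m) y).measurableSet
    rw [← chartVolume_inter_source g y hB, hsum y hB' Set.inter_subset_right, ← hν hB']
    exact measure_mono Set.inter_subset_left
  rw [hsum x hA hx, ← hν hA]
  exact Measure.le_iff'.1 hle A

theorem riemannianVolume_restrict_source :
    (riemannianVolume g).restrict (extChartAt (𝓡 m) x).source = chartVolume g x := by
  ext A hA
  rw [Measure.restrict_apply hA, riemannianVolume_apply g x (hA.inter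
    (isOpen_extChartAt_source x).measurableSet) Set.inter_subset_right, chartVolume_inter_source g x hA]

theorem setIntegral_source {F : M → ℝ} (hF : Continuous F) :
    ∫ y in (extChartAt (𝓡 m) x).source, F y ∂(riemannianVolume g)
      = ∫ u in (extChartAt (𝓡 m) x).target,
        Real.sqrt (chartMetric g x u).det * F ((extChartAt (𝓡 m) x).symm u) := by
  rw [riemannianVolume_restrict_source, chartVolume,
    integral_map (aemeasurable_extChartAt_symm g x) hF.aestronglyMeasurable,
    integral_withDensity_eq_integral_toReal_smul₀ (aemeasurable_volumeDensity g x)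
      (Filter.Eventually.of_forall fun _ => ENNReal.ofReal_lt_top)]
  refine integral_congr_ae (Filter.Eventually.of_forall fun u => ?_)
  simp [ENNReal.toReal_ofReal (Real.sqrt_nonneg _)]

/-- Finiteness is local: the preimage of a small ball in a chart has finite volume because the
density is bounded on the closed ball. -/
theorem riemannianVolume_lt_top_of_isCompact {C : Set M} (hC : IsCompact C) :
    riemannianVolume g C < ⊤ := by
  refine hC.measure_lt_top_of_nhdsWithin fun x _ => ?_
  obtain ⟨r, hr, hrT⟩ := Metric.nhds_basis_closedBall.mem_iff.1
    ((isOpen_extChartAt_target (I := 𝓡 m) x).mem_nhds (mem_extChartAt_target x))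
  set u := extChartAt (𝓡 m) x x
  let V := (extChartAt (𝓡 m) x).source ∩ extChartAt (𝓡 m) x ⁻¹' Metric.ball u r
  have hV : IsOpen V := (continuousOn_extChartAt x).isOpen_inter_preimage
    (isOpen_extChartAt_source x) Metric.isOpen_ball
  refine ⟨V, mem_nhdsWithin_of_mem_nhds (hV.mem_nhds ⟨mem_extChartAt_source x, Metric.mem_ball_self hr⟩), ?_⟩
  rw [riemannianVolume_apply g x hV.measurableSet Set.inter_subset_left,
    chartVolume_apply g x hV.measurableSet]
  have hcpt := isCompact_closedBall u r
  obtain ⟨c, hc⟩ := hcpt.exists_bound_of_continuousOn ((continuousOn_sqrt_det g x).mono hrT)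
  have hsub : chartPart m x V ⊆ Metric.closedBall u r := fun v hv => by
    have := hv.2.2
    rw [Set.mem_preimage, (extChartAt (𝓡 m) x).right_inv hv.1] at this
    exact Metric.ball_subset_closedBall this
  calc _ ≤ ∫⁻ v in Metric.closedBall u r, ENNReal.ofReal (Real.sqrt (chartMetric g x v).det) :=
        lintegral_mono_set hsub
    _ ≤ ∫⁻ _ in Metric.closedBall u r, ENNReal.ofReal c :=
        setLIntegral_mono' hcpt.measurableSet fun v hv =>
          ENNReal.ofReal_le_ofReal ((le_abs_self _).trans (hc v hv))
    _ < ⊤ := by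
        rw [setLIntegral_const]
        exact ENNReal.mul_lt_top ENNReal.ofReal_lt_top hcpt.measure_lt_top

end Volume

/-! ## Regularity and linearity of the Jacobi operator -/

section JacobiOperator

variable {m n : ℕ} {G : Eu m → Matrix (Fin m) (Fin m) ℝ} {K : Eu n → Matrix (Fin n) (Fin n) ℝ}
  {P V W : Eu m → Eu n} {O : Set (Eu m)} {S : Set (Eu n)} {u : Eu m}

theorem nabla_apply_contDiffOn (hG : IsMetricOn G O) (hK : IsMetricOn K S) (hP : ContDiffOn ℝ ∞ P O)
    (hPS : Set.MapsTo P O S) {α : Eu m → Eu m →L[ℝ] Eu n} (hα : ContDiffOn ℝ ∞ α O) (x y : Eu m) :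
    ContDiffOn ℝ ∞ (fun u => nabla G K P α u x y) O := by
  have hO := hG.isOpen
  have h : ContDiffOn ℝ ∞ (fun u => covD K P (fun w => α w y) u x - α u (gamma G u x y)) O :=
    (covD_apply_contDiffOn hK hO hP hPS (hα.clm_apply contDiffOn_const) x).sub
      (hα.clm_apply ((hG.gamma_smooth.clm_apply contDiffOn_const).clm_apply contDiffOn_const))
  exact h.congr fun u hu => nabla_apply (differentiableAt_of_contDiffOn hO hα hu) x y

theorem metricTrace_contDiffOn (hG : IsMetricOn G O) {β : Eu m → Eu m →L[ℝ] Eu m →L[ℝ] Eu n}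
    (hβ : ∀ x y, ContDiffOn ℝ ∞ (fun u => β u x y) O) :
    ContDiffOn ℝ ∞ (fun u => metricTrace (G u) (β u)) O :=
  ContDiffOn.sum fun i _ => ContDiffOn.sum fun j _ => (hG.inv_smooth i j).smul (hβ _ _)

theorem coordTension_contDiffOn (hG : IsMetricOn G O) (hK : IsMetricOn K S)
    (hP : ContDiffOn ℝ ∞ P O) (hPS : Set.MapsTo P O S) : ContDiffOn ℝ ∞ (coordTension G K P) O :=
  metricTrace_contDiffOn hG
    (nabla_apply_contDiffOn hG hK hP hPS (contDiffOn_fderiv hG.isOpen hP))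

theorem curv_contDiffOn (hK : IsMetricOn K S) (hP : ContDiffOn ℝ ∞ P O) (hPS : Set.MapsTo P O S)
    {a b v : Eu m → Eu n} (ha : ContDiffOn ℝ ∞ a O) (hb : ContDiffOn ℝ ∞ b O)
    (hv : ContDiffOn ℝ ∞ v O) : ContDiffOn ℝ ∞ (fun u => curv K (P u) (a u) (b u) (v u)) O := by
  have h1 : ContDiffOn ℝ ∞ (fun u => gamma K (P u)) O := hK.gamma_smooth.comp hP hPS
  have h2 : ContDiffOn ℝ ∞ (fun u => fderiv ℝ (gamma K) (P u)) O :=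
    (contDiffOn_fderiv hK.isOpen hK.gamma_smooth).comp hP hPS
  exact ((((h2.clm_apply ha).clm_apply hb).clm_apply hv).sub
    (((h2.clm_apply hb).clm_apply ha).clm_apply hv)).add
    ((h1.clm_apply ha).clm_apply ((h1.clm_apply hb).clm_apply hv)) |>.sub
    ((h1.clm_apply hb).clm_apply ((h1.clm_apply ha).clm_apply hv))

theorem jacobiOp_contDiffOn (hG : IsMetricOn G O) (hK : IsMetricOn K S) (hP : ContDiffOn ℝ ∞ P O)
    (hPS : Set.MapsTo P O S) (hV : ContDiffOn ℝ ∞ V O) : ContDiffOn ℝ ∞ (jacobiOp G K P V) O := by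
  have hO := hG.isOpen
  have h1 : ContDiffOn ℝ ∞ (roughLaplacian G K P V) O := metricTrace_contDiffOn hG
    (nabla_apply_contDiffOn hG hK hP hPS (covD_contDiffOn hK hO hP hPS hV))
  exact h1.add (ContDiffOn.sum fun i _ => ContDiffOn.sum fun j _ => (hG.inv_smooth i j).smul
    (curv_contDiffOn hK hP hPS hV (contDiffOn_fderiv_apply hO hP _) (contDiffOn_fderiv_apply hO hP _)))

theorem nabla_congr {α α' : Eu m → Eu m →L[ℝ] Eu n} (h : α =ᶠ[nhds u] α') :
    nabla G K P α u = nabla G K P α' u := by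
  rw [nabla, nabla, h.fderiv_eq, h.eq_of_nhds]

/-- The Jacobi operator is local, hence depends only on the germ of the field. -/
theorem jacobiOp_congr (h : V =ᶠ[nhds u] W) : jacobiOp G K P V u = jacobiOp G K P W u := by
  have h1 : covD K P V =ᶠ[nhds u] covD K P W := by
    filter_upwards [h.eventuallyEq_nhds] with w hw using covD_congr Filter.EventuallyEq.rfl hw
  rw [jacobiOp, jacobiOp, roughLaplacian, roughLaplacian, nabla_congr h1, h.eq_of_nhds]

theorem jacobiOp_zero : jacobiOp G K P (fun _ => 0) u = 0 := by
  have h1 : covD K P (fun _ => 0) = fun _ => 0 := by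
    funext w
    ext x
    simp [covD_apply]
  rw [jacobiOp, roughLaplacian, h1]
  have h2 : nabla G K P (fun _ => 0) u = 0 := by
    ext x y
    rw [nabla_apply (differentiableAt_const _), covD_apply]
    simp
  have h3 : ∀ b v : Eu n, curv K (P u) 0 b v = 0 := fun b v => by
    rw [← curvLeft_apply, map_zero]
  rw [h2]
  simp [metricTrace, h3]

theorem jacobiOp_add (hK : IsMetricOn K S) (hO : IsOpen O) (hP : ContDiffOn ℝ ∞ P O)
    (hPS : Set.MapsTo P O S) (hV : ContDiffOn ℝ ∞ V O) (hW : ContDiffOn ℝ ∞ W O) (hu : u ∈ O) :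
    jacobiOp G K P (fun w => V w + W w) u = jacobiOp G K P V u + jacobiOp G K P W u := by
  have h1 : covD K P (fun w => V w + W w) =ᶠ[nhds u] fun w => covD K P V w + covD K P W w := by
    filter_upwards [hO.mem_nhds hu] with w hw
    ext1 x
    exact covD_add K P (differentiableAt_of_contDiffOn hO hV hw)
      (differentiableAt_of_contDiffOn hO hW hw) x
  have d1 := differentiableAt_of_contDiffOn hO (covD_contDiffOn hK hO hP hPS hV) hu
  have d2 := differentiableAt_of_contDiffOn hO (covD_contDiffOn hK hO hP hPS hW) hu
  have h2 : nabla G K P (covD K P fun w => V w + W w) u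
      = nabla G K P (covD K P V) u + nabla G K P (covD K P W) u := by
    rw [nabla_congr h1]
    ext1 x
    ext1 y
    have d3 : DifferentiableAt ℝ (fun w => covD K P V w + covD K P W w) u := d1.add d2
    rw [add_apply, add_apply, nabla_apply d3, nabla_apply d1, nabla_apply d2]
    have := covD_add K P (d1.clm_apply (differentiableAt_const y))
      (d2.clm_apply (differentiableAt_const y)) x
    simp only [add_apply] at this ⊢
    rw [this]
    abel
  have h3 : ∀ a a' b v : Eu n, curv K (P u) (a + a') b v = curv K (P u) a b v + curv K (P u) a' b v :=
    fun a a' b v => by simp only [← curvLeft_apply, map_add]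
  rw [jacobiOp, jacobiOp, jacobiOp, roughLaplacian, roughLaplacian, roughLaplacian, h2, metricTrace_add]
  simp only [h3, smul_add, Finset.sum_add_distrib]
  abel

/-- Needed to split a variation field by a partition of unity. -/
theorem jacobiOp_sum (hK : IsMetricOn K S) (hO : IsOpen O) (hP : ContDiffOn ℝ ∞ P O)
    (hPS : Set.MapsTo P O S) {ι : Type*} (s : Finset ι) {V : ι → Eu m → Eu n}
    (hV : ∀ i, ContDiffOn ℝ ∞ (V i) O) (hu : u ∈ O) :
    jacobiOp G K P (fun w => ∑ i ∈ s, V i w) u = ∑ i ∈ s, jacobiOp G K P (V i) u := by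
  classical
  induction s using Finset.induction_on with
  | empty => simpa using jacobiOp_zero
  | insert i s hi ih =>
    simp only [Finset.sum_insert hi]
    rw [jacobiOp_add hK hO hP hPS (hV i) (ContDiffOn.sum fun j _ => hV j) hu, ih]

/-- The Jacobi operator is symmetric, on fields of which one has compact support. -/
theorem setIntegral_jacobiOp_symm (hG : IsMetricOn G O) (hK : IsMetricOn K S)
    (hP : ContDiffOn ℝ ∞ P O) (hPS : Set.MapsTo P O S) (hV : ContDiffOn ℝ ∞ V O)
    (hW : ContDiffOn ℝ ∞ W O) {C : Set (Eu m)} (hC : IsCompact C) (hCO : C ⊆ O)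
    (h0 : ∀ u ∈ O, u ∉ C → V u = 0) :
    ∫ u in O, Real.sqrt (G u).det * metricForm (K (P u)) (jacobiOp G K P V u) (W u)
      = ∫ u in O, Real.sqrt (G u).det * metricForm (K (P u)) (V u) (jacobiOp G K P W u) := by
  have hO := hG.isOpen
  have hs : ContDiffOn ℝ ∞ (fun u => Real.sqrt (G u).det) O := by
    have hd := ContDiffOn.matrix_det hG.smooth
    exact hd.sqrt fun u hu => (hG.posDef u hu).det_pos.ne'
  have h1 := integrableOn_of_eq_zero_off_compact hO hC hCO (hs.mul (contDiffOn_metricForm hK hP hPS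
    (jacobiOp_contDiffOn hG hK hP hPS hV) hW)) fun u hu huC => by
      have hz : V =ᶠ[nhds u] fun _ => 0 := by
        filter_upwards [(hO.sdiff hC.isClosed).mem_nhds ⟨hu, huC⟩] with w hw using h0 w hw.1 hw.2
      simp [jacobiOp_congr hz, jacobiOp_zero]
  have h2 := integrableOn_of_eq_zero_off_compact hO hC hCO (hs.mul (contDiffOn_metricForm hK hP hPS
    hV (jacobiOp_contDiffOn hG hK hP hPS hW))) fun u hu huC => by simp [h0 u hu huC]
  rw [← sub_eq_zero, ← integral_sub h1 h2, ← setIntegral_jacobiOp_comm hG hK hP hPS hV hW hC hCO h0]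
  simp only [mul_sub]

end JacobiOperator

/-! ## The first variation of the bienergy -/

section Families

variable {m n : ℕ}
  {M : Type*} [TopologicalSpace M] [ChartedSpace (EuclideanSpace ℝ (Fin m)) M]
  [IsManifold (𝓡 m) ∞ M]
  {N : Type*} [TopologicalSpace N] [ChartedSpace (EuclideanSpace ℝ (Fin n)) N]
  [IsManifold (𝓡 n) ∞ N]
  (g : RMetric m M) (h : RMetric n N) {Φ : ℝ → M → N} {φ : M → N} {x : M} {z : N} {u : Eu m} {t : ℝ}

variable (m n) in
/-- The expression of a family of maps in the charts at `x` and `z`. -/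
def familyInCharts (Φ : ℝ → M → N) (x : M) (z : N) (p : ℝ × Eu m) : Eu n :=
  inCharts m n (Φ p.1) x z p.2

variable (m n) in
/-- The domain of the expression of a family of maps in the charts at `x` and `z`. -/
def familyDom (Φ : ℝ → M → N) (x : M) (z : N) : Set (ℝ × Eu m) :=
  {p | p.2 ∈ chartDom m n (Φ p.1) x z}

variable (m n) in
/-- The derivative of a family of maps at time zero, in the charts at `x` and `z`. -/
def variationField (Φ : ℝ → M → N) (x : M) (z : N) (u : Eu m) : Eu n :=
  fderiv ℝ (familyInCharts m n Φ x z) (0, u) (1, 0)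

/-- The energy density of a family of maps, in the charts at `x` and `z`. -/
def familyDensity (Φ : ℝ → M → N) (x : M) (z : N) (p : ℝ × Eu m) : ℝ :=
  metricForm (chartMetric h z (familyInCharts m n Φ x z p))
    (familyTension (chartMetric g x) (chartMetric h z) (familyInCharts m n Φ x z) p)
    (familyTension (chartMetric g x) (chartMetric h z) (familyInCharts m n Φ x z) p)

/-- The time derivative of the energy density of a family of maps. -/
def energyRate (Φ : ℝ → M → N) (p : ℝ × M) : ℝ :=
  deriv (fun s => bienergyDensity g h (Φ s) p.2) p.1

theorem contMDiff_of_family (hΦ : ContMDiff (𝓘(ℝ, ℝ).prod (𝓡 m)) (𝓡 n) ∞ (Function.uncurry Φ))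
    (t : ℝ) : ContMDiff (𝓡 m) (𝓡 n) ∞ (Φ t) :=
  hΦ.comp (contMDiff_const.prodMk contMDiff_id)

theorem contMDiffOn_family_symm
    (hΦ : ContMDiff (𝓘(ℝ, ℝ).prod (𝓡 m)) (𝓡 n) ∞ (Function.uncurry Φ)) (x : M) :
    ContMDiffOn 𝓘(ℝ, ℝ × Eu m) (𝓡 n) ∞ (fun p : ℝ × Eu m => Φ p.1 ((extChartAt (𝓡 m) x).symm p.2))
      (Set.univ ×ˢ (extChartAt (𝓡 m) x).target) := by
  have h1 : ContMDiffOn 𝓘(ℝ, Eu m) (𝓡 m) ∞ (extChartAt (𝓡 m) x).symm (extChartAt (𝓡 m) x).target :=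
    contMDiffOn_extChartAt_symm x
  have h2 : ContMDiff 𝓘(ℝ, ℝ × Eu m) 𝓘(ℝ, ℝ) ∞ (Prod.fst : ℝ × Eu m → ℝ) := contDiff_fst.contMDiff
  have h3 : ContMDiff 𝓘(ℝ, ℝ × Eu m) 𝓘(ℝ, Eu m) ∞ (Prod.snd : ℝ × Eu m → Eu m) :=
    contDiff_snd.contMDiff
  exact hΦ.comp_contMDiffOn (h2.contMDiffOn.prodMk (h1.comp h3.contMDiffOn fun p hp => hp.2))

theorem familyDom_eq (Φ : ℝ → M → N) (x : M) (z : N) : familyDom m n Φ x z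
    = (Set.univ ×ˢ (extChartAt (𝓡 m) x).target) ∩
      (fun p : ℝ × Eu m => Φ p.1 ((extChartAt (𝓡 m) x).symm p.2)) ⁻¹' (extChartAt (𝓡 n) z).source := by
  ext p
  exact ⟨fun hp => ⟨⟨trivial, hp.1⟩, hp.2.2⟩,
    fun hp => ⟨hp.1.2, (extChartAt (𝓡 m) x).map_target hp.1.2, hp.2⟩⟩

theorem isOpen_familyDom (hΦ : ContMDiff (𝓘(ℝ, ℝ).prod (𝓡 m)) (𝓡 n) ∞ (Function.uncurry Φ))
    (x : M) (z : N) : IsOpen (familyDom m n Φ x z) := by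
  rw [familyDom_eq]
  exact (contMDiffOn_family_symm hΦ x).continuousOn.isOpen_inter_preimage
    (isOpen_univ.prod (isOpen_extChartAt_target x)) (isOpen_extChartAt_source z)

theorem familyInCharts_contDiffOn
    (hΦ : ContMDiff (𝓘(ℝ, ℝ).prod (𝓡 m)) (𝓡 n) ∞ (Function.uncurry Φ)) (x : M) (z : N) :
    ContDiffOn ℝ ∞ (familyInCharts m n Φ x z) (familyDom m n Φ x z) := by
  rw [← contMDiffOn_iff_contDiffOn]
  have h3 : ContMDiffOn (𝓡 n) 𝓘(ℝ, Eu n) ∞ (extChartAt (𝓡 n) z) (extChartAt (𝓡 n) z).source := by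
    rw [extChartAt_source]; exact contMDiffOn_extChartAt
  refine h3.comp ((contMDiffOn_family_symm hΦ x).mono ?_) fun p hp => hp.2.2
  rw [familyDom_eq]
  exact Set.inter_subset_left

theorem familyDom_snd_mem (p : ℝ × Eu m) (hp : p ∈ familyDom m n Φ x z) :
    p.2 ∈ (extChartAt (𝓡 m) x).target := hp.1

theorem familyInCharts_mapsTo (Φ : ℝ → M → N) (x : M) (z : N) :
    Set.MapsTo (familyInCharts m n Φ x z) (familyDom m n Φ x z) (extChartAt (𝓡 n) z).target :=
  fun p hp => inCharts_mapsTo (Φ p.1) x z hp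

theorem familyDensity_contDiffOn
    (hΦ : ContMDiff (𝓘(ℝ, ℝ).prod (𝓡 m)) (𝓡 n) ∞ (Function.uncurry Φ)) (x : M) (z : N) :
    ContDiffOn ℝ ∞ (familyDensity g h Φ x z) (familyDom m n Φ x z) := by
  have hT := familyTension_contDiffOn (isMetricOn_chartMetric g x) (isMetricOn_chartMetric h z)
    (isOpen_familyDom hΦ x z) (familyInCharts_contDiffOn hΦ x z) familyDom_snd_mem
    (familyInCharts_mapsTo Φ x z)
  exact contDiffOn_metricForm (isMetricOn_chartMetric h z) (familyInCharts_contDiffOn hΦ x z)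
    (familyInCharts_mapsTo Φ x z) hT hT

theorem bienergyDensity_family
    (hΦ : ContMDiff (𝓘(ℝ, ℝ).prod (𝓡 m)) (𝓡 n) ∞ (Function.uncurry Φ))
    (hp : (t, u) ∈ familyDom m n Φ x z) :
    bienergyDensity g h (Φ t) ((extChartAt (𝓡 m) x).symm u) = familyDensity g h Φ x z (t, u) := by
  rw [bienergyDensity_eq g h (contMDiff_of_family hΦ t) hp]
  have := coordTension_family (G := chartMetric g x) (K := chartMetric h z) (isOpen_familyDom hΦ x z)
    (familyInCharts_contDiffOn hΦ x z) hp
  rw [familyDensity, ← this]; rfl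

theorem hasDerivAt_comp_fst {Z : Type*} [NormedAddCommGroup Z] [NormedSpace ℝ Z]
    {F : ℝ × Eu m → Z} (hF : DifferentiableAt ℝ F (t, u)) :
    HasDerivAt (fun s => F (s, u)) (fderiv ℝ F (t, u) (1, 0)) t :=
  hF.hasFDerivAt.comp_hasDerivAt t ((hasDerivAt_id t).prodMk (hasDerivAt_const t u))

theorem hasDerivAt_bienergyDensity
    (hΦ : ContMDiff (𝓘(ℝ, ℝ).prod (𝓡 m)) (𝓡 n) ∞ (Function.uncurry Φ))
    (hp : (t, u) ∈ familyDom m n Φ x z) :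
    HasDerivAt (fun s => bienergyDensity g h (Φ s) ((extChartAt (𝓡 m) x).symm u))
      (fderiv ℝ (familyDensity g h Φ x z) (t, u) (1, 0)) t := by
  have hO := isOpen_familyDom hΦ x z
  refine (hasDerivAt_comp_fst (differentiableAt_of_contDiffOn hO
    (familyDensity_contDiffOn g h hΦ x z) hp)).congr_of_eventuallyEq ?_
  have hc : Continuous fun s : ℝ => (s, u) := by fun_prop
  filter_upwards [(hO.preimage hc).mem_nhds hp] with s hs using bienergyDensity_family g h hΦ hs

theorem energyRate_eq (hΦ : ContMDiff (𝓘(ℝ, ℝ).prod (𝓡 m)) (𝓡 n) ∞ (Function.uncurry Φ))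
    (hp : (t, u) ∈ familyDom m n Φ x z) : energyRate g h Φ (t, (extChartAt (𝓡 m) x).symm u)
      = fderiv ℝ (familyDensity g h Φ x z) (t, u) (1, 0) :=
  (hasDerivAt_bienergyDensity g h hΦ hp).deriv

/-- Near `(t, y)` the charts at `y` and at `Φ t y` express `F` through a continuous function of time
and coordinates. This gives joint continuity of densities defined through preferred charts. -/
theorem continuous_of_familyDom
    (hΦ : ContMDiff (𝓘(ℝ, ℝ).prod (𝓡 m)) (𝓡 n) ∞ (Function.uncurry Φ)) {F : ℝ × M → ℝ}
    {E : M → N → ℝ × Eu m → ℝ} (hE : ∀ x z, ContinuousOn (E x z) (familyDom m n Φ x z))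
    (hFE : ∀ x z t u, (t, u) ∈ familyDom m n Φ x z →
      F (t, (extChartAt (𝓡 m) x).symm u) = E x z (t, u)) : Continuous F := by
  rw [continuous_iff_continuousAt]
  rintro ⟨t, y⟩
  set z := Φ t y
  have hO := isOpen_familyDom hΦ y z
  have hp : (t, extChartAt (𝓡 m) y y) ∈ familyDom m n Φ y z :=
    extChartAt_mem_chartDom (mem_chartSrc_self (Φ t) y)
  have hc : ContinuousAt (fun p : ℝ × M => (p.1, extChartAt (𝓡 m) y p.2)) (t, y) :=
    continuousAt_fst.prodMk ((continuousAt_extChartAt y).comp_of_eq continuousAt_snd rfl)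
  have h1 : ContinuousAt (fun p : ℝ × M => E y z (p.1, extChartAt (𝓡 m) y p.2)) (t, y) :=
    ((hE y z).continuousAt (hO.mem_nhds hp)).comp_of_eq hc rfl
  refine h1.congr_of_eventuallyEq ?_
  have hs : ∀ᶠ p : ℝ × M in nhds (t, y), p.2 ∈ (extChartAt (𝓡 m) y).source :=
    continuousAt_snd.eventually (extChartAt_source_mem_nhds y)
  filter_upwards [hs, hc.eventually (hO.mem_nhds hp)] with p hp1 hp2
  rw [← hFE y z _ _ hp2, (extChartAt (𝓡 m) y).left_inv hp1]

theorem continuous_energyRate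
    (hΦ : ContMDiff (𝓘(ℝ, ℝ).prod (𝓡 m)) (𝓡 n) ∞ (Function.uncurry Φ)) :
    Continuous (energyRate g h Φ) :=
  continuous_of_familyDom hΦ (fun x z => (contDiffOn_fderiv_apply (isOpen_familyDom hΦ x z)
    (familyDensity_contDiffOn g h hΦ x z) (1, 0)).continuousOn)
    fun _ _ _ _ hp => energyRate_eq g h hΦ hp

theorem continuous_bienergyDensity
    (hΦ : ContMDiff (𝓘(ℝ, ℝ).prod (𝓡 m)) (𝓡 n) ∞ (Function.uncurry Φ)) :
    Continuous fun p : ℝ × M => bienergyDensity g h (Φ p.1) p.2 :=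
  continuous_of_familyDom hΦ (fun x z => (familyDensity_contDiffOn g h hΦ x z).continuousOn)
    fun _ _ _ _ hp => bienergyDensity_family g h hΦ hp

theorem hasDerivAt_bienergyDensity_energyRate
    (hΦ : ContMDiff (𝓘(ℝ, ℝ).prod (𝓡 m)) (𝓡 n) ∞ (Function.uncurry Φ)) (t : ℝ) (y : M) :
    HasDerivAt (fun s => bienergyDensity g h (Φ s) y) (energyRate g h Φ (t, y)) t := by
  have hp : (t, extChartAt (𝓡 m) y y) ∈ familyDom m n Φ y (Φ t y) :=
    extChartAt_mem_chartDom (mem_chartSrc_self (Φ t) y)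
  have h1 := hasDerivAt_bienergyDensity g h hΦ hp
  rw [← energyRate_eq g h hΦ hp, extChartAt_to_inv] at h1
  exact h1

theorem variationField_contDiffOn
    (hΦ : ContMDiff (𝓘(ℝ, ℝ).prod (𝓡 m)) (𝓡 n) ∞ (Function.uncurry Φ)) (hΦ0 : Φ 0 = φ)
    (x : M) (z : N) : ContDiffOn ℝ ∞ (variationField m n Φ x z) (chartDom m n φ x z) := by
  subst hΦ0
  exact contDiffOn_slice (contDiffOn_fderiv_apply (isOpen_familyDom hΦ x z)
    (familyInCharts_contDiffOn hΦ x z) (1, 0)) 0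

theorem hasDerivAt_familyInCharts
    (hΦ : ContMDiff (𝓘(ℝ, ℝ).prod (𝓡 m)) (𝓡 n) ∞ (Function.uncurry Φ)) (hΦ0 : Φ 0 = φ)
    (hu : u ∈ chartDom m n φ x z) :
    HasDerivAt (fun t => familyInCharts m n Φ x z (t, u)) (variationField m n Φ x z u) 0 := by
  subst hΦ0
  exact hasDerivAt_comp_fst (differentiableAt_of_contDiffOn (isOpen_familyDom hΦ x z)
    (familyInCharts_contDiffOn hΦ x z) hu)

theorem variationField_eq_zero
    (hΦ : ContMDiff (𝓘(ℝ, ℝ).prod (𝓡 m)) (𝓡 n) ∞ (Function.uncurry Φ)) (hΦ0 : Φ 0 = φ)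
    (hu : u ∈ chartDom m n φ x z)
    (h0 : ∀ t, Φ t ((extChartAt (𝓡 m) x).symm u) = φ ((extChartAt (𝓡 m) x).symm u)) :
    variationField m n Φ x z u = 0 := by
  have h1 : (fun t => familyInCharts m n Φ x z (t, u)) = fun _ => inCharts m n φ x z u := by
    funext t
    rw [familyInCharts, inCharts, h0]; rfl
  have h2 := hasDerivAt_familyInCharts hΦ hΦ0 hu
  rw [h1] at h2
  exact h2.unique (hasDerivAt_const _ _)

/-- At time zero the family enters only through its variation field, and linearly; this is what
makes localization by a partition of unity possible. -/
theorem energyRate_zero_eq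
    (hΦ : ContMDiff (𝓘(ℝ, ℝ).prod (𝓡 m)) (𝓡 n) ∞ (Function.uncurry Φ)) (hΦ0 : Φ 0 = φ)
    (hu : u ∈ chartDom m n φ x z) : energyRate g h Φ (0, (extChartAt (𝓡 m) x).symm u)
      = 2 * metricForm (chartMetric h z (inCharts m n φ x z u))
        (jacobiOp (chartMetric g x) (chartMetric h z) (inCharts m n φ x z) (variationField m n Φ x z) u)
        (coordTension (chartMetric g x) (chartMetric h z) (inCharts m n φ x z) u) := by
  subst hΦ0
  rw [energyRate_eq g h hΦ hu]
  exact fderiv_normSq_familyTension (isMetricOn_chartMetric g x) (isMetricOn_chartMetric h z)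
    (isOpen_familyDom hΦ x z) (familyInCharts_contDiffOn hΦ x z) familyDom_snd_mem
    (familyInCharts_mapsTo Φ x z) hu

/-- The compact set `C` is closed, so the variation field vanishes on a whole neighbourhood of `y`,
and with it its image under the local operator `J`. -/
theorem energyRate_eq_zero [T2Space M]
    (hΦ : ContMDiff (𝓘(ℝ, ℝ).prod (𝓡 m)) (𝓡 n) ∞ (Function.uncurry Φ)) (hΦ0 : Φ 0 = φ)
    {C : Set M} (hC : IsCompact C) (h0 : ∀ t, ∀ y ∉ C, Φ t y = φ y) {y : M} (hy : y ∉ C) :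
    energyRate g h Φ (0, y) = 0 := by
  have hφ : ContMDiff (𝓡 m) (𝓡 n) ∞ φ := hΦ0 ▸ contMDiff_of_family hΦ 0
  have hu := extChartAt_mem_chartDom (mem_chartSrc_self (m := m) (n := n) φ y)
  have e : variationField m n Φ y (φ y) =ᶠ[nhds (extChartAt (𝓡 m) y y)] fun _ => (0 : Eu n) := by
    have hO := isOpen_chartPart (m := m)
      ((isOpen_chartSrc (m := m) (n := n) hφ.continuous y (φ y)).sdiff hC.isClosed) y
    filter_upwards [hO.mem_nhds (extChartAt_mem_chartPart ⟨mem_chartSrc_self φ y, hy⟩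
      (mem_extChartAt_source y))] with w hw
    exact variationField_eq_zero hΦ hΦ0 ⟨hw.1, hw.2.1⟩ fun t => h0 t _ hw.2.2
  have h1 := energyRate_zero_eq g h hΦ hΦ0 hu
  rw [extChartAt_to_inv, jacobiOp_congr e, jacobiOp_zero] at h1
  simpa using h1

/-- The Euler-Lagrange operator of the `f`-bienergy, in the charts at `x` and `z`. -/
def eulerLagrange (f : M → ℝ) (φ : M → N) (x : M) (z : N) : Eu m → Eu n :=
  jacobiOp (chartMetric g x) (chartMetric h z) (inCharts m n φ x z) fun u =>
    f ((extChartAt (𝓡 m) x).symm u) •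
      coordTension (chartMetric g x) (chartMetric h z) (inCharts m n φ x z) u

theorem contDiffOn_inChart {f : M → ℝ} (hf : ContMDiff (𝓡 m) 𝓘(ℝ, ℝ) ∞ f) (x : M) :
    ContDiffOn ℝ ∞ (fun u => f ((extChartAt (𝓡 m) x).symm u)) (extChartAt (𝓡 m) x).target := by
  rw [← contMDiffOn_iff_contDiffOn]
  exact hf.comp_contMDiffOn (contMDiffOn_extChartAt_symm x)

/-! ### Differentiation of the bienergy and the integrated first variation -/

section Integration

variable [MeasurableSpace M] [BorelSpace M] [SecondCountableTopology M] [T2Space M]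

/-- Differentiation under the integral: `energyRate` is jointly continuous, hence bounded by a
constant on `[-1, 1] × Ω`, and `Ω` has finite volume. -/
theorem hasDerivAt_fBienergy (hΦ : ContMDiff (𝓘(ℝ, ℝ).prod (𝓡 m)) (𝓡 n) ∞ (Function.uncurry Φ))
    {f : M → ℝ} (hf : Continuous f) {Ω : Set M} (hΩ : IsCompact Ω) :
    HasDerivAt (fun t => fBienergy g h f Ω (Φ t))
      ((1 / 2) * ∫ y in Ω, f y * energyRate g h Φ (0, y) ∂(riemannianVolume g)) 0 := by
  have hfin : IsFiniteMeasureOnCompacts (riemannianVolume g) :=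
    ⟨fun _ hC => riemannianVolume_lt_top_of_isCompact g hC⟩
  have hF : ∀ t, Continuous fun y => f y * bienergyDensity g h (Φ t) y := fun t =>
    hf.mul ((continuous_bienergyDensity g h hΦ).comp (Continuous.prodMk_right t))
  have hF' : Continuous fun p : ℝ × M => f p.2 * energyRate g h Φ p :=
    (hf.comp continuous_snd).mul (continuous_energyRate g h hΦ)
  obtain ⟨c, hc⟩ := ((isCompact_Icc (a := (-1 : ℝ)) (b := 1)).prod hΩ).exists_bound_of_continuousOn
    hF'.continuousOn
  have h1 := hasDerivAt_integral_of_dominated_loc_of_deriv_le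
    (μ := (riemannianVolume g).restrict Ω) (x₀ := (0 : ℝ)) (s := Set.Icc (-1) 1)
    (F := fun t y => f y * bienergyDensity g h (Φ t) y)
    (F' := fun t y => f y * energyRate g h Φ (t, y)) (bound := fun _ => c)
    (Icc_mem_nhds (by norm_num) (by norm_num))
    (Filter.Eventually.of_forall fun t => (hF t).aestronglyMeasurable)
    ((hF 0).continuousOn.integrableOn_compact hΩ)
    (hF'.comp (Continuous.prodMk_right 0)).aestronglyMeasurable
    (ae_restrict_of_forall_mem hΩ.measurableSet fun y hy t ht => hc (t, y) ⟨ht, hy⟩)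
    (continuousOn_const.integrableOn_compact hΩ)
    (Filter.Eventually.of_forall fun y t _ =>
      (hasDerivAt_bienergyDensity_energyRate g h hΦ t y).const_mul (f y))
  exact h1.2.const_mul (1 / 2)

/-- The first variation formula, for variations supported in the domain of charts. -/
theorem setIntegral_energyRate
    (hΦ : ContMDiff (𝓘(ℝ, ℝ).prod (𝓡 m)) (𝓡 n) ∞ (Function.uncurry Φ)) (hΦ0 : Φ 0 = φ)
    {f : M → ℝ} (hf : ContMDiff (𝓡 m) 𝓘(ℝ, ℝ) ∞ f) {C : Set M} (hC : IsCompact C)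
    (hCs : C ⊆ chartSrc m n φ x z) (h0 : ∀ t, ∀ y ∉ C, Φ t y = φ y) {Ω : Set M}
    (hCΩ : C ⊆ Ω) :
    (1 / 2) * ∫ y in Ω, f y * energyRate g h Φ (0, y) ∂(riemannianVolume g)
      = ∫ u in chartDom m n φ x z, Real.sqrt (chartMetric g x u).det *
        metricForm (chartMetric h z (inCharts m n φ x z u)) (variationField m n Φ x z u)
          (eulerLagrange g h f φ x z u) := by
  have hφ : ContMDiff (𝓡 m) (𝓡 n) ∞ φ := hΦ0 ▸ contMDiff_of_family hΦ 0
  have hF : Continuous fun y => f y * energyRate g h Φ (0, y) :=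
    hf.continuous.mul ((continuous_energyRate g h hΦ).comp (Continuous.prodMk_right 0))
  have hz : ∀ y ∉ C, f y * energyRate g h Φ (0, y) = 0 := fun y hy => by
    rw [energyRate_eq_zero g h hΦ hΦ0 hC h0 hy, mul_zero]
  have hO := isOpen_chartDom (m := m) (n := n) hφ.continuous x z
  have hG := (isMetricOn_chartMetric g x).mono hO fun _ hu => hu.1
  have hK := isMetricOn_chartMetric h z
  have hP := inCharts_contDiffOn hφ x z
  have hPS := inCharts_mapsTo (m := m) (n := n) φ x z
  have hτ := coordTension_contDiffOn hG hK hP hPS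
  have hW : ContDiffOn ℝ ∞ (fun u => f ((extChartAt (𝓡 m) x).symm u) •
      coordTension (chartMetric g x) (chartMetric h z) (inCharts m n φ x z) u)
      (chartDom m n φ x z) := ((contDiffOn_inChart hf x).mono fun _ hu => hu.1).smul hτ
  have hC' : IsCompact (extChartAt (𝓡 m) x '' C) :=
    hC.image_of_continuousOn ((continuousOn_extChartAt x).mono fun y hy => (hCs hy).1)
  have hCO : extChartAt (𝓡 m) x '' C ⊆ chartDom m n φ x z := by
    rintro _ ⟨y, hy, rfl⟩
    exact extChartAt_mem_chartDom (hCs hy)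
  have hnot : ∀ u ∈ (extChartAt (𝓡 m) x).target, u ∉ extChartAt (𝓡 m) x '' C →
      (extChartAt (𝓡 m) x).symm u ∉ C := fun u hu huC hmem =>
    huC ⟨_, hmem, (extChartAt (𝓡 m) x).right_inv hu⟩
  -- Self-adjointness moves `J` from the variation field, which is supported in the image of `C`, to
  -- the field `f τ`.
  have e := setIntegral_jacobiOp_symm hG hK hP hPS (variationField_contDiffOn hΦ hΦ0 x z) hW hC' hCO
    fun u hu huC => variationField_eq_zero hΦ hΦ0 hu fun t => h0 t _ (hnot u hu.1 huC)
  have h1 := setIntegral_eq_of_subset_of_forall_sdiff_eq_zero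
    (μ := volume) (f := fun u => Real.sqrt (chartMetric g x u).det *
      (f ((extChartAt (𝓡 m) x).symm u) * energyRate g h Φ (0, (extChartAt (𝓡 m) x).symm u)))
    (isOpen_extChartAt_target (I := 𝓡 m) x).measurableSet
    (fun u (hu : u ∈ chartDom m n φ x z) => hu.1) fun u hu => by
      rw [hz _ (hnot u hu.1 fun hmem => hu.2 (hCO hmem)), mul_zero]
  -- The integrand vanishes off `C`, so the domain of integration may pass from `Ω` to the chart
  -- source at `x` and, in coordinates, from the chart target to the smaller `chartDom`.
  rw [eulerLagrange, ← e, setIntegral_eq_integral_of_forall_compl_eq_zero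
    fun y hy => hz y fun hyC => hy (hCΩ hyC), ← setIntegral_eq_integral_of_forall_compl_eq_zero
    (s := (extChartAt (𝓡 m) x).source) fun y hy => hz y fun hyC => hy (hCs hyC).1,
    setIntegral_source g x hF, h1, ← integral_const_mul]
  refine setIntegral_congr_fun hO.measurableSet fun u hu => ?_
  simp only [energyRate_zero_eq g h hΦ hΦ0 hu, map_smul, smul_eq_mul]
  ring

end Integration

end Families

/-! ## The Euler-Lagrange equation -/

section CriticalPoints

variable {m n : ℕ}
  {M : Type*} [TopologicalSpace M] [ChartedSpace (EuclideanSpace ℝ (Fin m)) M]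
  [IsManifold (𝓡 m) ∞ M]
  {N : Type*} [TopologicalSpace N] [ChartedSpace (EuclideanSpace ℝ (Fin n)) N]
  [IsManifold (𝓡 n) ∞ N]
  {g : RMetric m M} {h : RMetric n N} {f : M → ℝ} {φ : M → N} {x : M} {z : N} {u : Eu m}

theorem weightedTension_contDiffOn (hφ : ContMDiff (𝓡 m) (𝓡 n) ∞ φ)
    (hf : ContMDiff (𝓡 m) 𝓘(ℝ, ℝ) ∞ f) (x : M) (z : N) :
    ContDiffOn ℝ ∞ (fun u => f ((extChartAt (𝓡 m) x).symm u) •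
      coordTension (chartMetric g x) (chartMetric h z) (inCharts m n φ x z) u)
      (chartDom m n φ x z) := by
  have hO := isOpen_chartDom (m := m) (n := n) hφ.continuous x z
  have hG := (isMetricOn_chartMetric g x).mono hO fun _ hu => hu.1
  exact ((contDiffOn_inChart hf x).mono fun _ hu => hu.1).smul (coordTension_contDiffOn hG
    (isMetricOn_chartMetric h z) (inCharts_contDiffOn hφ x z) (inCharts_mapsTo φ x z))

theorem eulerLagrange_contDiffOn (hφ : ContMDiff (𝓡 m) (𝓡 n) ∞ φ)
    (hf : ContMDiff (𝓡 m) 𝓘(ℝ, ℝ) ∞ f) (x : M) (z : N) :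
    ContDiffOn ℝ ∞ (eulerLagrange g h f φ x z) (chartDom m n φ x z) := by
  have hO := isOpen_chartDom (m := m) (n := n) hφ.continuous x z
  have hG := (isMetricOn_chartMetric g x).mono hO fun _ hu => hu.1
  exact jacobiOp_contDiffOn hG (isMetricOn_chartMetric h z) (inCharts_contDiffOn hφ x z)
    (inCharts_mapsTo φ x z) (weightedTension_contDiffOn hφ hf x z)

/-- The Euler-Lagrange equation does not depend on the charts. -/
theorem eulerLagrange_eq_zero_of_center (hφ : ContMDiff (𝓡 m) (𝓡 n) ∞ φ)
    (hf : ContMDiff (𝓡 m) 𝓘(ℝ, ℝ) ∞ f)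
    (H : ∀ y, eulerLagrange g h f φ y (φ y) (extChartAt (𝓡 m) y y) = 0)
    (hu : u ∈ chartDom m n φ x z) : eulerLagrange g h f φ x z u = 0 := by
  set y := (extChartAt (𝓡 m) x).symm u with hy
  have hc := isChartChange g h hφ x y z (φ y)
  have hu' : u ∈ chartPart m x (chartSrc m n φ x z ∩ chartSrc m n φ y (φ y)) :=
    ⟨hu.1, hu.2, mem_chartSrc_self φ y⟩
  -- The fields `f τ` in the two pairs of charts correspond under the transition, hence so do their
  -- images under `J`. The derivative of the transition is injective, so vanishing at the centre of
  -- the preferred charts carries over.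
  have e := hc.jacobiOp_map
    ((weightedTension_contDiffOn (g := g) (h := h) hφ hf x z).mono fun w hw => ⟨hw.1, hw.2.1⟩)
    (weightedTension_contDiffOn (g := g) (h := h) hφ hf y (φ y)) (fun w hw => ?_) hu'
  · refine hc.codomain.injective (hc.mapsTo hu') ?_
    rw [map_zero, ← H y]
    exact e.symm
  · rw [hc.coordTension_map hw, map_smul]
    congr 2
    exact (extChartAt (𝓡 m) y).left_inv hw.2.2.1

/-! ### Localization of variations by a partition of unity -/

section Sufficiency

/-- Variations with values in a manifold cannot be multiplied by functions. Slowing down time by the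
factor `ρ y` has the same effect to first order: the variation field is multiplied by `ρ`. -/
theorem contMDiff_rescaled_family {Φ : ℝ → M → N}
    (hΦ : ContMDiff (𝓘(ℝ, ℝ).prod (𝓡 m)) (𝓡 n) ∞ (Function.uncurry Φ)) {ρ : M → ℝ}
    (hρ : ContMDiff (𝓡 m) 𝓘(ℝ, ℝ) ∞ ρ) :
    ContMDiff (𝓘(ℝ, ℝ).prod (𝓡 m)) (𝓡 n) ∞ (Function.uncurry fun t y => Φ (t * ρ y) y) := by
  have h1 : ContMDiff (𝓘(ℝ, ℝ).prod (𝓡 m)) 𝓘(ℝ, ℝ) ∞ fun p : ℝ × M => p.1 * ρ p.2 :=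
    contMDiff_fst.mul (hρ.comp contMDiff_snd)
  exact hΦ.comp (h1.prodMk contMDiff_snd)

theorem variationField_rescaled {Φ : ℝ → M → N}
    (hΦ : ContMDiff (𝓘(ℝ, ℝ).prod (𝓡 m)) (𝓡 n) ∞ (Function.uncurry Φ)) (hΦ0 : Φ 0 = φ) {ρ : M → ℝ}
    (hρ : ContMDiff (𝓡 m) 𝓘(ℝ, ℝ) ∞ ρ) (hu : u ∈ chartDom m n φ x z) :
    variationField m n (fun t y => Φ (t * ρ y) y) x z u
      = ρ ((extChartAt (𝓡 m) x).symm u) • variationField m n Φ x z u := by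
  have h1 := hasDerivAt_familyInCharts (contMDiff_rescaled_family hΦ hρ) (φ := φ)
    (by funext y; simp [hΦ0]) hu
  have h2 : HasDerivAt (fun t : ℝ => t * ρ ((extChartAt (𝓡 m) x).symm u))
      (ρ ((extChartAt (𝓡 m) x).symm u)) 0 := by
    simpa using (hasDerivAt_id (0 : ℝ)).mul_const (ρ ((extChartAt (𝓡 m) x).symm u))
  have h3 := HasDerivAt.scomp_of_eq (0 : ℝ) (hasDerivAt_familyInCharts hΦ hΦ0 hu) h2 (by simp)
  exact h1.unique h3

variable [MeasurableSpace M] [BorelSpace M] [SecondCountableTopology M] [T2Space M]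

/-- The variation field is cut into pieces `ρ_i V` supported in charts, each realized by a rescaled
variation. The rate is linear in the field, so it is the sum of the rates of the pieces, and each
integrates to zero by the first variation formula in its chart. -/
theorem isFBiharmonic_of_eulerLagrange (hφ : ContMDiff (𝓡 m) (𝓡 n) ∞ φ)
    (hf : ContMDiff (𝓡 m) 𝓘(ℝ, ℝ) ∞ f)
    (H : ∀ y, eulerLagrange g h f φ y (φ y) (extChartAt (𝓡 m) y y) = 0) :
    IsFBiharmonic g h f φ := by
  intro Ω hΩ Φ hΦ hΦ0 hΦΩ
  have hfin : IsFiniteMeasureOnCompacts (riemannianVolume g) :=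
    ⟨fun _ hC => riemannianVolume_lt_top_of_isCompact g hC⟩
  have : LocallyCompactSpace M := ChartedSpace.locallyCompactSpace (EuclideanSpace ℝ (Fin m)) M
  have hmain := hasDerivAt_fBienergy g h hΦ hf.continuous hΩ
  refine hmain.congr_deriv ?_
  obtain ⟨ρ, hρ⟩ := SmoothPartitionOfUnity.exists_isSubordinate (𝓡 m) hΩ.isClosed
    (fun x => chartSrc m n φ x (φ x)) (fun x => isOpen_chartSrc hφ.continuous x (φ x))
    fun y _ => Set.mem_iUnion.2 ⟨y, mem_chartSrc_self φ y⟩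
  have hρs : ∀ i, ContMDiff (𝓡 m) 𝓘(ℝ, ℝ) ∞ (ρ i) := fun i => (ρ i).contMDiff
  have hF := ρ.locallyFinite.finite_nonempty_inter_compact hΩ
  set F := hF.toFinset with hFdef
  have hsum : ∀ y ∈ Ω, ∑ i ∈ F, ρ i y = 1 := by
    intro y hy
    rw [← ρ.sum_eq_one hy]
    refine (finsum_eq_sum_of_support_subset _ fun i hi => ?_).symm
    rw [hFdef, Set.Finite.coe_toFinset]
    exact ⟨y, hi, hy⟩
  let Ψ : M → ℝ → M → N := fun i t y => Φ (t * ρ i y) y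
  have hΨ : ∀ i, ContMDiff (𝓘(ℝ, ℝ).prod (𝓡 m)) (𝓡 n) ∞ (Function.uncurry (Ψ i)) :=
    fun i => contMDiff_rescaled_family hΦ (hρs i)
  have hΨ0 : ∀ i, Ψ i 0 = φ := fun i => by funext y; simp [Ψ, hΦ0]
  have hrate : ∀ y ∈ Ω, energyRate g h Φ (0, y) = ∑ i ∈ F, energyRate g h (Ψ i) (0, y) := by
    intro y hy
    have hu := extChartAt_mem_chartDom (mem_chartSrc_self (m := m) (n := n) φ y)
    have hO := isOpen_chartDom (m := m) (n := n) hφ.continuous y (φ y)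
    have e0 := energyRate_zero_eq g h hΦ hΦ0 hu
    have ei := fun i => energyRate_zero_eq g h (hΨ i) (hΨ0 i) hu
    rw [extChartAt_to_inv] at e0
    simp only [extChartAt_to_inv] at ei
    -- The weights sum to `1` on `Ω` only, but off `Ω` the variation is fixed and both sides vanish.
    -- So the identity holds on a full neighbourhood even at boundary points of `Ω`, as the second
    -- order operator `J` requires.
    have hV : variationField m n Φ y (φ y) =ᶠ[nhds (extChartAt (𝓡 m) y y)]
        fun w => ∑ i ∈ F, variationField m n (Ψ i) y (φ y) w := by
      filter_upwards [hO.mem_nhds hu] with w hw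
      simp only [Ψ, variationField_rescaled hΦ hΦ0 (hρs _) hw, ← Finset.sum_smul]
      by_cases hwΩ : (extChartAt (𝓡 m) y).symm w ∈ Ω
      · rw [hsum _ hwΩ, one_smul]
      · rw [variationField_eq_zero hΦ hΦ0 hw fun t => hΦΩ t _ hwΩ, smul_zero]
    rw [e0, jacobiOp_congr hV, jacobiOp_sum (isMetricOn_chartMetric h (φ y)) hO
      (inCharts_contDiffOn hφ y (φ y)) (inCharts_mapsTo φ y (φ y)) F
      (fun i => variationField_contDiffOn (hΨ i) (hΨ0 i) y (φ y)) hu]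
    simp only [ei, map_sum, sum_apply, Finset.mul_sum]
  have hint : ∫ y in Ω, f y * energyRate g h Φ (0, y) ∂(riemannianVolume g)
      = ∑ i ∈ F, ∫ y in Ω, f y * energyRate g h (Ψ i) (0, y) ∂(riemannianVolume g) := by
    rw [← integral_finsetSum]
    · refine setIntegral_congr_fun hΩ.measurableSet fun y hy => ?_
      simp only [hrate y hy, Finset.mul_sum]
    · intro i _
      exact (hf.continuous.mul ((continuous_energyRate g h (hΨ i)).comp
        (Continuous.prodMk_right 0))).continuousOn.integrableOn_compact hΩ
  rw [hint, Finset.mul_sum]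
  refine Finset.sum_eq_zero fun i _ => ?_
  -- The variation with index `i` is fixed outside `Ω ∩ tsupport (ρ i)`, a compact subset of the
  -- chart domain at `i`.
  rw [setIntegral_energyRate g h (hΨ i) (hΨ0 i) hf (hΩ.inter_right (isClosed_tsupport (ρ i)))
    (fun y hy => hρ i hy.2) ?_ Set.inter_subset_left]
  · rw [setIntegral_congr_fun (g := fun _ => (0 : ℝ))
      (isOpen_chartDom hφ.continuous i (φ i)).measurableSet fun u hu => ?_]
    · simp
    · simp [eulerLagrange_eq_zero_of_center hφ hf H hu]
  · intro t y hy
    by_cases hyΩ : y ∈ Ω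
    · have h0 : ρ i y = 0 := by
        by_contra hne
        exact hy ⟨hyΩ, subset_tsupport _ hne⟩
      simp [Ψ, h0, hΦ0]
    · exact hΦΩ _ y hyΩ

end Sufficiency

end CriticalPoints

/-! ## Variations supported in a chart -/

section ChartVariation

variable {m n : ℕ}
  {M : Type*} [TopologicalSpace M] [ChartedSpace (EuclideanSpace ℝ (Fin m)) M]
  [IsManifold (𝓡 m) ∞ M]
  {N : Type*} [TopologicalSpace N] [ChartedSpace (EuclideanSpace ℝ (Fin n)) N]
  [IsManifold (𝓡 n) ∞ N]
  {g : RMetric m M} {h : RMetric n N} {f : M → ℝ} {φ : M → N} {x : M} {z : N} {u : Eu m}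

open Classical in
/-- The variation of `φ` which is `P + ε sin(t) χ v` in the charts at `x` and `z`. -/
def chartVariation (φ : M → N) (x : M) (z : N) (ε : ℝ) (χ : Eu m → ℝ) (v : Eu n) (t : ℝ) (y : M) : N :=
  if y ∈ chartSrc m n φ x z then
    (extChartAt (𝓡 n) z).symm (extChartAt (𝓡 n) z (φ y)
      + (ε * Real.sin t * χ (extChartAt (𝓡 m) x y)) • v)
  else φ y

variable {ε : ℝ} {χ : Eu m → ℝ} {v : Eu n}

theorem chartVariation_of_mem {y : M} (hy : y ∈ chartSrc m n φ x z) (t : ℝ) :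
    chartVariation φ x z ε χ v t y = (extChartAt (𝓡 n) z).symm (extChartAt (𝓡 n) z (φ y)
      + (ε * Real.sin t * χ (extChartAt (𝓡 m) x y)) • v) := if_pos hy

theorem chartVariation_eq {y : M} {t : ℝ}
    (hy : y ∈ chartSrc m n φ x z → ε * Real.sin t * χ (extChartAt (𝓡 m) x y) = 0) :
    chartVariation φ x z ε χ v t y = φ y := by
  by_cases h : y ∈ chartSrc m n φ x z
  · rw [chartVariation_of_mem h, hy h, zero_smul, add_zero, (extChartAt (𝓡 n) z).left_inv h.2]
  · exact if_neg h

theorem chartVariation_zero : chartVariation φ x z ε χ v 0 = φ := by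
  funext y
  exact chartVariation_eq fun _ => by simp

theorem chartVariation_eq_of_notMem {y : M} (hy : y ∉ (extChartAt (𝓡 m) x).symm '' tsupport χ) (t : ℝ) :
    chartVariation φ x z ε χ v t y = φ y := by
  refine chartVariation_eq fun h => ?_
  have h0 : extChartAt (𝓡 m) x y ∉ tsupport χ := fun hmem =>
    hy ⟨_, hmem, (extChartAt (𝓡 m) x).left_inv h.1⟩
  rw [image_eq_zero_of_notMem_tsupport h0, mul_zero]

/-- On the compact support of `χ` small displacements stay in the chart, by the tube lemma;
elsewhere nothing moves. Since `sin` is bounded, one `ε` serves for all times, as a variation has to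
be defined on all of `ℝ`. -/
theorem exists_chartVariation_bound (hφ : ContMDiff (𝓡 m) (𝓡 n) ∞ φ) (hχ : Continuous χ)
    (hχc : HasCompactSupport χ) (hχs : tsupport χ ⊆ chartDom m n φ x z) (v : Eu n) :
    ∃ ε > 0, ∀ t, ∀ u ∈ chartDom m n φ x z,
      inCharts m n φ x z u + (ε * Real.sin t * χ u) • v ∈ (extChartAt (𝓡 n) z).target := by
  have hO := isOpen_chartDom (m := m) (n := n) hφ.continuous x z
  have hP := (inCharts_contDiffOn hφ x z).continuousOn
  let A : Set (ℝ × Eu m) := (Set.univ ×ˢ chartDom m n φ x z) ∩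
    (fun p => inCharts m n φ x z p.2 + (p.1 * χ p.2) • v) ⁻¹' (extChartAt (𝓡 n) z).target
  have hA : IsOpen A := by
    refine ContinuousOn.isOpen_inter_preimage ?_ (isOpen_univ.prod hO) (isOpen_extChartAt_target z)
    refine ContinuousOn.add (hP.comp continuousOn_snd fun p hp => hp.2) ?_
    exact (Continuous.smul (continuous_fst.mul (hχ.comp continuous_snd)) continuous_const).continuousOn
  have h0 : ({0} : Set ℝ) ×ˢ tsupport χ ⊆ A := by
    rintro ⟨s, u⟩ ⟨hs, hu⟩
    obtain rfl : s = 0 := hs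
    exact ⟨⟨trivial, hχs hu⟩, by simpa using inCharts_mapsTo φ x z (hχs hu)⟩
  obtain ⟨U, W, hU, -, hU0, hW, hUW⟩ := generalized_tube_lemma isCompact_singleton hχc hA h0
  obtain ⟨δ, hδ, hδU⟩ := Metric.isOpen_iff.1 hU 0 (hU0 rfl)
  refine ⟨δ / 2, by positivity, fun t u hu => ?_⟩
  by_cases huC : u ∈ tsupport χ
  · have hs : δ / 2 * Real.sin t ∈ U := by
      refine hδU ?_
      rw [Metric.mem_ball, dist_zero_right, Real.norm_eq_abs, abs_mul, abs_of_pos (by positivity)]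
      have := Real.abs_sin_le_one t
      nlinarith
    exact (hUW (Set.mk_mem_prod hs (hW huC))).2
  · rw [image_eq_zero_of_notMem_tsupport huC, mul_zero, zero_smul, add_zero]
    exact inCharts_mapsTo φ x z hu

theorem isCompact_image_tsupport (hχc : HasCompactSupport χ) (hχs : tsupport χ ⊆ chartDom m n φ x z) :
    IsCompact ((extChartAt (𝓡 m) x).symm '' tsupport χ) :=
  hχc.isCompact.image_of_continuousOn ((continuousOn_extChartAt_symm x).mono fun _ hu => (hχs hu).1)

theorem contMDiffOn_comp_extChartAt {B : ℝ × Eu m → Eu n} {O : Set (Eu m)} {U : Set M}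
    (hB : ContDiffOn ℝ ∞ B (Set.univ ×ˢ O)) (hU : U ⊆ (extChartAt (𝓡 m) x).source)
    (hUO : ∀ y ∈ U, extChartAt (𝓡 m) x y ∈ O) :
    ContMDiffOn (𝓘(ℝ, ℝ).prod (𝓡 m)) 𝓘(ℝ, Eu n) ∞
      (fun p : ℝ × M => B (p.1, extChartAt (𝓡 m) x p.2)) (Set.univ ×ˢ U) := by
  have hx : ContMDiffOn (𝓡 m) 𝓘(ℝ, Eu m) ∞ (extChartAt (𝓡 m) x) (extChartAt (𝓡 m) x).source := by
    rw [extChartAt_source]; exact contMDiffOn_extChartAt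
  have h1 : ContMDiffOn (𝓘(ℝ, ℝ).prod (𝓡 m)) 𝓘(ℝ, ℝ × Eu m) ∞
      (fun p : ℝ × M => (p.1, extChartAt (𝓡 m) x p.2)) (Set.univ ×ˢ U) :=
    contMDiffOn_fst.prodMk_space ((hx.mono hU).comp contMDiffOn_snd fun p hp => hp.2)
  exact hB.contMDiffOn.comp h1 fun p hp => ⟨trivial, hUO _ hp.2⟩

/-- Near points of the chart domain the formula in coordinates is smooth. Any other point lies
outside the image of `tsupport χ`, which is compact and hence closed in the Hausdorff space `M`, and
there the variation is `φ`. -/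
theorem contMDiff_chartVariation [T2Space M] (hφ : ContMDiff (𝓡 m) (𝓡 n) ∞ φ) (hχ : ContDiff ℝ ∞ χ)
    (hχc : HasCompactSupport χ) (hχs : tsupport χ ⊆ chartDom m n φ x z)
    (hε : ∀ t, ∀ u ∈ chartDom m n φ x z,
      inCharts m n φ x z u + (ε * Real.sin t * χ u) • v ∈ (extChartAt (𝓡 n) z).target) :
    ContMDiff (𝓘(ℝ, ℝ).prod (𝓡 m)) (𝓡 n) ∞ (Function.uncurry (chartVariation φ x z ε χ v)) := by
  have hsrc := isOpen_chartSrc (m := m) (n := n) hφ.continuous x z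
  rintro ⟨t, y⟩
  by_cases hy : y ∈ chartSrc m n φ x z
  · have h2 : ContDiffOn ℝ ∞ (fun q : ℝ × Eu m => inCharts m n φ x z q.2
        + (ε * Real.sin q.1 * χ q.2) • v) (Set.univ ×ˢ chartDom m n φ x z) := by
      have a1 : ContDiffOn ℝ ∞ (fun q : ℝ × Eu m => inCharts m n φ x z q.2)
          (Set.univ ×ˢ chartDom m n φ x z) :=
        (inCharts_contDiffOn hφ x z).comp contDiff_snd.contDiffOn fun q hq => hq.2
      have a2 : ContDiff ℝ ∞ (fun q : ℝ × Eu m => (ε * Real.sin q.1 * χ q.2) • v) :=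
        ((contDiff_const.mul (Real.contDiff_sin.comp contDiff_fst)).mul (hχ.comp contDiff_snd)).smul
          contDiff_const
      exact a1.add a2.contDiffOn
    have h3 : ContMDiffOn (𝓘(ℝ, ℝ).prod (𝓡 m)) 𝓘(ℝ, Eu n) ∞
        (fun p : ℝ × M => inCharts m n φ x z (extChartAt (𝓡 m) x p.2)
          + (ε * Real.sin p.1 * χ (extChartAt (𝓡 m) x p.2)) • v)
        (Set.univ ×ˢ chartSrc m n φ x z) :=
      contMDiffOn_comp_extChartAt h2 Set.inter_subset_left fun y hy => extChartAt_mem_chartDom hy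
    have h4 : ContMDiffOn 𝓘(ℝ, Eu n) (𝓡 n) ∞ (extChartAt (𝓡 n) z).symm (extChartAt (𝓡 n) z).target :=
      contMDiffOn_extChartAt_symm z
    have h5 := h4.comp h3 fun p hp => hε p.1 _ (extChartAt_mem_chartDom hp.2)
    have hnhds : (Set.univ ×ˢ chartSrc m n φ x z : Set (ℝ × M)) ∈ nhds (t, y) :=
      (isOpen_univ.prod hsrc).mem_nhds ⟨trivial, hy⟩
    refine (h5.contMDiffAt hnhds).congr_of_eventuallyEq ?_
    filter_upwards [hnhds] with p hp
    rw [Function.comp_apply, inCharts_extChartAt hp.2.1]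
    exact chartVariation_of_mem hp.2 p.1
  · have hC : y ∉ (extChartAt (𝓡 m) x).symm '' tsupport χ := by
      rintro ⟨w, hw, rfl⟩
      exact hy (hχs hw).2
    have hcl := (isCompact_image_tsupport hχc hχs).isClosed
    refine ((hφ.comp contMDiff_snd).contMDiffAt (x := (t, y))).congr_of_eventuallyEq ?_
    filter_upwards [(isOpen_univ.prod hcl.isOpen_compl).mem_nhds (Set.mk_mem_prod (Set.mem_univ t) hC)]
      with p hp using chartVariation_eq_of_notMem hp.2 p.1

theorem variationField_chartVariation
    (hΦ : ContMDiff (𝓘(ℝ, ℝ).prod (𝓡 m)) (𝓡 n) ∞ (Function.uncurry (chartVariation φ x z ε χ v)))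
    (hε : ∀ t, ∀ u ∈ chartDom m n φ x z,
      inCharts m n φ x z u + (ε * Real.sin t * χ u) • v ∈ (extChartAt (𝓡 n) z).target)
    (hu : u ∈ chartDom m n φ x z) :
    variationField m n (chartVariation φ x z ε χ v) x z u = (ε * χ u) • v := by
  have h1 := hasDerivAt_familyInCharts hΦ chartVariation_zero hu
  have h2 : (fun t => familyInCharts m n (chartVariation φ x z ε χ v) x z (t, u))
      = fun t => inCharts m n φ x z u + (ε * Real.sin t * χ u) • v := by
    funext t
    rw [familyInCharts, inCharts, chartVariation_of_mem (symm_mem_chartSrc hu),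
      (extChartAt (𝓡 m) x).right_inv hu.1]
    exact (extChartAt (𝓡 n) z).right_inv (hε t u hu)
  rw [h2] at h1
  -- The derivative of `sin` at `0` is `1`, so the time profile leaves no trace in the variation
  -- field.
  have h3 : HasDerivAt (fun t => inCharts m n φ x z u + (ε * Real.sin t * χ u) • v)
      ((ε * Real.cos 0 * χ u) • v) 0 :=
    ((((Real.hasDerivAt_sin 0).const_mul ε).mul_const (χ u)).smul_const v).const_add _
  rw [Real.cos_zero, mul_one] at h3
  exact h1.unique h3

variable [MeasurableSpace M] [BorelSpace M] [SecondCountableTopology M] [T2Space M]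

/-- The fundamental lemma of the calculus of variations, for each constant direction `v` separately:
test functions `χ` give that the density paired with `v` vanishes almost everywhere, and continuity
gives it everywhere. -/
theorem IsFBiharmonic.eulerLagrange_eq_zero (H : IsFBiharmonic g h f φ)
    (hφ : ContMDiff (𝓡 m) (𝓡 n) ∞ φ) (hf : ContMDiff (𝓡 m) 𝓘(ℝ, ℝ) ∞ f)
    (hu : u ∈ chartDom m n φ x z) : eulerLagrange g h f φ x z u = 0 := by
  have hO := isOpen_chartDom (m := m) (n := n) hφ.continuous x z
  have hG := (isMetricOn_chartMetric g x).mono hO fun _ hu => hu.1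
  have hK := isMetricOn_chartMetric h z
  have hPS := inCharts_mapsTo (m := m) (n := n) φ x z
  have hKu := hK.posDef _ (hPS hu)
  refine metricForm_nondeg hKu fun v => ?_
  rw [metricForm_comm hKu]
  let F : Eu m → ℝ := fun u => Real.sqrt (chartMetric g x u).det *
    metricForm (chartMetric h z (inCharts m n φ x z u)) v (eulerLagrange g h f φ x z u)
  have hF : ContinuousOn F (chartDom m n φ x z) :=
    ((continuousOn_sqrt_det g x).mono fun _ hu => hu.1).mul
      (contDiffOn_metricForm hK (inCharts_contDiffOn hφ x z) hPS contDiffOn_const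
        (eulerLagrange_contDiffOn hφ hf x z)).continuousOn
  have hint : ∀ χ : Eu m → ℝ, ContDiff ℝ ∞ χ → HasCompactSupport χ →
      tsupport χ ⊆ chartDom m n φ x z → ∫ u, χ u • F u = 0 := by
    intro χ hχ hχc hχs
    obtain ⟨ε, hε0, hε⟩ := exists_chartVariation_bound hφ hχ.continuous hχc hχs v
    have hΦ := contMDiff_chartVariation hφ hχ hχc hχs hε
    have hC := isCompact_image_tsupport hχc hχs
    have h0 := fun t y hy => chartVariation_eq_of_notMem (φ := φ) (x := x) (z := z) (ε := ε) (χ := χ)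
      (v := v) (y := y) hy t
    -- The derivative of the bienergy over the support of the variation is computed twice: by the
    -- first variation formula, and as `0` by criticality.
    have h1 := (hasDerivAt_fBienergy g h hΦ hf.continuous hC).unique
      (H _ hC _ hΦ chartVariation_zero h0)
    rw [setIntegral_energyRate g h hΦ chartVariation_zero hf hC
      (by rintro _ ⟨w, hw, rfl⟩; exact (hχs hw).2) h0 subset_rfl] at h1
    have h2 : ∫ u in chartDom m n φ x z, ε * (χ u • F u) = 0 := by
      rw [← h1]
      refine setIntegral_congr_fun hO.measurableSet fun w hw => ?_
      simp only [variationField_chartVariation hΦ hε hw, F, map_smul, smul_apply, smul_eq_mul]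
      ring
    rw [integral_const_mul, setIntegral_eq_integral_of_forall_compl_eq_zero] at h2
    · exact (mul_eq_zero.1 h2).resolve_left hε0.ne'
    · intro w hw
      rw [image_eq_zero_of_notMem_tsupport fun hmem => hw (hχs hmem), zero_smul]
  have hae := hO.ae_eq_zero_of_integral_contDiff_smul_eq_zero
    (hF.locallyIntegrableOn hO.measurableSet) hint
  have hzero := Measure.eqOn_open_of_ae_eq (μ := (volume : Measure (Eu m))) (f := F) (g := fun _ => 0)
    ((ae_restrict_iff' hO.measurableSet).2 hae) hO hF continuousOn_const hu
  have hs : Real.sqrt (chartMetric g x u).det ≠ 0 := (Real.sqrt_pos.2 (hG.posDef u hu).det_pos).ne'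
  exact (mul_eq_zero.1 hzero).resolve_left hs

/-- The Euler-Lagrange equation of the `f`-bienergy. -/
theorem isFBiharmonic_iff_eulerLagrange (hφ : ContMDiff (𝓡 m) (𝓡 n) ∞ φ)
    (hf : ContMDiff (𝓡 m) 𝓘(ℝ, ℝ) ∞ f) : IsFBiharmonic g h f φ ↔
      ∀ y, eulerLagrange g h f φ y (φ y) (extChartAt (𝓡 m) y y) = 0 :=
  ⟨fun H y => H.eulerLagrange_eq_zero hφ hf (extChartAt_mem_chartDom (mem_chartSrc_self φ y)),
    isFBiharmonic_of_eulerLagrange hφ hf⟩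

end ChartVariation

/-! ## Hypersurfaces of Riemannian manifolds in charts -/

section Fields

variable {m n : ℕ}
  {M : Type*} [TopologicalSpace M] [ChartedSpace (EuclideanSpace ℝ (Fin m)) M]
  [IsManifold (𝓡 m) ∞ M]
  {N : Type*} [TopologicalSpace N] [ChartedSpace (EuclideanSpace ℝ (Fin n)) N]
  [IsManifold (𝓡 n) ∞ N]
  {g : RMetric m M} {h : RMetric n N} {φ : M → N} {ξ : ∀ x : M, TangentSpace (𝓡 n) (φ x)}
  {x : M} {z : N} {u : Eu m}

variable (m) in
/-- A vector field along a map, in the charts at `x` and `z`. -/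
def fieldInCharts (ξ : ∀ x : M, TangentSpace (𝓡 n) (φ x)) (x : M) (z : N) (u : Eu m) : Eu n :=
  (trivializationAt (EuclideanSpace ℝ (Fin n)) (TangentSpace (𝓡 n)) z
    (⟨φ ((extChartAt (𝓡 m) x).symm u), ξ ((extChartAt (𝓡 m) x).symm u)⟩ : TangentBundle (𝓡 n) N)).2

/-- A vector field along a map, with values in the model space. -/
def fieldVec (ξ : ∀ x : M, TangentSpace (𝓡 n) (φ x)) (y : M) : Eu n := ξ y

/-- The trivialization of the tangent bundle at `z` is inverse to the derivative of the inverse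
chart, so `fieldInCharts` consists of the components with respect to the coordinate frame at `z`. -/
theorem chartDeriv_fieldInCharts (ξ : ∀ x : M, TangentSpace (𝓡 n) (φ x)) (hu : u ∈ chartDom m n φ x z) :
    chartDeriv z (inCharts m n φ x z u) (fieldInCharts m ξ x z u)
      = fieldVec ξ ((extChartAt (𝓡 m) x).symm u) := by
  set y := (extChartAt (𝓡 m) x).symm u
  have hy : φ y ∈ (chartAt (EuclideanSpace ℝ (Fin n)) z).source := by
    have := hu.2.2
    rwa [Set.mem_preimage, extChartAt_source] at this
  have hb : φ y ∈ (trivializationAt (EuclideanSpace ℝ (Fin n)) (TangentSpace (𝓡 n)) z).baseSet := hy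
  have h1 := (trivializationAt (EuclideanSpace ℝ (Fin n)) (TangentSpace (𝓡 n)) z).symmL_continuousLinearMapAt
    (R := ℝ) hb (ξ y)
  rw [TangentBundle.symmL_trivializationAt hy, ModelWithCorners.range_eq_univ, mfderivWithin_univ,
    Trivialization.continuousLinearMapAt_apply, Trivialization.linearMapAt_apply, if_pos hb] at h1
  exact h1

theorem fieldInCharts_contDiffOn
    (hξ : ContMDiff (𝓡 m) (𝓡 n).tangent ∞ (fun x => (⟨φ x, ξ x⟩ : TangentBundle (𝓡 n) N)))
    (x : M) (z : N) : ContDiffOn ℝ ∞ (fieldInCharts m ξ x z) (chartDom m n φ x z) := by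
  rw [← contMDiffOn_iff_contDiffOn]
  have h1 : ContMDiffOn 𝓘(ℝ, Eu m) (𝓡 m) ∞ (extChartAt (𝓡 m) x).symm (extChartAt (𝓡 m) x).target :=
    contMDiffOn_extChartAt_symm x
  have h2 := hξ.comp_contMDiffOn (h1.mono fun u (hu : u ∈ chartDom m n φ x z) => hu.1)
  refine ((Trivialization.contMDiffOn_iff (e := trivializationAt (EuclideanSpace ℝ (Fin n))
    (TangentSpace (𝓡 n)) z) fun u hu => ?_).1 h2).2
  rw [Trivialization.mem_source]
  have := hu.2.2
  rwa [Set.mem_preimage, extChartAt_source] at this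

theorem metricForm_fieldInCharts (hu : u ∈ chartDom m n φ x z) (v w : Eu n) :
    metricForm (chartMetric h z (inCharts m n φ x z u)) v w
      = innerForm h (φ ((extChartAt (𝓡 m) x).symm u)) (chartDeriv z (inCharts m n φ x z u) v)
        (chartDeriv z (inCharts m n φ x z u) w) := by
  rw [metricForm_chartMetric, symm_inCharts hu]

/-- The coordinate tension field in arbitrary charts represents the tangent vector defined through
the preferred ones; thus `τ = mHξ` can be used in a neighbourhood and not only at the centre of a
chart. -/
theorem chartDeriv_coordTension (hφ : ContMDiff (𝓡 m) (𝓡 n) ∞ φ) (hu : u ∈ chartDom m n φ x z) :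
    chartDeriv z (inCharts m n φ x z u)
        (coordTension (chartMetric g x) (chartMetric h z) (inCharts m n φ x z) u)
      = fieldVec (tension g h φ) ((extChartAt (𝓡 m) x).symm u) := by
  set y := (extChartAt (𝓡 m) x).symm u with hy
  have hc := isChartChange g h hφ x y z (φ y)
  have hu' : u ∈ chartPart m x (chartSrc m n φ x z ∩ chartSrc m n φ y (φ y)) :=
    ⟨hu.1, hu.2, mem_chartSrc_self φ y⟩
  have h1 : fieldVec (tension g h φ) y = coordTension (chartMetric g y) (chartMetric h (φ y))
    (inCharts m n φ y (φ y)) (inCharts m m (id : M → M) x y u) := tension_eq g h hφ y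
  have h2 := chartDeriv_fderiv_inCharts (contMDiff_id (M := N) (I := 𝓡 n)) (hc.mapsTo hu')
    (coordTension (chartMetric g x) (chartMetric h z) (inCharts m n φ x z) u)
  have h3 : inCharts n n (id : N → N) z (φ y) (inCharts m n φ x z u) = extChartAt (𝓡 n) (φ y) (φ y) := by
    rw [inCharts, symm_inCharts hu]; rfl
  have h4 : mapDeriv (m := n) (n := n) (id : N → N) ((extChartAt (𝓡 n) z).symm (inCharts m n φ x z u))
      = ContinuousLinearMap.id ℝ (Eu n) := mfderiv_id
  rw [h1, hc.coordTension_map hu']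
  rw [h3, chartDeriv_self, h4] at h2
  exact h2.symm

theorem inCharts_center (φ : M → N) (y : M) :
    inCharts m n φ y (φ y) (extChartAt (𝓡 m) y y) = extChartAt (𝓡 n) (φ y) (φ y) :=
  inCharts_extChartAt (mem_extChartAt_source y)

theorem fieldInCharts_center (ξ : ∀ x : M, TangentSpace (𝓡 n) (φ x)) (y : M) :
    fieldInCharts m ξ y (φ y) (extChartAt (𝓡 m) y y) = fieldVec ξ y := by
  have h := chartDeriv_fieldInCharts ξ (extChartAt_mem_chartDom (mem_chartSrc_self (m := m) (n := n) φ y))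
  rwa [inCharts_center, chartDeriv_self, extChartAt_to_inv] at h

theorem fderiv_inCharts_center (hφ : ContMDiff (𝓡 m) (𝓡 n) ∞ φ) (y : M) (a : Eu m) :
    fderiv ℝ (inCharts m n φ y (φ y)) (extChartAt (𝓡 m) y y) a = mapDeriv φ y a := by
  have h := chartDeriv_fderiv_inCharts hφ
    (extChartAt_mem_chartDom (mem_chartSrc_self (m := m) (n := n) φ y)) a
  rwa [inCharts_center, chartDeriv_self, chartDeriv_self, extChartAt_to_inv] at h

/-! ### Tensors in the preferred chart -/

/-- `sharp`, with values in the model space. -/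
def sharpVec (g : RMetric m M) (y : M) (a : Fin m → ℝ) : Eu m := sharp g y a

/-- The defining property of the dual vector. It gives the inner products of gradients, shape
operators and tangential parts, all of which are built from `sharp`. -/
theorem metricForm_sharp (g : RMetric m M) (y : M) (α : Eu m →L[ℝ] ℝ) (v : Eu m) :
    metricForm (chartMetric g y (extChartAt (𝓡 m) y y)) (sharpVec g y fun j => α (stdVec j)) v = α v := by
  have hA := (isMetricOn_chartMetric g y).posDef _ (mem_extChartAt_target y)
  set A := chartMetric g y (extChartAt (𝓡 m) y y)
  have hv : ∀ j, metricForm A (sharpVec g y fun j => α (stdVec j)) (stdVec j) = α (stdVec j) := by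
    intro j
    have h1 : metricForm A (sharpVec g y fun j => α (stdVec j)) (stdVec j)
        = ∑ k, (∑ i, A⁻¹ k i * α (stdVec i)) * A k j := by
      rw [metricForm_apply]
      refine Finset.sum_congr rfl fun k _ => ?_
      simp only [PiLp.single_apply, ite_mul, one_mul, zero_mul, mul_ite, mul_zero,
        Finset.sum_ite_eq', Finset.mem_univ, if_true]
      rfl
    have h2 : ∀ i, ∑ k, A j k * A⁻¹ k i = if j = i then 1 else 0 := fun i => sum_mul_inv hA j i
    have hs : ∀ k, A k j = A j k := fun k => by simpa using hA.1.apply j k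
    rw [h1]
    simp only [Finset.sum_mul]
    rw [Finset.sum_comm]
    have h3 : ∀ i, ∑ k, A⁻¹ k i * α (stdVec i) * A k j = (if j = i then 1 else 0) * α (stdVec i) := by
      intro i
      rw [← h2 i, Finset.sum_mul]
      exact Finset.sum_congr rfl fun k _ => by rw [hs k]; ring
    simp [h3]
  conv_lhs => rw [← sum_coord_smul v]
  conv_rhs => rw [← sum_coord_smul v]
  simp only [map_sum, map_smul, hv]

theorem coordLaplacian_eq_laplacian (g : RMetric m M) (w : M → ℝ) (y : M) :
    laplacian g w y = coordLaplacian (chartMetric g y) (fun u => w ((extChartAt (𝓡 m) y).symm u))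
      (extChartAt (𝓡 m) y y) := by
  refine Finset.sum_congr rfl fun i _ => Finset.sum_congr rfl fun j _ => ?_
  congr 2
  conv_rhs => rw [← sum_coord_smul (gamma _ _ (stdVec i) (stdVec j))]
  rw [map_sum]
  refine Finset.sum_congr rfl fun k _ => ?_
  rw [map_smul, gamma_single_apply]; rfl

theorem curvatureCoeff_eq {K : Eu n → Matrix (Fin n) (Fin n) ℝ} {S : Set (Eu n)} (hK : IsMetricOn K S)
    {q : Eu n} (hq : q ∈ S) (l k i j : Fin n) :
    curvatureCoeff K l k i j q = curv K q (stdVec i) (stdVec j) (stdVec k) l := by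
  have hd := differentiableAt_of_contDiffOn hK.isOpen hK.gamma_smooth hq
  have h1 : ∀ i j k, fderiv ℝ (gamma K) q (stdVec i) (stdVec j) (stdVec k) l
      = partialD i (christoffel K l j k) q := by
    intro i j k
    rw [fderiv_clm_apply₂ hd, ← fderiv_coord ((hd.clm_apply (differentiableAt_const _)).clm_apply
      (differentiableAt_const _))]
    simp only [gamma_single_apply]; rfl
  have h2 : ∀ i j k, gamma K q (stdVec i) (gamma K q (stdVec j) (stdVec k)) l
      = ∑ s, christoffel K l i s q * christoffel K s j k q := by
    intro i j k
    conv_lhs => rw [← sum_coord_smul (gamma K q (stdVec j) (stdVec k))]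
    simp only [map_sum, map_smul, WithLp.ofLp_sum, Finset.sum_apply, PiLp.smul_apply, smul_eq_mul,
      gamma_single_apply]
    exact Finset.sum_congr rfl fun s _ => mul_comm _ _
  rw [curv, curvatureCoeff]
  simp only [PiLp.sub_apply, PiLp.add_apply, h1, h2, Finset.sum_sub_distrib]
  ring

/-- The Ricci tensor as a bilinear form. -/
def ricciBilin (K : Eu n → Matrix (Fin n) (Fin n) ℝ) (q : Eu n) : Eu n →L[ℝ] Eu n →L[ℝ] ℝ :=
  ∑ i, (ContinuousLinearMap.compL ℝ (Eu n) (Eu n) ℝ (EuclideanSpace.proj i)).comp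
    (curvRight K q (stdVec i))

theorem ricciBilin_apply (K : Eu n → Matrix (Fin n) (Fin n) ℝ) (q Z W : Eu n) :
    ricciBilin K q Z W = ricciForm K q Z W := by
  rw [ricciBilin, sum_apply, sum_apply]; rfl

theorem ricci_eq (h : RMetric n N) (y : N) (Z W : Eu n) :
    ricci h y Z W = ricciBilin (chartMetric h y) (extChartAt (𝓡 n) y y) Z W := by
  conv_rhs => rw [← bilin_eq (ricciBilin (chartMetric h y) (extChartAt (𝓡 n) y y)), bilin_apply]
  refine Finset.sum_congr rfl fun j _ => Finset.sum_congr rfl fun k _ => ?_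
  have h1 : ricciCoeff (chartMetric h y) j k (extChartAt (𝓡 n) y y)
      = ricciBilin (chartMetric h y) (extChartAt (𝓡 n) y y) (stdVec j) (stdVec k) := by
    rw [ricciBilin_apply]
    exact Finset.sum_congr rfl fun i _ => curvatureCoeff_eq (isMetricOn_chartMetric h y)
      (mem_extChartAt_target y) i k i j
  rw [h1, smul_eq_mul]
  simp only [comps]
  ring

theorem metricForm_eq_sum_inv {A : Matrix (Fin n) (Fin n) ℝ} (hA : A.PosDef) (v w : Eu n) :
    metricForm A v w
      = ∑ k, ∑ l, A⁻¹ k l * (metricForm A v (stdVec k) * metricForm A w (stdVec l)) := by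
  conv_lhs => rw [← sum_metricForm_inv_smul hA v]
  simp only [map_sum, map_smul, sum_apply, smul_apply, smul_eq_mul]
  refine Finset.sum_congr rfl fun i _ => Finset.sum_congr rfl fun j _ => ?_
  rw [metricForm_comm hA (stdVec j)]; ring

theorem coordLaplacian_const_mul {G : Eu m → Matrix (Fin m) (Fin m) ℝ} {O : Set (Eu m)}
    (hO : IsOpen O) {w : Eu m → ℝ} (hw : ContDiffOn ℝ ∞ w O) (hu : u ∈ O) (c : ℝ) :
    coordLaplacian G (fun v => c * w v) u = c * coordLaplacian G w u := by
  have h1 : ∀ v ∈ O, fderiv ℝ (fun v => c * w v) v = c • fderiv ℝ w v := fun v hv =>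
    fderiv_const_mul (differentiableAt_of_contDiffOn hO hw hv) c
  have h2 : ∀ j, fderiv ℝ (fun v => fderiv ℝ (fun v => c * w v) v (stdVec j)) u
      = c • fderiv ℝ (fun v => fderiv ℝ w v (stdVec j)) u := by
    intro j
    rw [← fderiv_const_mul (differentiableAt_of_contDiffOn hO (contDiffOn_fderiv_apply hO hw _) hu)]
    refine Filter.EventuallyEq.fderiv_eq ?_
    filter_upwards [hO.mem_nhds hu] with v hv
    rw [h1 v hv]; rfl
  simp only [coordLaplacian, h1 u hu, h2, Finset.mul_sum, smul_apply, smul_eq_mul]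
  refine Finset.sum_congr rfl fun i _ => Finset.sum_congr rfl fun j _ => ?_
  ring

end Fields

/-! ### The hypersurface in charts and its mean curvature -/

section HypersurfaceEquations

variable {m : ℕ}
  {M : Type*} [TopologicalSpace M] [ChartedSpace (EuclideanSpace ℝ (Fin m)) M]
  [IsManifold (𝓡 m) ∞ M]
  {N : Type*} [TopologicalSpace N] [ChartedSpace (EuclideanSpace ℝ (Fin (m + 1))) N]
  [IsManifold (𝓡 (m + 1)) ∞ N]
  {g : RMetric m M} {h : RMetric (m + 1) N} {φ : M → N}
  {ξ : ∀ x : M, TangentSpace (𝓡 (m + 1)) (φ x)} {f H : M → ℝ} {x : M} {z : N} {u : Eu m}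

theorem isHypersurfaceOn (hφ : IsIsometricImmersion g h φ) (hξ : IsUnitNormal (m := m) h φ ξ)
    (x : M) (z : N) : IsHypersurfaceOn (chartMetric g x) (chartMetric h z)
      (inCharts m (m + 1) φ x z) (fieldInCharts m ξ x z) (chartDom m (m + 1) φ x z)
      (extChartAt (𝓡 (m + 1)) z).target where
  source := (isMetricOn_chartMetric g x).mono (isOpen_chartDom hφ.1.continuous x z) fun _ hu => hu.1
  target := isMetricOn_chartMetric h z
  smooth := inCharts_contDiffOn hφ.1 x z
  mapsTo := inCharts_mapsTo φ x z
  isometry _ hu := hφ.metricForm_inCharts hu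
  normal_smooth := fieldInCharts_contDiffOn hξ.1 x z
  unit u hu := by
    rw [metricForm_fieldInCharts hu, chartDeriv_fieldInCharts ξ hu]
    exact hξ.2.1 _
  normal u hu a := by
    rw [metricForm_fieldInCharts hu, chartDeriv_fieldInCharts ξ hu, chartDeriv_fderiv_inCharts hφ.1 hu]
    exact hξ.2.2 _ _

theorem tension_eq_smul (hH : ∀ x, meanCurvatureVector g h φ x = H x • ξ x) (y : M) :
    fieldVec (tension g h φ) y = (m * H y) • fieldVec ξ y := by
  have h1 : (1 / (m : ℝ)) • fieldVec (tension g h φ) y = H y • fieldVec ξ y := hH y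
  -- For `m = 0` the normalization `1/m` cannot be inverted, but the tension field is an empty sum.
  rcases Nat.eq_zero_or_pos m with rfl | hm
  · have h2 : fieldVec (tension g h φ) y = 0 := by
      unfold fieldVec tension
      exact Finset.sum_eq_zero fun i _ => Fin.elim0 i
    rw [h2]; simp
  · rw [mul_smul, ← h1, smul_smul, mul_one_div_cancel (by positivity), one_smul]

theorem coordTension_eq_smul (hφ : IsIsometricImmersion g h φ)
    (hH : ∀ x, meanCurvatureVector g h φ x = H x • ξ x) (hu : u ∈ chartDom m (m + 1) φ x z) :
    coordTension (chartMetric g x) (chartMetric h z) (inCharts m (m + 1) φ x z) u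
      = (m * H ((extChartAt (𝓡 m) x).symm u)) • fieldInCharts m ξ x z u := by
  refine (chartDeriv_bijective z (inCharts_mapsTo φ x z hu)).1 ?_
  rw [map_smul, chartDeriv_coordTension hφ.1 hu, chartDeriv_fieldInCharts ξ hu, tension_eq_smul hH]

/-- The factor `1/0 = 0` makes the mean curvature vector vanish; pairing with the unit vector `ξ`
gives the claim. -/
theorem meanCurvature_eq_zero {M : Type*} [TopologicalSpace M]
    [ChartedSpace (EuclideanSpace ℝ (Fin 0)) M] [IsManifold (𝓡 0) ∞ M]
    {N : Type*} [TopologicalSpace N] [ChartedSpace (EuclideanSpace ℝ (Fin (0 + 1))) N]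
    [IsManifold (𝓡 (0 + 1)) ∞ N] {g : RMetric 0 M} {h : RMetric (0 + 1) N} {φ : M → N}
    {ξ : ∀ x : M, TangentSpace (𝓡 (0 + 1)) (φ x)} {H : M → ℝ}
    (hξ : IsUnitNormal (m := 0) h φ ξ)
    (hH : ∀ x, meanCurvatureVector g h φ x = H x • ξ x) (y : M) : H y = 0 := by
  have h1 : (1 / ((0 : ℕ) : ℝ)) • fieldVec (tension g h φ) y = H y • fieldVec ξ y := hH y
  have h2 : innerForm h (φ y) (fieldVec ξ y) (fieldVec ξ y) = 1 := hξ.2.1 y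
  have h3 := congrArg (fun v => innerForm h (φ y) v (fieldVec ξ y)) h1
  simpa [h2] using h3.symm

/-- Smoothness of `H` is not assumed: for `m > 0` it is recovered from `H = ⟨τ, ξ⟩ / m`, and for `m
= 0` the function is zero. -/
theorem meanCurvature_contDiffOn (hφ : IsIsometricImmersion g h φ)
    (hξ : IsUnitNormal (m := m) h φ ξ) (hH : ∀ x, meanCurvatureVector g h φ x = H x • ξ x)
    (x : M) (z : N) : ContDiffOn ℝ ∞ (fun u => H ((extChartAt (𝓡 m) x).symm u))
      (chartDom m (m + 1) φ x z) := by
  rcases Nat.eq_zero_or_pos m with rfl | hm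
  · have h0 := meanCurvature_eq_zero hξ hH
    simpa only [h0] using contDiffOn_const
  · have hs := isHypersurfaceOn hφ hξ x z
    have h1 : ContDiffOn ℝ ∞ (fun u => (1 / (m : ℝ)) *
        metricForm (chartMetric h z (inCharts m (m + 1) φ x z u))
          (coordTension (chartMetric g x) (chartMetric h z) (inCharts m (m + 1) φ x z) u)
          (fieldInCharts m ξ x z u)) (chartDom m (m + 1) φ x z) :=
      contDiffOn_const.mul (contDiffOn_metricForm hs.target hs.smooth hs.mapsTo
        (coordTension_contDiffOn hs.source hs.target hs.smooth hs.mapsTo) hs.normal_smooth)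
    refine h1.congr fun u hu => ?_
    have hm' : (m : ℝ) ≠ 0 := by positivity
    rw [coordTension_eq_smul hφ hH hu, map_smul, smul_apply, hs.unit u hu, smul_eq_mul, mul_one]
    field_simp

/-- Every ambient vector splits into a tangent part and a multiple of the normal, so it suffices to
test against these. -/
theorem IsHypersurfaceOn.eq_zero_iff {G : Eu m → Matrix (Fin m) (Fin m) ℝ}
    {K : Eu (m + 1) → Matrix (Fin (m + 1)) (Fin (m + 1)) ℝ} {P X : Eu m → Eu (m + 1)}
    {O : Set (Eu m)} {S : Set (Eu (m + 1))} (h : IsHypersurfaceOn G K P X O S) (hu : u ∈ O)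
    (v : Eu (m + 1)) : v = 0 ↔ metricForm (K (P u)) v (X u) = 0 ∧
      ∀ a, metricForm (K (P u)) v (fderiv ℝ P u a) = 0 := by
  have hK := h.target.posDef _ (h.mapsTo hu)
  refine ⟨fun hv => by simp [hv], fun ⟨h1, h2⟩ => metricForm_nondeg hK fun w => ?_⟩
  obtain ⟨a, ha⟩ := exists_eq_tangent_add_normal (h.source.posDef u hu) hK (fderiv ℝ P u)
    (h.isometry u hu) (h.unit u hu) (h.normal u hu) w
  rw [ha, map_add, h2, map_smul, h1]; simp

end HypersurfaceEquations

/-! ## The equations of `f`-biharmonic hypersurfaces -/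

section BiharmonicEquations

variable {m : ℕ}
  {M : Type*} [TopologicalSpace M] [ChartedSpace (EuclideanSpace ℝ (Fin m)) M]
  [IsManifold (𝓡 m) ∞ M]
  {N : Type*} [TopologicalSpace N] [ChartedSpace (EuclideanSpace ℝ (Fin (m + 1))) N]
  [IsManifold (𝓡 (m + 1)) ∞ N]
  {g : RMetric m M} {h : RMetric (m + 1) N} {φ : M → N}
  {ξ : ∀ x : M, TangentSpace (𝓡 (m + 1)) (φ x)} {f H : M → ℝ}

/-- The shape operator, with values in the model space. -/
def shapeVec (g : RMetric m M) (h : RMetric (m + 1) N) (φ : M → N)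
    (ξ : ∀ x : M, TangentSpace (𝓡 (m + 1)) (φ x)) (y : M) (X : Eu m) : Eu m :=
  shapeOperator g h φ ξ y X

/-- The gradient, with values in the model space. -/
def gradVec (g : RMetric m M) (w : M → ℝ) (y : M) : Eu m := grad g w y

/-- The tangential part of `Ric(ξ)`, with values in the model space. -/
def ricciTangentVec (g : RMetric m M) (h : RMetric (m + 1) N) (φ : M → N)
    (ξ : ∀ x : M, TangentSpace (𝓡 (m + 1)) (φ x)) (y : M) : Eu m :=
  tangentialPart g h φ y (ricciOp h (φ y) (ξ y))

theorem metricForm_gradVec (g : RMetric m M) (w : M → ℝ) (y : M) (a : Eu m) :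
    metricForm (chartMetric g y (extChartAt (𝓡 m) y y)) (gradVec g w y) a
      = fderiv ℝ (fun u => w ((extChartAt (𝓡 m) y).symm u)) (extChartAt (𝓡 m) y y) a :=
  metricForm_sharp g y _ a

theorem metricForm_shapeVec (hφ : IsIsometricImmersion g h φ) (hξ : IsUnitNormal (m := m) h φ ξ)
    (y : M) (a b : Eu m) :
    metricForm (chartMetric g y (extChartAt (𝓡 m) y y)) (shapeVec g h φ ξ y a) b
      = -weingarten (chartMetric h (φ y)) (inCharts m (m + 1) φ y (φ y))
        (fieldInCharts m ξ y (φ y)) (extChartAt (𝓡 m) y y) a b := by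
  have hs := isHypersurfaceOn hφ hξ y (φ y)
  have hu := extChartAt_mem_chartDom (mem_chartSrc_self (m := m) (n := m + 1) φ y)
  set G := chartMetric g y
  set K := chartMetric h (φ y)
  set P := inCharts m (m + 1) φ y (φ y) with hP
  set X := fieldInCharts m ξ y (φ y) with hX
  set u := extChartAt (𝓡 m) y y with hu'
  have h1 : ∀ b : Eu m, innerForm h (φ y) (nabla G K P (fderiv ℝ P) u a b) (fieldVec ξ y)
      = (-weingarten K P X u a) b := by
    intro b
    have hd := differentiableAt_of_contDiffOn hs.source.isOpen
      (contDiffOn_fderiv hs.source.isOpen hs.smooth) hu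
    rw [← fieldInCharts_center (m := m) ξ y, ← metricForm_chartMetric_self h (φ y),
      ← inCharts_center (m := m) φ y, neg_apply, hs.weingarten_eq hu, neg_neg, nabla_apply hd, map_sub,
      sub_apply, hs.comm hu (fderiv ℝ P u _), hs.normal u hu, sub_zero]
  have h2 : shapeVec g h φ ξ y a = sharpVec g y fun j => (-weingarten K P X u a) (stdVec j) := by
    refine congrArg (sharpVec g y) (funext fun j => ?_)
    rw [← h1]
    exact congrArg (fun v => innerForm h (φ y) v (fieldVec ξ y))
      (secondFundamentalForm_eq g h hφ.1 y a (stdVec j))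
  rw [h2, metricForm_sharp]; rfl

theorem metricForm_ricciTangentVec (hφ : IsIsometricImmersion g h φ) (y : M) (a : Eu m) :
    metricForm (chartMetric g y (extChartAt (𝓡 m) y y)) (ricciTangentVec g h φ ξ y) a
      = ricciForm (chartMetric h (φ y)) (extChartAt (𝓡 (m + 1)) (φ y) (φ y)) (fieldVec ξ y)
        (fderiv ℝ (inCharts m (m + 1) φ y (φ y)) (extChartAt (𝓡 m) y y) a) := by
  set q := extChartAt (𝓡 (m + 1)) (φ y) (φ y)
  set K := chartMetric h (φ y)
  set L := fderiv ℝ (inCharts m (m + 1) φ y (φ y)) (extChartAt (𝓡 m) y y)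
  let V : Eu (m + 1) := ricciOp h (φ y) (ξ y)
  have hV : ∀ w, metricForm (K q) V w = ricciBilin K q (fieldVec ξ y) w := by
    intro w
    have h1 : V = sharpVec h (φ y) fun k => ricciBilin K q (fieldVec ξ y) (stdVec k) :=
      congrArg (sharpVec h (φ y)) (funext fun k => ricci_eq h (φ y) (fieldVec ξ y) (stdVec k))
    rw [h1]
    exact metricForm_sharp h (φ y) (ricciBilin K q (fieldVec ξ y)) w
  have h2 : ricciTangentVec g h φ ξ y
      = sharpVec g y fun j => ((metricForm (K q) V).comp L) (stdVec j) := by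
    refine congrArg (sharpVec g y) (funext fun j => ?_)
    rw [ContinuousLinearMap.comp_apply, metricForm_chartMetric_self, fderiv_inCharts_center hφ.1]
    rfl
  rw [h2, metricForm_sharp, ContinuousLinearMap.comp_apply, hV, ricciBilin_apply]

theorem shapeNormSq_eq (hφ : IsIsometricImmersion g h φ) (hξ : IsUnitNormal (m := m) h φ ξ) (y : M) :
    shapeNormSq g h φ ξ y = ∑ i, ∑ j, (chartMetric g y (extChartAt (𝓡 m) y y))⁻¹ i j *
      ∑ k, ∑ l, (chartMetric g y (extChartAt (𝓡 m) y y))⁻¹ k l *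
        (weingarten (chartMetric h (φ y)) (inCharts m (m + 1) φ y (φ y)) (fieldInCharts m ξ y (φ y))
            (extChartAt (𝓡 m) y y) (stdVec i) (stdVec k)
          * weingarten (chartMetric h (φ y)) (inCharts m (m + 1) φ y (φ y)) (fieldInCharts m ξ y (φ y))
            (extChartAt (𝓡 m) y y) (stdVec j) (stdVec l)) := by
  have hG := (isMetricOn_chartMetric g y).posDef _ (mem_extChartAt_target y)
  refine Finset.sum_congr rfl fun i _ => Finset.sum_congr rfl fun j _ => ?_
  have h1 : g.inner y (shapeOperator g h φ ξ y (basisVec y i)) (shapeOperator g h φ ξ y (basisVec y j))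
      = innerForm g y (shapeVec g h φ ξ y (stdVec i)) (shapeVec g h φ ξ y (stdVec j)) := rfl
  rw [h1, ← metricForm_chartMetric_self, metricForm_eq_sum_inv hG]
  simp only [metricForm_shapeVec hφ hξ, neg_mul_neg]
  rfl

/-- The Euler-Lagrange equation of the `f`-bienergy for a hypersurface, split into its normal and
tangential parts. -/
theorem eulerLagrange_hypersurface_iff (hφ : IsIsometricImmersion g h φ)
    (hξ : IsUnitNormal (m := m) h φ ξ) (hH : ∀ x, meanCurvatureVector g h φ x = H x • ξ x)
    (hf : ContMDiff (𝓡 m) 𝓘(ℝ, ℝ) ∞ f) (y : M) :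
    eulerLagrange g h f φ y (φ y) (extChartAt (𝓡 m) y y) = 0 ↔
      laplacian g (fun y => f y * H y) y
          - f y * H y * (shapeNormSq g h φ ξ y - ricci h (φ y) (ξ y) (ξ y)) = 0 ∧
      shapeOperator g h φ ξ y (grad g (fun y => f y * H y) y)
          + (f y * H y) • (((m : ℝ) / 2) • grad g H y
              - tangentialPart g h φ y (ricciOp h (φ y) (ξ y))) = 0 := by
  have hs := isHypersurfaceOn hφ hξ y (φ y)
  have hu := extChartAt_mem_chartDom (mem_chartSrc_self (m := m) (n := m + 1) φ y)
  have hG := hs.source.posDef _ hu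
  have hinv := extChartAt_to_inv (I := 𝓡 m) y
  have hτ := fun u hu => coordTension_eq_smul (u := u) (x := y) (z := φ y) hφ hH hu
  have hHs := meanCurvature_contDiffOn hφ hξ hH y (φ y)
  have hfs := (contDiffOn_inChart hf y).mono fun u (hu : u ∈ chartDom m (m + 1) φ y (φ y)) => hu.1
  have hshape := metricForm_shapeVec hφ hξ y
  have hric := metricForm_ricciTangentVec (ξ := ξ) hφ y
  have hnorm := shapeNormSq_eq hφ hξ y
  have hric' : ricci h (φ y) (ξ y) (ξ y) = _ :=
    (ricci_eq h (φ y) (fieldVec ξ y) (fieldVec ξ y)).trans (ricciBilin_apply _ _ _ _)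
  rw [← inCharts_center (m := m) φ y, ← fieldInCharts_center (m := m) ξ y] at hric'
  simp only [← inCharts_center (m := m) φ y, ← fieldInCharts_center (m := m) ξ y] at hric
  set G := chartMetric g y
  set K := chartMetric h (φ y)
  set P := inCharts m (m + 1) φ y (φ y) with hP
  set X := fieldInCharts m ξ y (φ y) with hX
  set u₀ := extChartAt (𝓡 m) y y with hu'
  let s := (extChartAt (𝓡 m) y).symm
  have hO := hs.source.isOpen
  have hω : ContDiffOn ℝ ∞ (fun u => f (s u) * H (s u)) (chartDom m (m + 1) φ y (φ y)) := hfs.mul hHs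
  have hw : ContDiffOn ℝ ∞ (fun u => (m : ℝ) * (f (s u) * H (s u))) (chartDom m (m + 1) φ y (φ y)) :=
    contDiffOn_const.mul hω
  -- Near `u₀` the field `f τ` is `m f H ξ`, and the Jacobi operator depends only on the germ.
  have hEL : eulerLagrange g h f φ y (φ y) u₀
      = jacobiOp G K P (fun u => ((m : ℝ) * (f (s u) * H (s u))) • X u) u₀ := by
    refine jacobiOp_congr ?_
    filter_upwards [hO.mem_nhds hu] with v hv
    rw [hτ v hv, smul_smul]
    congr 1
    ring
  let Z : Eu m := shapeVec g h φ ξ y (gradVec g (fun y => f y * H y) y)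
    + (f y * H y) • (((m : ℝ) / 2) • gradVec g H y - ricciTangentVec g h φ ξ y)
  have hZ : ∀ a, metricForm (G u₀) Z a
      = -(∑ i, ∑ j, (G u₀)⁻¹ i j * fderiv ℝ (fun u => f (s u) * H (s u)) u₀ (stdVec i) *
          weingarten K P X u₀ (stdVec j) a)
        + f y * H y * ((m : ℝ) / 2 * fderiv ℝ (fun u => H (s u)) u₀ a
          - ricciForm K (P u₀) (X u₀) (fderiv ℝ P u₀ a)) := by
    intro a
    simp only [Z, map_add, map_sub, map_smul, add_apply, sub_apply, smul_apply, smul_eq_mul]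
    rw [hshape, hric, metricForm_gradVec]
    congr 2
    conv_lhs => rw [← sum_metricForm_inv_smul hG (gradVec g (fun y => f y * H y) y)]
    simp only [map_sum, map_smul, sum_apply, smul_apply, smul_eq_mul]
    refine Finset.sum_congr rfl fun i _ => Finset.sum_congr rfl fun j _ => ?_
    rw [metricForm_gradVec]
  have hlap := coordLaplacian_eq_laplacian g (fun y => f y * H y) y
  have hPDE2 : (shapeOperator g h φ ξ y (grad g (fun y => f y * H y) y)
          + (f y * H y) • (((m : ℝ) / 2) • grad g H y
              - tangentialPart g h φ y (ricciOp h (φ y) (ξ y))) = 0) ↔ ∀ a, metricForm (G u₀) Z a = 0 := by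
    change Z = 0 ↔ _
    exact ⟨fun h0 a => by simp [h0], metricForm_nondeg hG⟩
  rw [hPDE2, hs.eq_zero_iff hu, hEL, hlap]
  have hn := hs.jacobiOp_normal hw hu
  have ht := fun a => hs.jacobiOp_tangent hτ hw hu a
  rw [coordLaplacian_const_mul hO hω hu] at hn
  have hs0 : s u₀ = y := hinv
  have hd1 : fderiv ℝ (fun u => (m : ℝ) * (f (s u) * H (s u))) u₀
      = (m : ℝ) • fderiv ℝ (fun u => f (s u) * H (s u)) u₀ :=
    fderiv_const_mul (differentiableAt_of_contDiffOn hO hω hu) _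
  have hd2 : fderiv ℝ (fun u => (m : ℝ) * H (s u)) u₀ = (m : ℝ) • fderiv ℝ (fun u => H (s u)) u₀ :=
    fderiv_const_mul (differentiableAt_of_contDiffOn hO hHs hu) _
  have hn' : metricForm (K (P u₀)) (jacobiOp G K P (fun u => ((m : ℝ) * (f (s u) * H (s u))) • X u) u₀)
      (X u₀) = m * (coordLaplacian G (fun u => f (s u) * H (s u)) u₀
        - f y * H y * (shapeNormSq g h φ ξ y - ricci h (φ y) (ξ y) (ξ y))) := by
    rw [hn, hs0, hnorm, hric']; ring
  -- With `w = m f H` and `μ = m H`, the mixed term and the Ricci term carry the factor `2m`, while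
  -- `w dμ = m² f H dH`. Extracting `-2m` therefore leaves the coefficient `m/2` in front of `grad
  -- H`.
  have ht' : ∀ a, metricForm (K (P u₀))
      (jacobiOp G K P (fun u => ((m : ℝ) * (f (s u) * H (s u))) • X u) u₀) (fderiv ℝ P u₀ a)
        = -2 * m * metricForm (G u₀) Z a := by
    intro a
    rw [ht, hZ, hd1, hs0]
    change _ - _ * fderiv ℝ (fun u => (m : ℝ) * H (s u)) u₀ a + _ = _
    rw [hd2]
    have e : ∑ i, ∑ j, (G u₀)⁻¹ i j * ((m : ℝ) • fderiv ℝ (fun u => f (s u) * H (s u)) u₀) (stdVec i) *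
          weingarten K P X u₀ (stdVec j) a
        = m * ∑ i, ∑ j, (G u₀)⁻¹ i j * fderiv ℝ (fun u => f (s u) * H (s u)) u₀ (stdVec i) *
          weingarten K P X u₀ (stdVec j) a := by
      simp only [Finset.mul_sum, smul_apply, smul_eq_mul]
      refine Finset.sum_congr rfl fun i _ => Finset.sum_congr rfl fun j _ => ?_
      ring
    rw [e, smul_apply, smul_eq_mul]
    ring
  rw [hn']
  simp only [ht']
  -- For `m = 0` everything vanishes: `H = 0`, the tangent space is trivial and the Laplacian is an
  -- empty sum. Otherwise the factors `m` and `-2m` can be cancelled.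
  rcases Nat.eq_zero_or_pos m with rfl | hm
  · have h0 := meanCurvature_eq_zero hξ hH
    have hZ0 : Z = 0 := Subsingleton.elim _ _
    simp [h0, hZ0, coordLaplacian]
  · have hm' : (m : ℝ) ≠ 0 := by positivity
    have h2 : (-2 * (m : ℝ)) ≠ 0 := mul_ne_zero (by norm_num) hm'
    simp only [mul_eq_zero, hm', h2, false_or]
    rfl

end BiharmonicEquations

end

theorem theorem3p1 {m : ℕ}
    {M : Type*} [TopologicalSpace M] [ChartedSpace (EuclideanSpace ℝ (Fin m)) M]
    [IsManifold (𝓡 m) ∞ M] [T2Space M] [SecondCountableTopology M]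
    [MeasurableSpace M] [BorelSpace M]
    {N : Type*} [TopologicalSpace N] [ChartedSpace (EuclideanSpace ℝ (Fin (m + 1))) N]
    [IsManifold (𝓡 (m + 1)) ∞ N] [T2Space N] [SecondCountableTopology N]
    (g : RMetric m M) (h : RMetric (m + 1) N)
    (φ : M → N) (hφ : IsIsometricImmersion g h φ)
    (ξ : ∀ x : M, TangentSpace (𝓡 (m + 1)) (φ x)) (hξ : IsUnitNormal (m := m) h φ ξ)
    (H : M → ℝ) (hH : ∀ x, meanCurvatureVector g h φ x = H x • ξ x)
    (f : M → ℝ) (hf : ContMDiff (𝓡 m) 𝓘(ℝ, ℝ) ∞ f) (hf_pos : ∀ x, 0 < f x) :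
    IsFBiharmonic g h f φ ↔
      ∀ x : M,
        laplacian g (fun y => f y * H y) x
            - f x * H x * (shapeNormSq g h φ ξ x - ricci h (φ x) (ξ x) (ξ x)) = 0 ∧
        shapeOperator g h φ ξ x (grad g (fun y => f y * H y) x)
            + (f x * H x) • (((m : ℝ) / 2) • grad g H x
                - tangentialPart g h φ x (ricciOp h (φ x) (ξ x))) = 0 :=
  (isFBiharmonic_iff_eulerLagrange hφ.1 hf).trans
    (forall_congr' (eulerLagrange_hypersurface_iff hφ hξ hH hf))
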